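/- Let $n\ge 1$ and $m=n+1$. Let $\mathcal H=\mathcal H_{2n+1}$ be the Heisenberg group of matrices $\begin{bmatrix}1&x^{T}&z\\0&I_n&y\\0&0&1\end{bmatrix}$, $x,y\in\mathbb R^n$, $z\in\mathbb R$, and let $M=\mathcal H\times(0,\infty)$, with $\phi$ the coordinate on $(0,\infty)$. With the left invariant 1-form $\zeta=\sum_i x_i\,dy_i-dz$ and \[ F_n(\phi)=2(-1)^{n+1}(n+1)!\,\frac1\phi\Big[\sum_{k=0}^{n+1}\frac{(-1)^k}{k!}\phi^k-e^{-\phi}\Big], \] consider on $M$ the Heisenberg soliton \[ g=\phi\sum_{i=1}^n(dx_i^2+dy_i^2)+\frac{F_n(\phi)}{\phi^{n-1}}\,\zeta^2+\frac{\phi^{n-1}}{F_n(\phi)}\,d\phi^2, \qquad f=-\phi , \] with the complex structure $J$ determined by $J\partial_{x_i}=\partial_{y_i}+x_i\partial_z$ and $J\partial_\phi=-\frac{\phi^{n-1}}{F_n(\phi)}\partial_z$. Then $(M,g,J)$ is a complete K\"ahler manifold, $(g,f)$ is an expanding gradient K\"ahler-Ricci soliton, $\mathrm{Ric}+\nabla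 df=-g$, the left translations by $\mathcal H$ are holomorphic isometries, and the following hold. 1. $-g<\mathrm{Ric}<0$ as quadratic forms on nonzero tangent vectors. 2. $-2m<\mathrm{Scal}<0$. 3. The sectional curvatures of $g$ are bounded. 4. Let $\psi_t$ be the flow, with $\psi_0=\mathrm{id}$, of the time-dependent vector field $\nabla f/(1+2t)$. For every $t>-\frac12$ it is a diffeomorphism of $M$, and the metrics $g(t)=(1+2t)\psi_t^*g$, $t>-\frac12$, form a solution of the Ricci flow $\partial_t g(t)=-2\mathrm{Ric}(g(t))$ with $g(0)=g$. It is of type III: for $t\ge 0$ the metrics $g(t)$ are complete with bounded curvature, and $\sup_{M\times(0,\infty)}t\,|\mathrm{Rm}(g(t))|<\infty$. 5. Let $\Gamma\subset\mathcal H$ be a discrete subgroup with compact quotient $\Gamma\backslash\mathcal H$ (for example, the subgroup of integer matrices is one). Then $\Gamma\backslash\mathcal H$ is Hausdorff, $\mathcal H\to\Gamma\backslash\mathcal H$ is a covering map with group $\Gamma$, and $\Gamma\backslash M=(\Gamma\backslash\mathcal H)\times(0,\infty)$ has exactly two ends, $\phi\to\infty$ and $\phi\to0$. For metrics $g_1,g_2$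 write $g_1\sim g_2$ at an end if the norm of $g_1-g_2$ with respect to $g_2$ tends to zero at that end (zeroth order asymptotics). The metric induced by $g$ on $\Gamma\backslash M$ is asymptotically conical at the end $\phi\to\infty$: with $r=\sqrt{2\phi}$, \[ g\sim dr^2+r^2\Big[\zeta^2+\tfrac12\sum_{i=1}^n(dx_i^2+dy_i^2)\Big]. \] At the end $\phi\to0$, \[ g\sim g_0=\phi\sum_{i=1}^n(dx_i^2+dy_i^2)+\frac{2\phi^2}{n+2}\,\zeta^2+\frac{n+2}{2\phi^2}\,d\phi^2, \] where $g_0$, with the complex structure $J_0$ determined by $J_0\partial_{x_i}=\partial_{y_i}+x_i\partial_z$ and $J_0\partial_\phi=-\frac{n+2}{2\phi^2}\partial_z$, is K\"ahler of constant holomorphic sectional curvature $-\frac2{n+2}$, and the left translations by $\mathcal H$ are holomorphic isometries of $(g_0,J_0)$. -/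

import Mathlib

open Set Filter Topology
open scoped ContDiff ENNReal

noncomputable section

/-! ### Riemannian geometry on an open set of coordinate space

Tensor fields on an open set `U` of `ι → ℝ` are functions of a point and of tangent vectors; only
their values at points of `U` matter. -/

section Geometry

variable {ι : Type} [Fintype ι] [DecidableEq ι]

/-- A covariant 2-tensor field: `g p v w` is its value at `p` on the vectors `v`, `w`. -/
abbrev TwoTensor (ι : Type) : Type := (ι → ℝ) → (ι → ℝ) → (ι → ℝ) → ℝ

/-- A field of endomorphisms of the tangent spaces. -/
abbrev EndoField (ι : Type) : Type := (ι → ℝ) → (ι → ℝ) → (ι → ℝ)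

/-- The `i`-th coordinate vector. -/
def coordVec (i : ι) : ι → ℝ := Pi.single i 1

/-- `g` is a smooth Riemannian metric on `U`. -/
structure IsRiemannianMetricOn (U : Set (ι → ℝ)) (g : TwoTensor ι) : Prop where
  add_left : ∀ p ∈ U, ∀ u v w, g p (u + v) w = g p u w + g p v w
  smul_left : ∀ p ∈ U, ∀ (c : ℝ) (v w), g p (c • v) w = c * g p v w
  symm : ∀ p ∈ U, ∀ v w, g p v w = g p w v
  pos : ∀ p ∈ U, ∀ v, v ≠ 0 → 0 < g p v v
  smooth : ∀ v w, ContDiffOn ℝ ∞ (fun p => g p v w) U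

/-- The Gram matrix `g_ij` of the coordinate vectors. -/
def gram (g : TwoTensor ι) (p : ι → ℝ) : Matrix ι ι ℝ :=
  Matrix.of fun i j => g p (coordVec i) (coordVec j)

/-- Raising an index: the vector with components `∑ l, g^{kl} α(e_l)`, which represents the linear
form `α` with respect to `g p`. -/
def sharp (g : TwoTensor ι) (p : ι → ℝ) (α : (ι → ℝ) → ℝ) : ι → ℝ :=
  fun k => ∑ l, (gram g p)⁻¹ k l * α (coordVec l)

/-- The derivative at `p` in the direction `u` of the function `g(v, w)`, where `v`, `w` are
constant vector fields. -/
def metricDeriv (g : TwoTensor ι) (p u v w : ι → ℝ) : ℝ :=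
  fderiv ℝ (fun q => g q v w) p u

/-- `∇_v w` at `p` for constant vector fields `v`, `w` and the Levi-Civita connection `∇` of `g`. -/
def christoffel (g : TwoTensor ι) (p v w : ι → ℝ) : ι → ℝ :=
  sharp g p fun x =>
    (1 / 2) * (metricDeriv g p v w x + metricDeriv g p w v x - metricDeriv g p x v w)

/-- The Riemann curvature tensor `R(u, v)w = ∇_u ∇_v w - ∇_v ∇_u w - ∇_{[u, v]} w`. -/
def riemann (g : TwoTensor ι) (p u v w : ι → ℝ) : ι → ℝ :=
  fderiv ℝ (fun q => christoffel g q v w) p u - fderiv ℝ (fun q => christoffel g q u w) p v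
    + christoffel g p u (christoffel g p v w) - christoffel g p v (christoffel g p u w)

/-- The Ricci curvature: the trace of `u ↦ R(u, v)w`. -/
def ricci (g : TwoTensor ι) : TwoTensor ι :=
  fun p v w => ∑ i, riemann g p (coordVec i) v w i

/-- The scalar curvature: the trace of the Ricci curvature with respect to `g`. -/
def scalarCurv (g : TwoTensor ι) (p : ι → ℝ) : ℝ :=
  ∑ i, sharp g p (fun w => ricci g p (coordVec i) w) i

/-- The sectional curvature of the plane spanned by `v` and `w`. -/
def secCurv (g : TwoTensor ι) (p v w : ι → ℝ) : ℝ :=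
  g p (riemann g p v w w) v / (g p v v * g p w w - g p v w ^ 2)

/-- The norm of the curvature tensor of `g` at `p` is at most `K`, that is,
`∑ Rm(e_i, e_j, e_k, e_l)² ≤ K²` for a `g p`-orthonormal basis `e`. -/
def CurvNormLE (g : TwoTensor ι) (p : ι → ℝ) (K : ℝ) : Prop :=
  ∀ e : ι → ι → ℝ, (∀ i j, g p (e i) (e j) = if i = j then 1 else 0) →
    √(∑ i, ∑ j, ∑ k, ∑ l, g p (riemann g p (e i) (e j) (e k)) (e l) ^ 2) ≤ K

/-- The gradient of `f`. -/
def gradField (g : TwoTensor ι) (f : (ι → ℝ) → ℝ) (p : ι → ℝ) : ι → ℝ :=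
  sharp g p fun v => fderiv ℝ f p v

/-- The Hessian `∇df`. -/
def hessian (g : TwoTensor ι) (f : (ι → ℝ) → ℝ) : TwoTensor ι :=
  fun p v w => fderiv ℝ (fun q => fderiv ℝ f q w) p v - fderiv ℝ f p (christoffel g p v w)

/-- The pull-back `ψ^* g`. -/
def pullback {κ : Type} [Fintype κ] (ψ : (ι → ℝ) → (κ → ℝ)) (g : TwoTensor κ) : TwoTensor ι :=
  fun p v w => g (ψ p) (fderiv ℝ ψ p v) (fderiv ℝ ψ p w)

/-- `ψ` restricts to a smooth diffeomorphism of `U` onto itself. -/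
def IsDiffeoOn (U : Set (ι → ℝ)) (ψ : (ι → ℝ) → (ι → ℝ)) : Prop :=
  ContDiffOn ℝ ∞ ψ U ∧ MapsTo ψ U U ∧
    ∃ χ : (ι → ℝ) → (ι → ℝ), ContDiffOn ℝ ∞ χ U ∧ MapsTo χ U U ∧ InvOn χ ψ U U

/-- The length of a curve `[0, 1] → U`. -/
def curveLength (g : TwoTensor ι) (γ : ℝ → ι → ℝ) : ℝ≥0∞ :=
  ∫⁻ t in Icc (0 : ℝ) 1, ENNReal.ofReal √(g (γ t) (deriv γ t) (deriv γ t))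

/-- The Riemannian distance on `U`: the infimum of the lengths of `C^1` curves in `U`. -/
def riemDist (U : Set (ι → ℝ)) (g : TwoTensor ι) (p q : ι → ℝ) : ℝ≥0∞ :=
  ⨅ (γ : ℝ → ι → ℝ) (_ : ContDiffOn ℝ 1 γ (Icc 0 1) ∧ MapsTo γ (Icc 0 1) U ∧ γ 0 = p ∧ γ 1 = q),
    curveLength g γ

/-- `(U, g)` is complete: each sequence in `U` that is Cauchy for the Riemannian distance converges
to a point of `U`. -/
def IsCompleteOn (U : Set (ι → ℝ)) (g : TwoTensor ι) : Prop :=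
  ∀ a : ℕ → ι → ℝ, (∀ k, a k ∈ U) →
    (∀ ε : ℝ≥0∞, 0 < ε → ∃ N, ∀ k ≥ N, ∀ l ≥ N, riemDist U g (a k) (a l) < ε) →
    ∃ q ∈ U, Tendsto a atTop (𝓝 q)

/-- `(U, g, J)` is a Kähler manifold: `J` is a smooth `g`-orthogonal almost complex structure that
is parallel for the Levi-Civita connection. -/
structure IsKahlerOn (U : Set (ι → ℝ)) (g : TwoTensor ι) (J : EndoField ι) : Prop where
  metric : IsRiemannianMetricOn U g
  add : ∀ p ∈ U, ∀ v w, J p (v + w) = J p v + J p w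
  smul : ∀ p ∈ U, ∀ (c : ℝ) (v), J p (c • v) = c • J p v
  smooth : ∀ v, ContDiffOn ℝ ∞ (fun p => J p v) U
  sq : ∀ p ∈ U, ∀ v, J p (J p v) = -v
  orthogonal : ∀ p ∈ U, ∀ v w, g p (J p v) (J p w) = g p v w
  parallel : ∀ p ∈ U, ∀ v w,
    fderiv ℝ (fun q => J q w) p v + christoffel g p v (J p w) - J p (christoffel g p v w) = 0

/-- `(g, f)` is a gradient Kähler-Ricci soliton: `Ric + ∇df = lam g` for a Kähler metric `g`. -/
structure IsKahlerRicciSolitonOn (U : Set (ι → ℝ)) (g : TwoTensor ι) (J : EndoField ι)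
    (f : (ι → ℝ) → ℝ) (lam : ℝ) : Prop where
  kahler : IsKahlerOn U g J
  smooth : ContDiffOn ℝ ∞ f U
  soliton : ∀ p ∈ U, ∀ v w, ricci g p v w + hessian g f p v w = lam * g p v w

/-- All holomorphic sectional curvatures are equal to `c`. -/
def HasConstantHolSecCurvOn (U : Set (ι → ℝ)) (g : TwoTensor ι) (J : EndoField ι) (c : ℝ) : Prop :=
  ∀ p ∈ U, ∀ v, v ≠ 0 → secCurv g p v (J p v) = c

/-- The metrics `G t`, for `t` in the interval `T`, are a smooth solution of the Ricci flow
`∂G/∂t = -2 Ric(G t)` on `U`. -/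
structure IsRicciFlowOn (T : Set ℝ) (U : Set (ι → ℝ)) (G : ℝ → TwoTensor ι) : Prop where
  metric : ∀ t ∈ T, IsRiemannianMetricOn U (G t)
  smooth : ∀ v w, ContDiffOn ℝ ∞ (fun x : ℝ × (ι → ℝ) => G x.1 x.2 v w) (T ×ˢ U)
  flow : ∀ t ∈ T, ∀ p ∈ U, ∀ v w,
    HasDerivWithinAt (fun s => G s p v w) (-2 * ricci (G t) p v w) T t

/-- A Ricci flow of type III: it exists for all positive time, by complete metrics of bounded
curvature, and `t |Rm(G t)|` is bounded. -/
structure IsTypeIII (U : Set (ι → ℝ)) (G : ℝ → TwoTensor ι) : Prop where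
  flow : IsRicciFlowOn (Ici 0) U G
  complete : ∀ t, 0 ≤ t → IsCompleteOn U (G t)
  bounded : ∀ t, 0 ≤ t → ∃ K, ∀ p ∈ U, CurvNormLE (G t) p K
  decay : ∃ C, ∀ t, 0 < t → ∀ p ∈ U, CurvNormLE (G t) p (C / t)

/-- The times for which the self-similar flow of a soliton with soliton constant `lam` exists. -/
def lifeSpan (lam : ℝ) : Set ℝ := {t | 0 < 1 - 2 * lam * t}

/-- The diffeomorphisms `ψ t` of `U` are the flow, starting at the identity, of the time-dependent
vector field `∇f / (1 - 2 lam t)`. -/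
structure IsSolitonDiffeos (U : Set (ι → ℝ)) (g : TwoTensor ι) (f : (ι → ℝ) → ℝ) (lam : ℝ)
    (ψ : ℝ → (ι → ℝ) → (ι → ℝ)) : Prop where
  smooth : ContDiffOn ℝ ∞ (fun x : ℝ × (ι → ℝ) => ψ x.1 x.2) (lifeSpan lam ×ˢ U)
  diffeo : ∀ t ∈ lifeSpan lam, IsDiffeoOn U (ψ t)
  zero : ∀ p ∈ U, ψ 0 p = p
  ode : ∀ t ∈ lifeSpan lam, ∀ p ∈ U,
    HasDerivAt (fun s => ψ s p) ((1 - 2 * lam * t)⁻¹ • gradField g f (ψ t p)) t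

/-- The family of metrics `(1 - 2 lam t) ψ_t^* g`. -/
def selfSimilarFlow (g : TwoTensor ι) (lam : ℝ) (ψ : ℝ → (ι → ℝ) → (ι → ℝ)) : ℝ → TwoTensor ι :=
  fun t p v w => (1 - 2 * lam * t) * pullback (ψ t) g p v w

end Geometry

/-! ### Ends of a topological space -/

/-- An end of `X`, as a filter: it is generated by the sets `C K`, where `C` is a choice, for each
compact `K`, of a connected component of `X ∖ K` such that `C L ⊆ C K` when `K ⊆ L`. -/
def IsEnd {X : Type} [TopologicalSpace X] (F : Filter X) : Prop :=
  ∃ C : Set X → Set X,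
    (∀ K, IsCompact K → ∃ x ∈ Kᶜ, C K = connectedComponentIn Kᶜ x) ∧
    (∀ K L, IsCompact K → IsCompact L → K ⊆ L → C L ⊆ C K) ∧
    F = ⨅ (K : Set X) (_ : IsCompact K), 𝓟 (C K)

/-! ### The Heisenberg group -/

/-- The Heisenberg group of dimension `2n+1`; `⟨x, y, z⟩` is the block matrix
`[1, xᵀ, z; 0, I, y; 0, 0, 1]`. -/
@[ext] structure Heis (n : ℕ) : Type where
  x : Fin n → ℝ
  y : Fin n → ℝ
  z : ℝ

/-- Indices of the coordinates `x_i`, `y_i`, `z` of the Heisenberg group. -/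
abbrev HIdx (n : ℕ) : Type := Fin n ⊕ Fin n ⊕ Unit

namespace Heis

variable {n : ℕ}

instance : Mul (Heis n) :=
  ⟨fun a b => ⟨a.x + b.x, a.y + b.y, a.z + b.z + ∑ i, a.x i * b.y i⟩⟩

instance : One (Heis n) := ⟨⟨0, 0, 0⟩⟩

instance : Inv (Heis n) := ⟨fun a => ⟨-a.x, -a.y, -a.z + ∑ i, a.x i * a.y i⟩⟩

@[simp] theorem mul_x (a b : Heis n) : (a * b).x = a.x + b.x := rfl

@[simp] theorem mul_y (a b : Heis n) : (a * b).y = a.y + b.y := rfl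

@[simp] theorem mul_z (a b : Heis n) : (a * b).z = a.z + b.z + ∑ i, a.x i * b.y i := rfl

@[simp] theorem one_x : (1 : Heis n).x = 0 := rfl

@[simp] theorem one_y : (1 : Heis n).y = 0 := rfl

@[simp] theorem one_z : (1 : Heis n).z = 0 := rfl

@[simp] theorem inv_x (a : Heis n) : a⁻¹.x = -a.x := rfl

@[simp] theorem inv_y (a : Heis n) : a⁻¹.y = -a.y := rfl

@[simp] theorem inv_z (a : Heis n) : a⁻¹.z = -a.z + ∑ i, a.x i * a.y i := rfl

instance : Group (Heis n) :=
  Group.ofLeftAxioms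
    (fun a b c => by
      ext i
      · simp [add_assoc]
      · simp [add_assoc]
      · simp only [mul_z, mul_x, mul_y, Pi.add_apply, add_mul, mul_add, Finset.sum_add_distrib]
        ring)
    (fun a => by ext i <;> simp)
    (fun a => by ext i <;> simp)

/-- The coordinates `(x, y, z)` of a group element. -/
def coords (a : Heis n) : HIdx n → ℝ := Sum.elim a.x (Sum.elim a.y fun _ => a.z)

/-- The group element with given coordinates. -/
def ofCoords (q : HIdx n → ℝ) : Heis n :=
  ⟨fun i => q (.inl i), fun i => q (.inr (.inl i)), q (.inr (.inr ()))⟩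

instance : TopologicalSpace (Heis n) := TopologicalSpace.induced coords inferInstance

/-- Left translation by `a`, in coordinates. -/
def translBase (a : Heis n) (q : HIdx n → ℝ) : HIdx n → ℝ := (a * ofCoords q).coords

/-- The subgroup of matrices with integer entries. -/
def integerLattice (n : ℕ) : Subgroup (Heis n) where
  carrier := {a | (∀ i, ∃ k : ℤ, a.x i = k) ∧ (∀ i, ∃ k : ℤ, a.y i = k) ∧ ∃ k : ℤ, a.z = k}
  one_mem' := ⟨fun _ => ⟨0, by simp⟩, fun _ => ⟨0, by simp⟩, 0, by simp⟩
  mul_mem' := by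
    rintro a b ⟨hax, hay, kz, hz⟩ ⟨hbx, hby, lz, hz'⟩
    choose k hk using hax
    choose k' hk' using hay
    choose l hl using hbx
    choose l' hl' using hby
    exact ⟨fun i => ⟨k i + l i, by simp [hk, hl]⟩, fun i => ⟨k' i + l' i, by simp [hk', hl']⟩,
      kz + lz + ∑ i, k i * l' i, by simp [hz, hz', hk, hl']⟩
  inv_mem' := by
    rintro a ⟨hax, hay, kz, hz⟩
    choose k hk using hax
    choose k' hk' using hay
    exact ⟨fun i => ⟨-k i, by simp [hk]⟩, fun i => ⟨-k' i, by simp [hk']⟩,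
      -kz + ∑ i, k i * k' i, by simp [hz, hk, hk']⟩

/-- The orbit space `Γ \ H` of the left multiplication action of a subgroup. -/
abbrev Nil (Γ : Subgroup (Heis n)) : Type := MulAction.orbitRel.Quotient Γ (Heis n)

/-- A discrete subgroup with compact orbit space. -/
structure IsLattice (Γ : Subgroup (Heis n)) : Prop where
  discrete : DiscreteTopology Γ
  cocompact : CompactSpace (Nil Γ)

end Heis

/-! ### The manifold `H × (0, ∞)` and its metrics -/

/-- Indices of the coordinates `x_i`, `y_i`, `z`, `φ` of `H × (0, ∞)`. -/
abbrev MIdx (n : ℕ) : Type := HIdx n ⊕ Unit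

/-- The coordinate `φ` of a point, or the component `dφ(v)` of a vector. -/
def phi {n : ℕ} (p : MIdx n → ℝ) : ℝ := p (.inr ())

/-- The coordinates `(x, y, z)` of a point, or the corresponding components of a vector. -/
def base {n : ℕ} (p : MIdx n → ℝ) : HIdx n → ℝ := fun a => p (.inl a)

/-- The coordinate domain of the manifold `H × (0, ∞)`. -/
def halfSpace (n : ℕ) : Set (MIdx n → ℝ) := {p | 0 < phi p}

/-- The action of `H` on `H × (0, ∞)` by left multiplication on the first factor. -/
def transl {n : ℕ} (a : Heis n) (p : MIdx n → ℝ) : MIdx n → ℝ :=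
  Sum.elim (a.translBase (base p)) fun _ => phi p

/-- The left invariant 1-form `ζ = ∑ x_i dy_i - dz` at `q`, evaluated on `v`. -/
def zeta {n : ℕ} (q v : HIdx n → ℝ) : ℝ := ∑ i, q (.inl i) * v (.inr (.inl i)) - v (.inr (.inr ()))

/-- The tensor `∑ (dx_i² + dy_i²)` evaluated on `v`, `w`. -/
def horiz {n : ℕ} (v w : HIdx n → ℝ) : ℝ :=
  ∑ i, (v (.inl i) * w (.inl i) + v (.inr (.inl i)) * w (.inr (.inl i)))

/-- The metric `φ ∑ (dx_i² + dy_i²) + h(φ) ζ² + dφ² / h(φ)`. -/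
def heisMetric (n : ℕ) (h : ℝ → ℝ) : TwoTensor (MIdx n) := fun p v w =>
  phi p * horiz (base v) (base w) + h (phi p) * (zeta (base p) (base v) * zeta (base p) (base w))
    + phi v * phi w / h (phi p)

/-- The almost complex structure with `J X_i = Y_i` and `J ∂_φ = Z / h(φ)`, for the left invariant
fields `X_i = ∂_{x_i}`, `Y_i = ∂_{y_i} + x_i ∂_z`, `Z = -∂_z`. -/
def heisJ (n : ℕ) (h : ℝ → ℝ) : EndoField (MIdx n) := fun p v =>
  Sum.elim
    (Sum.elim (fun i => -base v (.inr (.inl i)))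
      (Sum.elim (fun i => base v (.inl i))
        fun _ => ∑ i, base p (.inl i) * base v (.inl i) - phi v / h (phi p)))
    fun _ => -(h (phi p) * zeta (base p) (base v))

/-- The function `F_n(φ) = 2 (-1)^{n+1} (n+1)! φ⁻¹ (∑_{k=0}^{n+1} (-1)^k φ^k / k! - e^{-φ})`. -/
def profileF (n : ℕ) (s : ℝ) : ℝ :=
  2 * (-1) ^ (n + 1) * ((n + 1).factorial : ℝ) * (1 / s)
    * (∑ k ∈ Finset.range (n + 2), (-1) ^ k / (k.factorial : ℝ) * s ^ k - Real.exp (-s))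

/-- The function `F_n(φ) / φ^{n-1}`, for `n ≥ 1`. -/
def solProfile (n : ℕ) (s : ℝ) : ℝ := profileF n s / s ^ (n - 1)

/-- The Heisenberg soliton
`φ ∑ (dx_i² + dy_i²) + (F_n(φ) / φ^{n-1}) ζ² + (φ^{n-1} / F_n(φ)) dφ²`. -/
def solMetric (n : ℕ) : TwoTensor (MIdx n) := heisMetric n (solProfile n)

/-- The complex structure of the Heisenberg soliton. -/
def solJ (n : ℕ) : EndoField (MIdx n) := heisJ n (solProfile n)

/-- The soliton potential `f = -φ`. -/
def solPotential (n : ℕ) (p : MIdx n → ℝ) : ℝ := -phi p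

/-- The metric `φ ∑ (dx_i² + dy_i²) + (2 φ² / (n+2)) ζ² + ((n+2) / (2 φ²)) dφ²`. -/
def cuspMetric (n : ℕ) : TwoTensor (MIdx n) := heisMetric n fun s => 2 * s ^ 2 / (n + 2)

/-- The complex structure of `cuspMetric`. -/
def cuspJ (n : ℕ) : EndoField (MIdx n) := heisJ n fun s => 2 * s ^ 2 / (n + 2)

/-- The left invariant metric `ζ² + (1/2) ∑ (dx_i² + dy_i²)` on `H`. -/
def linkMetric (n : ℕ) : TwoTensor (HIdx n) := fun q v w =>
  zeta q v * zeta q w + 1 / 2 * horiz v w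

/-- The cone metric `dr² + r² k` on `H × (0, ∞)`, with `r` the last coordinate, over a metric `k`
on `H`. -/
def coneMetric {n : ℕ} (k : TwoTensor (HIdx n)) : TwoTensor (MIdx n) := fun p v w =>
  phi v * phi w + phi p ^ 2 * k (base p) (base v) (base w)

/-- The change of coordinates `(x, y, z, φ) ↦ (x, y, z, r)` with `r = √(2 φ)`. -/
def toRadius (n : ℕ) (p : MIdx n → ℝ) : MIdx n → ℝ := Sum.elim (base p) fun _ => √(2 * phi p)

/-- The left translation by `a` preserves the metric `g` on `H × (0, ∞)`. -/
def IsIsometricTransl {n : ℕ} (a : Heis n) (g : TwoTensor (MIdx n)) : Prop :=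
  ∀ p ∈ halfSpace n, ∀ v w, pullback (transl a) g p v w = g p v w

/-- The left translation by `a` preserves the endomorphism field `J` on `H × (0, ∞)`. -/
def IsHolomorphicTransl {n : ℕ} (a : Heis n) (J : EndoField (MIdx n)) : Prop :=
  ∀ p ∈ halfSpace n, ∀ v,
    fderiv ℝ (transl a) p (J p v) = J (transl a p) (fderiv ℝ (transl a) p v)

/-! ### The quotient `(Γ \ H) × (0, ∞)`

Tensor fields on the quotient are the `Γ`-invariant tensor fields on `H × (0, ∞)`. -/

namespace Heis

variable {n : ℕ}

/-- The quotient of `H × (0, ∞)` by a subgroup `Γ` of `H`. -/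
abbrev QuotSpace (Γ : Subgroup (Heis n)) : Type := Nil Γ × Ioi (0 : ℝ)

/-- The projection of `H × (0, ∞)` onto its quotient. -/
def proj (Γ : Subgroup (Heis n)) (p : halfSpace n) : QuotSpace Γ :=
  (Quotient.mk _ (ofCoords (base p.1)), ⟨phi p.1, p.2⟩)

/-- The end `φ → ∞` of the quotient. -/
def endInfty (Γ : Subgroup (Heis n)) : Filter (QuotSpace Γ) :=
  comap (fun q => (q.2 : ℝ)) atTop

/-- The end `φ → 0` of the quotient. -/
def endZero (Γ : Subgroup (Heis n)) : Filter (QuotSpace Γ) :=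
  comap (fun q => (q.2 : ℝ)) (𝓝 0)

/-- The metric on the quotient induced by `g` is asymptotic along `F`, in zeroth order, to the one
induced by `g'`: the norm of `g - g'` with respect to `g'` tends to zero. -/
structure IsAsymptotic (Γ : Subgroup (Heis n)) (F : Filter (QuotSpace Γ))
    (g g' : TwoTensor (MIdx n)) : Prop where
  metric : IsRiemannianMetricOn (halfSpace n) g
  metric' : IsRiemannianMetricOn (halfSpace n) g'
  descends : ∀ a ∈ Γ, IsIsometricTransl a g
  descends' : ∀ a ∈ Γ, IsIsometricTransl a g'
  lim : ∀ ε > 0, ∀ᶠ q in F, ∀ p : halfSpace n, proj Γ p = q →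
    ∀ v, |g p.1 v v - g' p.1 v v| ≤ ε * g' p.1 v v

/-- The metric on the quotient induced by `g` is asymptotically conical along `F`, in zeroth order:
a `Γ`-equivariant diffeomorphism `Φ`, whose radial component `r` tends to infinity along `F`, makes
it asymptotic to the cone `dr² + r² k` over `Γ \ H` with the metric induced by `k`. -/
structure IsAsymptoticallyConical (Γ : Subgroup (Heis n)) (F : Filter (QuotSpace Γ))
    (g : TwoTensor (MIdx n)) (k : TwoTensor (HIdx n))
    (Φ : (MIdx n → ℝ) → (MIdx n → ℝ)) : Prop where
  link : IsRiemannianMetricOn univ k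
  link_descends : ∀ a ∈ Γ, ∀ q v w, pullback (translBase a) k q v w = k q v w
  diffeo : IsDiffeoOn (halfSpace n) Φ
  equivariant : ∀ a ∈ Γ, ∀ p ∈ halfSpace n, Φ (transl a p) = transl a (Φ p)
  radius : ∀ R : ℝ, ∀ᶠ q in F, ∀ p : halfSpace n, proj Γ p = q → R < phi (Φ p.1)
  asymptotic : IsAsymptotic Γ F g (pullback Φ (coneMetric k))

end Heis

end

/-! The metric belongs to a family `heisMetric n h` governed by one positive function `h` of `φ`,
and the geometry is computed for arbitrary `h`. The Kähler form is the exact form `d(φ ζ)` whatever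
`h` is, and `h` is the squared norm of the gradient of `φ`. In the left invariant coframe the
curvature is a combination of tensors of space form type with the coefficients `-h/φ²`, `-h''/2` and
`-(h/φ)'` (`IsProfile.inner_riemann`). Hence `Ric` and `∇dφ` are both scalar on the horizontal part
(`dx`, `dy`) and on the vertical part (`ζ`, `dφ`). For `f = -φ` the horizontal part of the soliton
equation is the ODE `h' + h + n h/φ = 2φ`, and the vertical part is its derivative. So `P = φ^n h`
solves `P' + P = 2 φ^(n+1)`; with `P(0) = 0` the solution is the Taylor remainder of `e^{-φ}` that
appears in `F_n`.

By the ODE the Ricci eigenvalues are `-1 + h/(2φ)` and `-1 + h'/2`, so the Ricci and scalar bounds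
amount to `0 < h < 2φ` and `0 < h' < 2`. These, and the two-sided estimates of `h` at both ends,
come from one principle (`pos_of_deriv_add_self_pos`): if `f(0) = 0` and `f' + f > 0`, then `f > 0`.
The ODE makes `f' + f` simple for each `f` built from `P` and powers of `φ`. The same estimates
bound the three curvature coefficients.

Completeness: `h ≤ φ²` makes `log φ` 1-Lipschitz, so a Cauchy sequence keeps `φ` in a compact part
of `(0, ∞)`, where the other coordinates are controlled in turn (`IsProfile.isCompleteOn`). The
gradient field `-h ∂_φ` is complete because `h < 2φ`. Its flow, run for the time `½ log(1 + 2t)`,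
gives the self-similar metrics; naturality of the curvature under diffeomorphisms and scaling yields
the Ricci flow equation and the decay of `Rm` like `1/(1 + 2t)`.

On a quotient by a lattice the first factor is compact and connected, so the two ends are those of
`(0, ∞)`. Two metrics of the family are asymptotic when the quotient of their profiles tends to `1`.
The cone is the member with `h = 2φ`, and the model at `φ → 0` is the member with `h = 2φ²/(n+2)`,
for which the three curvature coefficients coincide. -/

noncomputable section

set_option linter.unusedSectionVars false

/-! ### Raising indices and the Koszul characterisation of the connection. -/

section Sharp

variable {ι : Type} [Fintype ι] [DecidableEq ι]

/-- A linear map on coordinate space is determined by its values on coordinate vectors. -/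
theorem IsLinearMap.eq_sum_coordVec {F : Type*} [AddCommGroup F] [Module ℝ F]
    {f : (ι → ℝ) → F} (hf : IsLinearMap ℝ f) (v : ι → ℝ) :
    f v = ∑ i, v i • f (coordVec i) := by
  have h := LinearMap.pi_apply_eq_sum_univ hf.mk' v
  simp only [IsLinearMap.mk'_apply] at h
  rw [h]
  refine Finset.sum_congr rfl fun i _ => ?_
  congr 2
  funext j
  simp [coordVec, Pi.single_apply, eq_comm]

namespace IsRiemannianMetricOn

variable {U : Set (ι → ℝ)} {g : TwoTensor ι} (hg : IsRiemannianMetricOn U g)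
  {p : ι → ℝ} (hp : p ∈ U)

include hg hp

theorem isLinearMap_left (w : ι → ℝ) : IsLinearMap ℝ fun v => g p v w :=
  ⟨fun u v => hg.add_left p hp u v w, fun c v => hg.smul_left p hp c v w⟩

theorem isLinearMap_right (v : ι → ℝ) : IsLinearMap ℝ fun w => g p v w := by
  refine ⟨fun u w => ?_, fun c w => ?_⟩
  · rw [hg.symm p hp v, hg.add_left p hp, hg.symm p hp u, hg.symm p hp w]
  · rw [hg.symm p hp v, hg.smul_left p hp, hg.symm p hp w, smul_eq_mul]

theorem gram_mulVec (v : ι → ℝ) (k : ι) : (gram g p).mulVec v k = g p v (coordVec k) := by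
  rw [(hg.isLinearMap_left hp _).eq_sum_coordVec v]
  simp only [Matrix.mulVec, dotProduct, gram, Matrix.of_apply, smul_eq_mul]
  exact Finset.sum_congr rfl fun i _ => by rw [hg.symm p hp, mul_comm]

/-- Positive definiteness: a vector killed by the Gram matrix is orthogonal to every coordinate
vector, hence to itself. -/
theorem isUnit_gram : IsUnit (gram g p) := by
  rw [← Matrix.mulVec_injective_iff_isUnit]
  intro v w hvw
  by_contra hne
  have h0 : ∀ x, g p (v - w) x = 0 := by
    intro x
    rw [(hg.isLinearMap_right hp _).eq_sum_coordVec x]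
    refine Finset.sum_eq_zero fun k _ => ?_
    have h1 := hg.gram_mulVec hp (v - w) k
    rw [Matrix.mulVec_sub] at h1
    have hvw' : (gram g p).mulVec v = (gram g p).mulVec w := hvw
    rw [← h1, hvw', sub_self]
    simp
  exact (hg.pos p hp _ (sub_ne_zero.mpr hne)).ne' (h0 _)

/-- A vector with the inner products prescribed by `α` on coordinate vectors is `sharp α`. -/
theorem sharp_eq {α : (ι → ℝ) → ℝ} {s : ι → ℝ} (h : ∀ k, g p s (coordVec k) = α (coordVec k)) :
    sharp g p α = s := by
  have hs : (fun k => α (coordVec k)) = (gram g p).mulVec s := by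
    funext k
    rw [hg.gram_mulVec hp, h]
  have : sharp g p α = (gram g p)⁻¹.mulVec fun k => α (coordVec k) := by
    funext k
    simp [sharp, Matrix.mulVec, dotProduct]
  rw [this, hs, Matrix.mulVec_mulVec, Matrix.nonsing_inv_mul _
    ((Matrix.isUnit_iff_isUnit_det _).mp (hg.isUnit_gram hp)), Matrix.one_mulVec]

/-- Linearity of `α` enters because `sharp` only sees the values of `α` on coordinate vectors. -/
theorem inner_sharp {α : (ι → ℝ) → ℝ} (hα : IsLinearMap ℝ α) (x : ι → ℝ) :
    g p (sharp g p α) x = α x := by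
  rw [(hg.isLinearMap_right hp _).eq_sum_coordVec x, hα.eq_sum_coordVec x]
  refine Finset.sum_congr rfl fun k _ => ?_
  congr 1
  have h1 : sharp g p α = (gram g p)⁻¹.mulVec fun k => α (coordVec k) := by
    funext k
    simp [sharp, Matrix.mulVec, dotProduct]
  rw [← hg.gram_mulVec hp, h1, Matrix.mulVec_mulVec, Matrix.mul_nonsing_inv _
    ((Matrix.isUnit_iff_isUnit_det _).mp (hg.isUnit_gram hp)), Matrix.one_mulVec]

theorem ext_inner {s t : ι → ℝ} (h : ∀ x, g p s x = g p t x) : s = t := by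
  by_contra hne
  refine (hg.pos p hp _ (sub_ne_zero.mpr hne)).ne' ?_
  have := (hg.isLinearMap_left hp (s - t)).mk'.map_sub s t
  simp only [IsLinearMap.mk'_apply] at this
  rw [this, h, sub_self]

/-- This turns the computation of a connection into the verification of a guess: no Gram matrix has
to be inverted. -/
theorem christoffel_eq {v w s : ι → ℝ} (h : ∀ x, g p s x =
      (1 / 2) * (metricDeriv g p v w x + metricDeriv g p w v x - metricDeriv g p x v w)) :
    christoffel g p v w = s :=
  hg.sharp_eq hp fun _ => h _

end IsRiemannianMetricOn

end Sharp

/-- The directional derivative computed along a line. -/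
theorem DifferentiableAt.fderiv_eq_of_line {E F : Type*} [NormedAddCommGroup E] [NormedSpace ℝ E]
    [NormedAddCommGroup F] [NormedSpace ℝ F] {f : E → F} {p u : E} {d : F}
    (hf : DifferentiableAt ℝ f p) (h : HasDerivAt (fun t : ℝ => f (p + t • u)) d 0) :
    fderiv ℝ f p u = d :=
  hf.lineDeriv_eq_fderiv.symm.trans h.deriv

/-! ### The left invariant coframe. -/

section HeisFrame

variable {n : ℕ}

/-- The bilinear form `∑ dx_i ⊗ dy_i`. -/
def horizXY (v w : HIdx n → ℝ) : ℝ := ∑ i, v (.inl i) * w (.inr (.inl i))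

/-- The standard complex structure of the horizontal directions; the `z`-component is dropped. -/
def rot (v : HIdx n → ℝ) : HIdx n → ℝ :=
  Sum.elim (fun i => -v (.inr (.inl i))) (Sum.elim (fun i => v (.inl i)) 0)

/-- The tangent vector at `p` with horizontal part `b`, with `ζ = c` and `dφ = d`. -/
def ofFrame (p : MIdx n → ℝ) (b : HIdx n → ℝ) (c d : ℝ) : MIdx n → ℝ :=
  Sum.elim (Sum.elim (fun i => b (.inl i)) (Sum.elim (fun i => b (.inr (.inl i)))
    fun _ => horizXY (base p) b - c)) fun _ => d

theorem phi_add (v w : MIdx n → ℝ) : phi (v + w) = phi v + phi w := rfl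
theorem phi_smul (c : ℝ) (v : MIdx n → ℝ) : phi (c • v) = c * phi v := rfl
theorem base_add (v w : MIdx n → ℝ) : base (v + w) = base v + base w := rfl
theorem base_smul (c : ℝ) (v : MIdx n → ℝ) : base (c • v) = c • base v := rfl

theorem horiz_comm (v w : HIdx n → ℝ) : horiz v w = horiz w v := by
  simp only [horiz, mul_comm]

theorem horiz_add_left (u v w : HIdx n → ℝ) : horiz (u + v) w = horiz u w + horiz v w := by
  simp only [horiz, ← Finset.sum_add_distrib, Pi.add_apply]
  exact Finset.sum_congr rfl fun _ _ => by ring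

theorem horiz_smul_left (c : ℝ) (v w : HIdx n → ℝ) : horiz (c • v) w = c * horiz v w := by
  simp only [horiz, Finset.mul_sum, Pi.smul_apply, smul_eq_mul]
  exact Finset.sum_congr rfl fun _ _ => by ring

theorem horiz_add_right (u v w : HIdx n → ℝ) : horiz w (u + v) = horiz w u + horiz w v := by
  simp only [horiz_comm w, horiz_add_left]

theorem horiz_smul_right (c : ℝ) (v w : HIdx n → ℝ) : horiz w (c • v) = c * horiz w v := by
  simp only [horiz_comm w, horiz_smul_left]

theorem horizXY_add_left (u v w : HIdx n → ℝ) :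
    horizXY (u + v) w = horizXY u w + horizXY v w := by
  simp only [horizXY, ← Finset.sum_add_distrib, Pi.add_apply, add_mul]

theorem horizXY_smul_left (c : ℝ) (v w : HIdx n → ℝ) : horizXY (c • v) w = c * horizXY v w := by
  simp only [horizXY, Finset.mul_sum, Pi.smul_apply, smul_eq_mul, mul_assoc]

theorem horizXY_add_right (u v w : HIdx n → ℝ) :
    horizXY w (u + v) = horizXY w u + horizXY w v := by
  simp only [horizXY, ← Finset.sum_add_distrib, Pi.add_apply, mul_add]

theorem horizXY_smul_right (c : ℝ) (v w : HIdx n → ℝ) : horizXY w (c • v) = c * horizXY w v := by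
  simp only [horizXY, Finset.mul_sum, Pi.smul_apply, smul_eq_mul]
  exact Finset.sum_congr rfl fun _ _ => by ring

theorem rot_add (v w : HIdx n → ℝ) : rot (v + w) = rot v + rot w := by
  ext (i | i | i) <;> simp [rot, add_comm]

theorem rot_smul (c : ℝ) (v : HIdx n → ℝ) : rot (c • v) = c • rot v := by
  ext (i | i | i) <;> simp [rot]

/-- The symplectic form of the horizontal directions. -/
theorem horiz_rot_left (v w : HIdx n → ℝ) : horiz (rot v) w = horizXY v w - horizXY w v := by
  simp only [horiz, horizXY, rot, ← Finset.sum_sub_distrib, Sum.elim_inl, Sum.elim_inr]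
  exact Finset.sum_congr rfl fun _ _ => by ring

theorem horiz_rot_right (v w : HIdx n → ℝ) : horiz v (rot w) = horizXY w v - horizXY v w := by
  rw [horiz_comm, horiz_rot_left]

theorem horizXY_rot_sub (v w : HIdx n → ℝ) :
    horizXY (rot v) w - horizXY w (rot v) = -horiz v w := by
  simp only [horizXY, horiz, rot, ← Finset.sum_neg_distrib, ← Finset.sum_sub_distrib, Sum.elim_inl,
    Sum.elim_inr]
  exact Finset.sum_congr rfl fun _ _ => by ring

theorem horiz_self_nonneg (v : HIdx n → ℝ) : 0 ≤ horiz v v :=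
  Finset.sum_nonneg fun _ _ => add_nonneg (mul_self_nonneg _) (mul_self_nonneg _)

theorem zeta_eq (q v : HIdx n → ℝ) : zeta q v = horizXY q v - v (.inr (.inr ())) := rfl

theorem zeta_add (q v w : HIdx n → ℝ) : zeta q (v + w) = zeta q v + zeta q w := by
  simp only [zeta_eq, horizXY_add_right, Pi.add_apply]; ring

theorem zeta_smul (q : HIdx n → ℝ) (c : ℝ) (v : HIdx n → ℝ) : zeta q (c • v) = c * zeta q v := by
  simp only [zeta_eq, horizXY_smul_right, Pi.smul_apply, smul_eq_mul]; ring

/-- `ζ` is affine in the base point, with linear part `horizXY`. This is the only trace of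
non-commutativity in the calculations below; antisymmetrised, it says `dζ = ∑ dx_i ∧ dy_i`. -/
theorem zeta_line (q u v : HIdx n → ℝ) (t : ℝ) :
    zeta (q + t • u) v = zeta q v + t * horizXY u v := by
  simp only [zeta_eq, horizXY_add_left, horizXY_smul_left]; ring

@[simp] theorem phi_ofFrame (p : MIdx n → ℝ) (b c d) : phi (ofFrame p b c d) = d := rfl

@[simp] theorem horiz_base_ofFrame_left (p : MIdx n → ℝ) (b c d w) :
    horiz (base (ofFrame p b c d)) w = horiz b w := rfl

@[simp] theorem horiz_base_ofFrame_right (p : MIdx n → ℝ) (b c d w) :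
    horiz w (base (ofFrame p b c d)) = horiz w b := rfl

@[simp] theorem horizXY_base_ofFrame_left (p : MIdx n → ℝ) (b c d w) :
    horizXY (base (ofFrame p b c d)) w = horizXY b w := rfl

@[simp] theorem horizXY_base_ofFrame_right (p : MIdx n → ℝ) (b c d w) :
    horizXY w (base (ofFrame p b c d)) = horizXY w b := rfl

@[simp] theorem rot_base_ofFrame (p : MIdx n → ℝ) (b c d) :
    rot (base (ofFrame p b c d)) = rot b := rfl

@[simp] theorem zeta_base_ofFrame (p : MIdx n → ℝ) (b c d) :
    zeta (base p) (base (ofFrame p b c d)) = c := by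
  rw [zeta_eq, horizXY_base_ofFrame_right]
  simp [base, ofFrame]

theorem ofFrame_add (p : MIdx n → ℝ) (b b' c c' d d') :
    ofFrame p b c d + ofFrame p b' c' d' = ofFrame p (b + b') (c + c') (d + d') := by
  ext ((i | i | i) | i) <;> simp [ofFrame, horizXY_add_right]
  ring

theorem smul_ofFrame (p : MIdx n → ℝ) (a : ℝ) (b c d) :
    a • ofFrame p b c d = ofFrame p (a • b) (a * c) (a * d) := by
  ext ((i | i | i) | i) <;> simp [ofFrame, horizXY_smul_right, mul_sub]

theorem ofFrame_sub (p : MIdx n → ℝ) (b b' c c' d d') :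
    ofFrame p b c d - ofFrame p b' c' d' = ofFrame p (b + (-1 : ℝ) • b') (c - c') (d - d') := by
  rw [sub_eq_add_neg, ← neg_one_smul ℝ (ofFrame p b' c' d'), smul_ofFrame, ofFrame_add]
  congr 1 <;> ring

theorem ofFrame_base (p v : MIdx n → ℝ) :
    ofFrame p (base v) (zeta (base p) (base v)) (phi v) = v := by
  ext ((i | i | i) | i) <;> simp [ofFrame, zeta_eq, base, phi]

/-- A tangent vector is determined by its components in the left invariant coframe. -/
theorem ext_frame (p : MIdx n → ℝ) {v w : MIdx n → ℝ} (hx : ∀ i, base v (.inl i) = base w (.inl i))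
    (hy : ∀ i, base v (.inr (.inl i)) = base w (.inr (.inl i)))
    (hz : zeta (base p) (base v) = zeta (base p) (base w)) (hphi : phi v = phi w) : v = w := by
  rw [← ofFrame_base p v, ← ofFrame_base p w, hz, hphi]
  ext ((i | i | i) | i)
  · exact hx i
  · exact hy i
  · simp [ofFrame, horizXY, hy]
  · rfl

/-- The frame moves with the point while derivatives are taken in fixed coordinates; the term `-
horizXY (base u) (b 0)` in the `ζ`-component corrects for this. -/
theorem hasDerivAt_ofFrame {p u : MIdx n → ℝ} {b : ℝ → HIdx n → ℝ} {c d : ℝ → ℝ}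
    {b' : HIdx n → ℝ} {c' d' : ℝ} (hb : HasDerivAt b b' 0) (hc : HasDerivAt c c' 0)
    (hd : HasDerivAt d d' 0) :
    HasDerivAt (fun t : ℝ => ofFrame (p + t • u) (b t) (c t) (d t))
      (ofFrame p b' (c' - horizXY (base u) (b 0)) d') 0 := by
  rw [hasDerivAt_pi] at hb ⊢
  rintro ((i | i | i) | i)
  · exact hb _
  · exact hb _
  · have h1 : HasDerivAt (fun t : ℝ => ∑ i, (base p (.inl i) + t * base u (.inl i))
          * b t (.inr (.inl i)) - c t)
        (∑ i, ((0 + 1 * base u (.inl i)) * b 0 (.inr (.inl i))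
          + (base p (.inl i) + 0 * base u (.inl i)) * b' (.inr (.inl i))) - c') 0 := by
      refine HasDerivAt.sub (HasDerivAt.fun_sum fun i _ => ?_) hc
      exact ((hasDerivAt_const _ _).add ((hasDerivAt_id' _).mul_const _)).mul (hb _)
    refine HasDerivAt.congr_deriv h1 ?_
    simp only [ofFrame, Sum.elim_inl, Sum.elim_inr, horizXY, zero_add, one_mul, zero_mul, add_zero,
      Finset.sum_add_distrib]
    ring
  · exact hd

theorem contDiff_phi {k : WithTop ℕ∞} : ContDiff ℝ k (phi : (MIdx n → ℝ) → ℝ) := by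
  unfold phi; fun_prop

theorem contDiff_base {k : WithTop ℕ∞} : ContDiff ℝ k (base : (MIdx n → ℝ) → (HIdx n → ℝ)) := by
  unfold base; fun_prop

theorem contDiff_zeta {k : WithTop ℕ∞} (v : HIdx n → ℝ) :
    ContDiff ℝ k (fun p : MIdx n → ℝ => zeta (base p) v) := by
  unfold zeta base; fun_prop

theorem ContDiffOn.ofFrame {k : WithTop ℕ∞} {U : Set (MIdx n → ℝ)} {b : (MIdx n → ℝ) → HIdx n → ℝ}
    {c d : (MIdx n → ℝ) → ℝ} (hb : ContDiffOn ℝ k b U) (hc : ContDiffOn ℝ k c U)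
    (hd : ContDiffOn ℝ k d U) :
    ContDiffOn ℝ k (fun p => ofFrame p (b p) (c p) (d p)) U := by
  rw [contDiffOn_pi] at hb ⊢
  rintro ((i | i | i) | i)
  · exact hb _
  · exact hb _
  · refine ContDiffOn.sub (ContDiffOn.sum fun i _ => ContDiffOn.mul ?_ (hb _)) hc
    exact (contDiff_apply ℝ ℝ _).contDiffOn
  · exact hd

theorem isOpen_halfSpace : IsOpen (halfSpace n) :=
  isOpen_lt continuous_const (continuous_apply _)

end HeisFrame

/-! ### The metrics with an arbitrary profile. -/

/-- A positive smooth function on `(0, ∞)`. -/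
structure IsProfile (h : ℝ → ℝ) : Prop where
  pos : ∀ s, 0 < s → 0 < h s
  smooth : ContDiffOn ℝ ∞ h (Ioi 0)

namespace IsProfile

variable {n : ℕ} {h : ℝ → ℝ} (hh : IsProfile h)

include hh

theorem hasDerivAt {s : ℝ} (hs : 0 < s) : HasDerivAt h (deriv h s) s :=
  ((hh.smooth.contDiffAt (Ioi_mem_nhds hs)).differentiableAt (by simp)).hasDerivAt

theorem smooth_deriv : ContDiffOn ℝ ∞ (deriv h) (Ioi 0) :=
  hh.smooth.deriv_of_isOpen isOpen_Ioi (by simp)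

theorem hasDerivAt_deriv {s : ℝ} (hs : 0 < s) : HasDerivAt (deriv h) (deriv (deriv h) s) s :=
  ((hh.smooth_deriv.contDiffAt (Ioi_mem_nhds hs)).differentiableAt (by simp)).hasDerivAt

theorem comp_phi : ContDiffOn ℝ ∞ (fun p : MIdx n → ℝ => h (phi p)) (halfSpace n) :=
  hh.smooth.comp contDiff_phi.contDiffOn fun _ hp => hp

theorem deriv_comp_phi : ContDiffOn ℝ ∞ (fun p : MIdx n → ℝ => deriv h (phi p)) (halfSpace n) :=
  hh.smooth_deriv.comp contDiff_phi.contDiffOn fun _ hp => hp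

theorem isRiemannianMetricOn : IsRiemannianMetricOn (halfSpace n) (heisMetric n h) where
  add_left p _ u v w := by
    simp only [heisMetric, base_add, phi_add, horiz_add_left, zeta_add]; ring
  smul_left p _ c v w := by
    simp only [heisMetric, base_smul, phi_smul, horiz_smul_left, zeta_smul]; ring
  symm p _ v w := by
    simp only [heisMetric, horiz_comm (base v)]; ring
  pos p hp v hv := by
    have hpos : 0 < h (phi p) := hh.pos _ hp
    have hp' : 0 < phi p := hp
    have h1 : 0 ≤ phi p * horiz (base v) (base v) := mul_nonneg hp'.le (horiz_self_nonneg _)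
    have h2 : 0 ≤ h (phi p) * (zeta (base p) (base v) * zeta (base p) (base v)) :=
      mul_nonneg hpos.le (mul_self_nonneg _)
    have h3 : 0 ≤ phi v * phi v / h (phi p) := div_nonneg (mul_self_nonneg _) hpos.le
    by_contra hle
    have e1 : phi p * horiz (base v) (base v) = 0 := by unfold heisMetric at hle; linarith
    have e2 : h (phi p) * (zeta (base p) (base v) * zeta (base p) (base v)) = 0 := by
      unfold heisMetric at hle; linarith
    have e3 : phi v * phi v / h (phi p) = 0 := by unfold heisMetric at hle; linarith
    simp only [mul_eq_zero, hp'.ne', hpos.ne', false_or, or_self, div_eq_zero_iff, or_false]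
      at e1 e2 e3
    have e1' := (Finset.sum_eq_zero_iff_of_nonneg fun i _ =>
      add_nonneg (mul_self_nonneg _) (mul_self_nonneg _)).mp e1
    have e4 : ∀ i, base v (.inl i) = 0 ∧ base v (.inr (.inl i)) = 0 := fun i =>
      mul_self_add_mul_self_eq_zero.mp (e1' i (Finset.mem_univ i))
    refine hv (ext_frame p (fun i => (e4 i).1) (fun i => (e4 i).2) ?_ e3)
    rw [e2]
    simp [zeta, base]
  smooth v w := by
    have hne : ∀ p ∈ halfSpace n, h (phi p) ≠ 0 := fun p hp => (hh.pos _ hp).ne'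
    exact ((contDiff_phi.contDiffOn.mul contDiffOn_const).add (hh.comp_phi.mul
      ((contDiff_zeta _).mul (contDiff_zeta _)).contDiffOn)).add
      (contDiffOn_const.div hh.comp_phi hne)

/-- The vectors are constant in coordinates, so the variation comes from the coefficients `φ`, `h`,
`1/h` and from `ζ`; the latter produces the `horizXY` terms. -/
theorem metricDeriv_eq {p : MIdx n → ℝ} (hp : p ∈ halfSpace n) (u v w : MIdx n → ℝ) :
    metricDeriv (heisMetric n h) p u v w =
      phi u * horiz (base v) (base w)
      + deriv h (phi p) * phi u * (zeta (base p) (base v) * zeta (base p) (base w))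
      + h (phi p) * (horizXY (base u) (base v) * zeta (base p) (base w)
          + zeta (base p) (base v) * horizXY (base u) (base w))
      - phi v * phi w * (deriv h (phi p) * phi u) / h (phi p) ^ 2 := by
  have hp' : 0 < phi p := hp
  have hd : DifferentiableAt ℝ (fun q => heisMetric n h q v w) p :=
    ((hh.isRiemannianMetricOn.smooth v w).contDiffAt (isOpen_halfSpace.mem_nhds hp)).differentiableAt
      (by simp)
  refine hd.fderiv_eq_of_line ?_
  have hphi : HasDerivAt (fun t : ℝ => phi p + t * phi u) (phi u) 0 := by
    simpa using ((hasDerivAt_id' (0 : ℝ)).mul_const (phi u)).const_add (phi p)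
  have hz : ∀ x, HasDerivAt (fun t : ℝ => zeta (base p) x + t * horizXY (base u) x)
      (horizXY (base u) x) 0 := fun x => by
    simpa using ((hasDerivAt_id' (0 : ℝ)).mul_const (horizXY (base u) x)).const_add (zeta (base p) x)
  have hh1 : HasDerivAt (fun t : ℝ => h (phi p + t * phi u)) (deriv h (phi p) * phi u) 0 := by
    have h0 : HasDerivAt h (deriv h (phi p)) (phi p + 0 * phi u) := by
      simpa using hh.hasDerivAt hp'
    exact h0.comp (0 : ℝ) hphi
  have hne : h (phi p + 0 * phi u) ≠ 0 := by simpa using (hh.pos _ hp').ne'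
  have key := ((hphi.mul_const (horiz (base v) (base w))).add
    (hh1.mul ((hz (base v)).mul (hz (base w))))).add
    ((hasDerivAt_const (0 : ℝ) (phi v * phi w)).div hh1 hne)
  simp only [zero_mul, add_zero, Pi.mul_apply] at key
  convert key using 1
  · funext t
    simp only [heisMetric, base_add, base_smul, phi_add, phi_smul, zeta_line]
    rfl
  · ring

end IsProfile

/-! ### The Levi-Civita connection and the Kähler property. -/

/-- The Christoffel symbols of `heisMetric n h` in the left invariant coframe. -/
def heisGamma (n : ℕ) (h : ℝ → ℝ) (p v w : MIdx n → ℝ) : MIdx n → ℝ :=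
  ofFrame p
    ((1 / (2 * phi p)) • (phi v • base w + phi w • base v
      + (h (phi p) * zeta (base p) (base w)) • rot (base v)
      + (h (phi p) * zeta (base p) (base v)) • rot (base w)))
    (deriv h (phi p) / (2 * h (phi p))
        * (phi v * zeta (base p) (base w) + phi w * zeta (base p) (base v))
      + 1 / 2 * (horizXY (base v) (base w) + horizXY (base w) (base v)))
    (-(1 / 2) * (h (phi p) * (horiz (base v) (base w)
      + deriv h (phi p) * (zeta (base p) (base v) * zeta (base p) (base w)))
      + deriv h (phi p) / h (phi p) * (phi v * phi w)))

namespace IsProfile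

variable {n : ℕ} {h : ℝ → ℝ} (hh : IsProfile h)

include hh

theorem christoffel_heisMetric {p : MIdx n → ℝ} (hp : p ∈ halfSpace n) (v w : MIdx n → ℝ) :
    christoffel (heisMetric n h) p v w = heisGamma n h p v w := by
  refine hh.isRiemannianMetricOn.christoffel_eq hp fun x => ?_
  have hp' : phi p ≠ 0 := ne_of_gt hp
  have hpos : h (phi p) ≠ 0 := (hh.pos _ hp).ne'
  simp only [hh.metricDeriv_eq hp, heisMetric, heisGamma, phi_ofFrame, horiz_base_ofFrame_left,
    zeta_base_ofFrame, horiz_smul_left, horiz_add_left, horiz_rot_left]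
  field_simp
  ring

theorem contDiffOn_heisGamma (v w : MIdx n → ℝ) :
    ContDiffOn ℝ ∞ (fun p => heisGamma n h p v w) (halfSpace n) := by
  have hne : ∀ p ∈ halfSpace n, h (phi p) ≠ 0 := fun p hp => (hh.pos _ hp).ne'
  have hne1 : ∀ p ∈ halfSpace n, 2 * h (phi p) ≠ 0 := fun p hp => mul_ne_zero two_ne_zero (hne p hp)
  have hne2 : ∀ p ∈ halfSpace n, 2 * phi p ≠ 0 := fun p hp => mul_ne_zero two_ne_zero (ne_of_gt hp)
  have hphi : ContDiffOn ℝ ∞ (phi : (MIdx n → ℝ) → ℝ) (halfSpace n) := contDiff_phi.contDiffOn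
  have hz : ∀ x : HIdx n → ℝ, ContDiffOn ℝ ∞ (fun p : MIdx n → ℝ => zeta (base p) x) (halfSpace n) :=
    fun x => (contDiff_zeta x).contDiffOn
  refine ContDiffOn.ofFrame ?_ ?_ ?_
  · exact (contDiffOn_const.div (contDiffOn_const.mul hphi) hne2).smul
      ((contDiffOn_const.add ((hh.comp_phi.mul (hz _)).smul contDiffOn_const)).add
        ((hh.comp_phi.mul (hz _)).smul contDiffOn_const))
  · exact ((hh.deriv_comp_phi.div (contDiffOn_const.mul hh.comp_phi) hne1).mul
      ((contDiffOn_const.mul (hz _)).add (contDiffOn_const.mul (hz _)))).add contDiffOn_const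
  · exact contDiffOn_const.mul ((hh.comp_phi.mul (contDiffOn_const.add (hh.deriv_comp_phi.mul
      ((hz _).mul (hz _))))).add ((hh.deriv_comp_phi.div hh.comp_phi hne).mul contDiffOn_const))

theorem contDiffOn_christoffel (v w : MIdx n → ℝ) :
    ContDiffOn ℝ ∞ (fun p => christoffel (heisMetric n h) p v w) (halfSpace n) :=
  (hh.contDiffOn_heisGamma v w).congr fun _ hp => hh.christoffel_heisMetric hp v w

end IsProfile

section HeisFrame

variable {n : ℕ}

theorem horiz_rot_rot_left (v w : HIdx n → ℝ) : horiz (rot (rot v)) w = -horiz v w := by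
  rw [horiz_rot_left, horizXY_rot_sub]

theorem horizXY_rot_comm (v w : HIdx n → ℝ) : horizXY v (rot w) = horizXY w (rot v) := by
  simp only [horizXY, rot, Sum.elim_inl, Sum.elim_inr, mul_comm]

/-- A normal form: it moves every `rot` to the second argument of `horizXY`, so that the remaining
pairings can be treated as independent variables by `ring`. -/
theorem horizXY_rot_left (v w : HIdx n → ℝ) :
    horizXY (rot v) w = horizXY w (rot v) - horiz v w := by
  linarith [horizXY_rot_sub v w]

/-- `ofFrame` ignores the `z`-component of its horizontal argument, and `horiz` does not see it
either. Testing with `horiz` is thus exactly what is needed; for example `rot (rot v)` is `-v` only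
in this sense. -/
theorem ofFrame_congr {p : MIdx n → ℝ} {b b' : HIdx n → ℝ} {c c' d d' : ℝ}
    (hb : ∀ x, horiz b x = horiz b' x) (hc : c = c') (hd : d = d') :
    ofFrame p b c d = ofFrame p b' c' d' := by
  refine ext_frame p (fun i => ?_) (fun i => ?_) (by simp [hc]) (by simp [hd])
  · simpa [horiz, Pi.single_apply, base, ofFrame] using hb (Pi.single (.inl i) 1)
  · simpa [horiz, Pi.single_apply, base, ofFrame] using hb (Pi.single (.inr (.inl i)) 1)

theorem ofFrame_zero (p : MIdx n → ℝ) : ofFrame p 0 0 0 = 0 := by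
  ext ((i | i | i) | i) <;> simp [ofFrame, horizXY]

theorem horiz_zero_left (w : HIdx n → ℝ) : horiz 0 w = 0 := by simp [horiz]

theorem heisJ_eq_ofFrame (h : ℝ → ℝ) (p v : MIdx n → ℝ) :
    heisJ n h p v = ofFrame p (rot (base v)) (phi v / h (phi p))
      (-(h (phi p) * zeta (base p) (base v))) := by
  ext ((i | i | i) | i) <;> simp [heisJ, ofFrame, rot, horizXY]

end HeisFrame

namespace IsProfile

variable {n : ℕ} {h : ℝ → ℝ} (hh : IsProfile h)

include hh

theorem hasDerivAt_line {p : MIdx n → ℝ} (hp : p ∈ halfSpace n) (u : MIdx n → ℝ) :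
    HasDerivAt (fun t : ℝ => h (phi p + t * phi u)) (deriv h (phi p) * phi u) 0 := by
  have hphi : HasDerivAt (fun t : ℝ => phi p + t * phi u) (phi u) 0 := by
    simpa using ((hasDerivAt_id' (0 : ℝ)).mul_const (phi u)).const_add (phi p)
  have h0 : HasDerivAt h (deriv h (phi p)) (phi p + 0 * phi u) := by
    simpa using hh.hasDerivAt hp
  exact h0.comp (0 : ℝ) hphi

theorem hasDerivAt_deriv_line {p : MIdx n → ℝ} (hp : p ∈ halfSpace n) (u : MIdx n → ℝ) :
    HasDerivAt (fun t : ℝ => deriv h (phi p + t * phi u)) (deriv (deriv h) (phi p) * phi u) 0 := by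
  have hphi : HasDerivAt (fun t : ℝ => phi p + t * phi u) (phi u) 0 := by
    simpa using ((hasDerivAt_id' (0 : ℝ)).mul_const (phi u)).const_add (phi p)
  have h0 : HasDerivAt (deriv h) (deriv (deriv h) (phi p)) (phi p + 0 * phi u) := by
    simpa using hh.hasDerivAt_deriv hp
  exact h0.comp (0 : ℝ) hphi

theorem contDiffOn_heisJ (v : MIdx n → ℝ) :
    ContDiffOn ℝ ∞ (fun p => heisJ n h p v) (halfSpace n) := by
  simp only [heisJ_eq_ofFrame]
  have hne : ∀ p ∈ halfSpace n, h (phi p) ≠ 0 := fun p hp => (hh.pos _ hp).ne'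
  exact ContDiffOn.ofFrame contDiffOn_const (contDiffOn_const.div hh.comp_phi hne)
    (hh.comp_phi.mul (contDiff_zeta _).contDiffOn).neg

theorem fderiv_heisJ {p : MIdx n → ℝ} (hp : p ∈ halfSpace n) (v w : MIdx n → ℝ) :
    fderiv ℝ (fun q => heisJ n h q w) p v =
      ofFrame p 0 (-(phi w * (deriv h (phi p) * phi v)) / h (phi p) ^ 2
          - horizXY (base v) (rot (base w)))
        (-(deriv h (phi p) * phi v * zeta (base p) (base w)
          + h (phi p) * horizXY (base v) (base w))) := by
  have hd : DifferentiableAt ℝ (fun q => heisJ n h q w) p :=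
    ((hh.contDiffOn_heisJ w).contDiffAt (isOpen_halfSpace.mem_nhds hp)).differentiableAt (by simp)
  refine hd.fderiv_eq_of_line ?_
  have hz : HasDerivAt (fun t : ℝ => zeta (base p) (base w) + t * horizXY (base v) (base w))
      (horizXY (base v) (base w)) 0 := by
    simpa using ((hasDerivAt_id' (0 : ℝ)).mul_const (horizXY (base v) (base w))).const_add
      (zeta (base p) (base w))
  have hh1 := hh.hasDerivAt_line hp v
  have hne : h (phi p + 0 * phi v) ≠ 0 := by simpa using (hh.pos _ hp).ne'
  have key := hasDerivAt_ofFrame (p := p) (u := v) (hasDerivAt_const (0 : ℝ) (rot (base w)))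
    ((hasDerivAt_const (0 : ℝ) (phi w)).div hh1 hne) (hh1.mul hz).neg
  simp only [zero_mul, add_zero, zero_sub] at key
  simp only [heisJ_eq_ofFrame, base_add, base_smul, phi_add, phi_smul, zeta_line]
  exact key

/-- No condition on the profile is needed: the Kähler form is `φ dζ + dφ ∧ ζ = d(φ ζ)`. The
parallelism of `J` is verified directly, one component of the coframe at a time. -/
theorem isKahlerOn : IsKahlerOn (halfSpace n) (heisMetric n h) (heisJ n h) where
  metric := hh.isRiemannianMetricOn
  add p _ v w := by
    simp only [heisJ_eq_ofFrame, ofFrame_add, base_add, phi_add, rot_add, zeta_add]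
    congr 1 <;> ring
  smul p _ c v := by
    simp only [heisJ_eq_ofFrame, smul_ofFrame, base_smul, phi_smul, rot_smul, zeta_smul]
    congr 1 <;> ring
  smooth := hh.contDiffOn_heisJ
  sq p hp v := by
    have hpos : h (phi p) ≠ 0 := (hh.pos _ hp).ne'
    have e : -v = ofFrame p ((-1 : ℝ) • base v) (-1 * zeta (base p) (base v)) (-1 * phi v) := by
      rw [← smul_ofFrame, ofFrame_base, neg_one_smul]
    rw [e]
    simp only [heisJ_eq_ofFrame, rot_base_ofFrame, phi_ofFrame, zeta_base_ofFrame]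
    refine ofFrame_congr (fun x => ?_) ?_ ?_
    · rw [horiz_rot_rot_left, horiz_smul_left]; ring
    · field_simp
    · field_simp
  orthogonal p hp v w := by
    have hpos : h (phi p) ≠ 0 := (hh.pos _ hp).ne'
    simp only [heisJ_eq_ofFrame, heisMetric, horiz_base_ofFrame_left, horiz_base_ofFrame_right,
      phi_ofFrame, zeta_base_ofFrame, horiz_rot_left, horizXY_rot_left, horiz_comm (base w) (base v)]
    field_simp
    ring
  parallel p hp v w := by
    have hpos : h (phi p) ≠ 0 := (hh.pos _ hp).ne'
    have hp' : phi p ≠ 0 := ne_of_gt hp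
    rw [hh.fderiv_heisJ hp, hh.christoffel_heisMetric hp, hh.christoffel_heisMetric hp,
      ← ofFrame_zero p]
    simp only [heisJ_eq_ofFrame, heisGamma, rot_base_ofFrame, phi_ofFrame, zeta_base_ofFrame,
      ofFrame_add, ofFrame_sub]
    refine ofFrame_congr (fun x => ?_) ?_ ?_
    · simp only [horiz_add_left, horiz_smul_left, horiz_zero_left, rot_smul, rot_add,
        horiz_base_ofFrame_left, horiz_rot_rot_left]
      field_simp
      ring
    · simp only [horizXY_base_ofFrame_left, horizXY_base_ofFrame_right, horizXY_rot_left,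
        horiz_comm (base w) (base v)]
      field_simp
      ring
    · simp only [horiz_base_ofFrame_right, horiz_rot_right]
      field_simp
      ring

/-- The derivative of the Christoffel symbols. -/
theorem fderiv_heisGamma {p : MIdx n → ℝ} (hp : p ∈ halfSpace n) (u v w : MIdx n → ℝ) :
    fderiv ℝ (fun q => heisGamma n h q v w) p u =
      ofFrame p
        ((-(phi u) / (2 * phi p ^ 2)) • (phi v • base w + phi w • base v
            + (h (phi p) * zeta (base p) (base w)) • rot (base v)
            + (h (phi p) * zeta (base p) (base v)) • rot (base w))
          + (1 / (2 * phi p)) • (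
            (deriv h (phi p) * phi u * zeta (base p) (base w)
              + h (phi p) * horizXY (base u) (base w)) • rot (base v)
            + (deriv h (phi p) * phi u * zeta (base p) (base v)
              + h (phi p) * horizXY (base u) (base v)) • rot (base w)))
        ((deriv (deriv h) (phi p) * h (phi p) - deriv h (phi p) ^ 2) * phi u / (2 * h (phi p) ^ 2)
            * (phi v * zeta (base p) (base w) + phi w * zeta (base p) (base v))
          + deriv h (phi p) / (2 * h (phi p))
            * (phi v * horizXY (base u) (base w) + phi w * horizXY (base u) (base v))
          - 1 / (2 * phi p) * (phi v * horizXY (base u) (base w)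
            + phi w * horizXY (base u) (base v)
            + h (phi p) * zeta (base p) (base w) * horizXY (base u) (rot (base v))
            + h (phi p) * zeta (base p) (base v) * horizXY (base u) (rot (base w))))
        (-(1 / 2) * (deriv h (phi p) * phi u * (horiz (base v) (base w)
            + deriv h (phi p) * (zeta (base p) (base v) * zeta (base p) (base w)))
          + h (phi p) * (deriv (deriv h) (phi p) * phi u
              * (zeta (base p) (base v) * zeta (base p) (base w))
            + deriv h (phi p) * (horizXY (base u) (base v) * zeta (base p) (base w)
              + zeta (base p) (base v) * horizXY (base u) (base w)))
          + (deriv (deriv h) (phi p) * h (phi p) - deriv h (phi p) ^ 2) * phi u / h (phi p) ^ 2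
            * (phi v * phi w))) := by
  have hd : DifferentiableAt ℝ (fun q => heisGamma n h q v w) p :=
    ((hh.contDiffOn_heisGamma v w).contDiffAt (isOpen_halfSpace.mem_nhds hp)).differentiableAt
      (by simp)
  refine hd.fderiv_eq_of_line ?_
  have hz : ∀ x, HasDerivAt (fun t : ℝ => zeta (base p) x + t * horizXY (base u) x)
      (horizXY (base u) x) 0 := fun x => by
    simpa using ((hasDerivAt_id' (0 : ℝ)).mul_const (horizXY (base u) x)).const_add (zeta (base p) x)
  have hphi : HasDerivAt (fun t : ℝ => phi p + t * phi u) (phi u) 0 := by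
    simpa using ((hasDerivAt_id' (0 : ℝ)).mul_const (phi u)).const_add (phi p)
  have hpos : h (phi p) ≠ 0 := (hh.pos _ hp).ne'
  have hp' : phi p ≠ 0 := ne_of_gt hp
  have hh1 := hh.hasDerivAt_line hp u
  have hh2 := hh.hasDerivAt_deriv_line hp u
  have hne : h (phi p + 0 * phi u) ≠ 0 := by simpa using hpos
  have hneb : 2 * h (phi p + 0 * phi u) ≠ 0 := mul_ne_zero two_ne_zero hne
  have hnep : 2 * (phi p + 0 * phi u) ≠ 0 := by simpa using hp'
  have hb := ((hasDerivAt_const (0 : ℝ) (1 : ℝ)).fun_div (hphi.const_mul 2) hnep).fun_smul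
    (((hh1.fun_mul (hz (base w))).smul_const (rot (base v))).const_add
      (phi v • base w + phi w • base v) |>.fun_add
      ((hh1.fun_mul (hz (base v))).smul_const (rot (base w))))
  have hc := ((hh2.fun_div (hh1.const_mul 2) hneb).fun_mul
    (((hz (base w)).const_mul (phi v)).fun_add ((hz (base v)).const_mul (phi w)))).add_const
    (1 / 2 * (horizXY (base v) (base w) + horizXY (base w) (base v)))
  have hdd := (((hh1.fun_mul ((hh2.fun_mul ((hz (base v)).fun_mul (hz (base w)))).const_add
    (horiz (base v) (base w)))).fun_add
    ((hh2.fun_div hh1 hne).mul_const (phi v * phi w))).const_mul (-(1 / 2)))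
  have key := hasDerivAt_ofFrame (p := p) (u := u) hb hc hdd
  simp only [heisGamma, base_add, base_smul, phi_add, phi_smul, zeta_line]
  refine HasDerivAt.congr_deriv key ?_
  simp only [zero_mul, add_zero]
  refine ofFrame_congr (fun x => ?_) ?_ ?_
  · simp only [horiz_add_left, horiz_smul_left]
    field_simp
    ring
  · simp only [horizXY_add_right, horizXY_smul_right]
    field_simp
  · field_simp

theorem fderiv_christoffel {p : MIdx n → ℝ} (hp : p ∈ halfSpace n) (u v w : MIdx n → ℝ) :
    fderiv ℝ (fun q => christoffel (heisMetric n h) q v w) p u =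
      fderiv ℝ (fun q => heisGamma n h q v w) p u := by
  rw [Filter.EventuallyEq.fderiv_eq]
  filter_upwards [isOpen_halfSpace.mem_nhds hp] with q hq
  exact hh.christoffel_heisMetric hq v w

end IsProfile

/-! ### The curvature tensor. -/

/-- The curvature of a holomorphic space form, polarised: `a`, `b` are symmetric bilinear forms and
`a'`, `b'` the associated `2`-forms. -/
def spaceFormCurv {E : Type*} (a a' b b' : E → E → ℝ) (u v w x : E) : ℝ :=
  1 / 4 * (a v w * b u x - a u w * b v x + a' v w * b' u x - a' u w * b' v x - 2 * a' u v * b' w x)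

/-- The horizontal part of `heisMetric`. -/
def metricH {n : ℕ} (p v w : MIdx n → ℝ) : ℝ := phi p * horiz (base v) (base w)

/-- The horizontal part of the Kähler form. -/
def formH {n : ℕ} (p v w : MIdx n → ℝ) : ℝ := phi p * horiz (rot (base v)) (base w)

/-- The vertical part of `heisMetric`. -/
def metricV {n : ℕ} (h : ℝ → ℝ) (p v w : MIdx n → ℝ) : ℝ :=
  h (phi p) * (zeta (base p) (base v) * zeta (base p) (base w)) + phi v * phi w / h (phi p)

/-- The vertical part of the Kähler form. -/
def formV {n : ℕ} (p v w : MIdx n → ℝ) : ℝ :=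
  phi v * zeta (base p) (base w) - zeta (base p) (base v) * phi w

/-- The horizontal holomorphic sectional curvature of `heisMetric`. -/
def curvH (h : ℝ → ℝ) (s : ℝ) : ℝ := -(h s / s ^ 2)

/-- The vertical holomorphic sectional curvature of `heisMetric`. -/
def curvV (h : ℝ → ℝ) (s : ℝ) : ℝ := -(deriv (deriv h) s / 2)

/-- Twice the mixed bisectional curvature of `heisMetric`. -/
def curvM (h : ℝ → ℝ) (s : ℝ) : ℝ := -(deriv h s / s - h s / s ^ 2)

-- Every later curvature statement is read off from this formula: the Ricci and scalar curvatures,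
-- the norm bounds, and the constant holomorphic curvature of the model at `φ → 0`.
set_option maxHeartbeats 1600000 in
theorem IsProfile.inner_riemann {n : ℕ} {h : ℝ → ℝ} (hh : IsProfile h) {p : MIdx n → ℝ}
    (hp : p ∈ halfSpace n) (u v w x : MIdx n → ℝ) :
    heisMetric n h p (riemann (heisMetric n h) p u v w) x =
      curvH h (phi p) * spaceFormCurv (metricH p) (formH p) (metricH p) (formH p) u v w x
      + curvV h (phi p) * spaceFormCurv (metricV h p) (formV p) (metricV h p) (formV p) u v w x
      + curvM h (phi p) * (spaceFormCurv (metricH p) (formH p) (metricV h p) (formV p) u v w x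
        + spaceFormCurv (metricV h p) (formV p) (metricH p) (formH p) u v w x) := by
  have hpos : h (phi p) ≠ 0 := (hh.pos _ hp).ne'
  have hp' : phi p ≠ 0 := ne_of_gt hp
  simp only [riemann, hh.fderiv_christoffel hp, hh.fderiv_heisGamma hp,
    hh.christoffel_heisMetric hp]
  simp only [heisGamma, ofFrame_sub, ofFrame_add, rot_base_ofFrame, phi_ofFrame, zeta_base_ofFrame,
    horizXY_base_ofFrame_left, horizXY_base_ofFrame_right, horiz_base_ofFrame_right]
  simp only [heisMetric, phi_ofFrame, zeta_base_ofFrame, horiz_base_ofFrame_left]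
  simp only [spaceFormCurv, metricH, formH, metricV, formV, curvH, curvV, curvM]
  -- All pairings are brought to a normal form, using the symmetry of `horiz` and of `horizXY v (rot
  -- w)`. What is left is a rational identity in independent variables, with no relations among
  -- them.
  simp only [horiz_add_left, horiz_smul_left, horiz_add_right, horiz_smul_right, rot_add, rot_smul,
    horiz_base_ofFrame_left, horiz_rot_left, horiz_rot_right, horizXY_add_left, horizXY_smul_left,
    horizXY_add_right, horizXY_smul_right, horizXY_rot_left, horizXY_rot_comm (base v) (base u),
    horiz_comm (base v) (base u),
    horiz_comm (base w) (base u), horiz_comm (base w) (base v)]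
  generalize horiz (base u) (base v) = Huv
  generalize horiz (base u) (base w) = Huw
  generalize horiz (base v) (base w) = Hvw
  generalize horiz (base u) (base x) = Hux
  generalize horiz (base v) (base x) = Hvx
  generalize horiz (base w) (base x) = Hwx
  generalize horizXY (base u) (base v) = Buv
  generalize horizXY (base u) (base w) = Buw
  generalize horizXY (base v) (base w) = Bvw
  generalize horizXY (base v) (base u) = Bvu
  generalize horizXY (base w) (base u) = Bwu
  generalize horizXY (base w) (base v) = Bwv
  generalize horizXY (base u) (base x) = Bux
  generalize horizXY (base v) (base x) = Bvx
  generalize horizXY (base w) (base x) = Bwx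
  generalize horizXY (base x) (base u) = Bxu
  generalize horizXY (base x) (base v) = Bxv
  generalize horizXY (base x) (base w) = Bxw
  generalize horizXY (base u) (rot (base v)) = Auv
  generalize horizXY (base u) (rot (base w)) = Auw
  generalize horizXY (base v) (rot (base w)) = Avw
  generalize zeta (base p) (base u) = zu
  generalize zeta (base p) (base v) = zv
  generalize zeta (base p) (base w) = zw
  generalize zeta (base p) (base x) = zx
  generalize phi u = fu
  generalize phi v = fv
  generalize phi w = fw
  generalize phi x = fx
  generalize h (phi p) = h0 at *
  generalize deriv h (phi p) = h1
  generalize deriv (deriv h) (phi p) = h2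
  generalize phi p = s at *
  field_simp
  ring

/-! ### Traces in the invariant frame; Ricci and scalar curvature. -/

section Trace

variable {n : ℕ}

/-- The left invariant fields `X_i` and `Y_i`, labelled by the horizontal indices. -/
def frameX (p : MIdx n → ℝ) (i : Fin n) : MIdx n → ℝ := ofFrame p (Pi.single (.inl i) 1) 0 0

def frameY (p : MIdx n → ℝ) (i : Fin n) : MIdx n → ℝ :=
  ofFrame p (Pi.single (.inr (.inl i)) 1) 0 0

def frameZ (p : MIdx n → ℝ) : MIdx n → ℝ := ofFrame p 0 1 0

def framePhi (p : MIdx n → ℝ) : MIdx n → ℝ := ofFrame p 0 0 1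

/-- The trace of an endomorphism, computed in the left invariant frame. -/
theorem trace_eq_frame (p : MIdx n → ℝ) {A : (MIdx n → ℝ) → (MIdx n → ℝ)} (hA : IsLinearMap ℝ A) :
    ∑ i, A (coordVec i) i =
      ∑ i, (base (A (frameX p i)) (.inl i) + base (A (frameY p i)) (.inr (.inl i)))
        + (zeta (base p) (base (A (frameZ p))) + phi (A (framePhi p))) := by
  have hX : ∀ i : Fin n, (coordVec (.inl (.inl i)) : MIdx n → ℝ) = frameX p i := fun i => by
    ext ((j | j | j) | j) <;> simp [coordVec, frameX, ofFrame, Pi.single_apply, horizXY]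
  have hY : ∀ i : Fin n, (coordVec (.inl (.inr (.inl i))) : MIdx n → ℝ)
      = frameY p i + base p (.inl i) • frameZ p := fun i => by
    ext ((j | j | j) | j) <;>
      simp [coordVec, frameY, frameZ, ofFrame, Pi.single_apply, horizXY, base]
  have hZ : (coordVec (.inl (.inr (.inr ()))) : MIdx n → ℝ) = (-1 : ℝ) • frameZ p := by
    ext ((j | j | j) | j) <;> simp [coordVec, frameZ, ofFrame, horizXY]
  have hF : (coordVec (.inr ()) : MIdx n → ℝ) = framePhi p := by
    ext ((j | j | j) | j) <;> simp [coordVec, framePhi, ofFrame, horizXY]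
  simp only [Fintype.sum_sum_type, Finset.univ_unique, Finset.sum_singleton, PUnit.default_eq_unit]
  rw [hZ, hF]
  simp only [hX, hY, hA.map_add, hA.map_smul, zeta_eq, horizXY, Pi.add_apply, Pi.smul_apply,
    smul_eq_mul, Finset.sum_add_distrib, base, phi]
  ring

theorem horiz_single_inl (v : HIdx n → ℝ) (i : Fin n) :
    horiz v (Pi.single (.inl i) 1) = v (.inl i) := by
  simp [horiz, Pi.single_apply]

theorem horiz_single_inr (v : HIdx n → ℝ) (i : Fin n) :
    horiz v (Pi.single (.inr (.inl i)) 1) = v (.inr (.inl i)) := by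
  simp [horiz, Pi.single_apply]

theorem base_ofFrame_inl (p : MIdx n → ℝ) (b c d) (i : Fin n) :
    base (ofFrame p b c d) (.inl i) = b (.inl i) := rfl

theorem base_ofFrame_inr (p : MIdx n → ℝ) (b c d) (i : Fin n) :
    base (ofFrame p b c d) (.inr (.inl i)) = b (.inr (.inl i)) := rfl

theorem rot_inl (v : HIdx n → ℝ) (i : Fin n) : rot v (.inl i) = -v (.inr (.inl i)) := rfl

theorem rot_inr (v : HIdx n → ℝ) (i : Fin n) : rot v (.inr (.inl i)) = v (.inl i) := rfl

theorem rot_zero : rot (0 : HIdx n → ℝ) = 0 := by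
  ext (i | i | i) <;> simp [rot]

end Trace

/-- By nondegeneracy, linearity may be tested after pairing with `g`. For the curvature and the
Christoffel symbols only the pairings have formulas from which linearity is visible. -/
theorem IsRiemannianMetricOn.isLinearMap_of_inner {ι : Type} [Fintype ι] [DecidableEq ι]
    {U : Set (ι → ℝ)} {g : TwoTensor ι} (hg : IsRiemannianMetricOn U g) {p : ι → ℝ} (hp : p ∈ U)
    {A : (ι → ℝ) → ι → ℝ} (hA : ∀ x, IsLinearMap ℝ fun u => g p (A u) x) : IsLinearMap ℝ A := by
  refine ⟨fun u v => hg.ext_inner hp fun x => ?_, fun c v => hg.ext_inner hp fun x => ?_⟩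
  · rw [hg.add_left p hp, (hA x).map_add]
  · rw [hg.smul_left p hp, (hA x).map_smul, smul_eq_mul]

/-- The eigenvalue of the Ricci tensor of `heisMetric n h` on horizontal vectors. -/
def ricciH (n : ℕ) (h : ℝ → ℝ) (s : ℝ) : ℝ := ((n : ℝ) + 1) / 2 * curvH h s + curvM h s / 2

/-- The eigenvalue of the Ricci tensor of `heisMetric n h` on vertical vectors. -/
def ricciV (n : ℕ) (h : ℝ → ℝ) (s : ℝ) : ℝ := curvV h s + (n : ℝ) / 2 * curvM h s

theorem heisMetric_eq_add {n : ℕ} (h : ℝ → ℝ) (p v w : MIdx n → ℝ) :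
    heisMetric n h p v w = metricH p v w + metricV h p v w := by
  simp only [heisMetric, metricH, metricV, add_assoc]

namespace IsProfile

variable {n : ℕ} {h : ℝ → ℝ} (hh : IsProfile h) {p : MIdx n → ℝ} (hp : p ∈ halfSpace n)

include hh hp

theorem isLinearMap_riemann (v w : MIdx n → ℝ) :
    IsLinearMap ℝ fun u => riemann (heisMetric n h) p u v w := by
  refine hh.isRiemannianMetricOn.isLinearMap_of_inner hp fun x => ?_
  simp only [hh.inner_riemann hp, spaceFormCurv, metricH, metricV, formH, formV]
  constructor
  · intro u u'
    simp only [base_add, phi_add, horiz_add_left, rot_add, zeta_add]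
    ring
  · intro c u
    simp only [base_smul, phi_smul, horiz_smul_left, rot_smul, zeta_smul, smul_eq_mul]
    ring

theorem ricci_heisMetric (v w : MIdx n → ℝ) :
    ricci (heisMetric n h) p v w =
      ricciH n h (phi p) * metricH p v w + ricciV n h (phi p) * metricV h p v w := by
  have hpos : h (phi p) ≠ 0 := (hh.pos _ hp).ne'
  have hp' : phi p ≠ 0 := ne_of_gt hp
  rw [ricci, trace_eq_frame p (hh.isLinearMap_riemann hp v w)]
  -- The directions `X_i` and `Y_i` are taken together, because the squares of the components of the
  -- symplectic pairing with them combine into the `i`-th summand of `horiz`.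
  have key : ∀ i : Fin n, base (riemann (heisMetric n h) p (frameX p i) v w) (.inl i)
      + base (riemann (heisMetric n h) p (frameY p i) v w) (.inr (.inl i))
      = phi p * curvH h (phi p) * (1 / 2 * horiz (base v) (base w)
        + 1 / 2 * (base v (.inl i) * base w (.inl i)
          + base v (.inr (.inl i)) * base w (.inr (.inl i))))
        + curvM h (phi p) / 2 * metricV h p v w := by
    intro i
    have e1 := hh.inner_riemann hp (frameX p i) v w (frameX p i)
    have e2 := hh.inner_riemann hp (frameY p i) v w (frameY p i)
    simp only [heisMetric] at e1 e2
    simp only [frameX, frameY, spaceFormCurv, metricH, metricV, formH, formV, phi_ofFrame,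
      horiz_base_ofFrame_left, horiz_base_ofFrame_right, zeta_base_ofFrame, rot_base_ofFrame,
      horiz_single_inl, horiz_single_inr, horiz_comm (Pi.single _ _), horiz_rot_left] at e1 e2 ⊢
    simp only [base_ofFrame_inl, base_ofFrame_inr, rot_inl, rot_inr, horizXY, Pi.single_apply, Sum.inl.injEq, Sum.inr.injEq, reduceCtorEq, if_false,
      mul_ite, ite_mul, mul_one, mul_zero, one_mul, zero_mul, Finset.sum_ite_eq',
      Finset.mem_univ, if_true, Finset.sum_const_zero, add_zero, zero_add, sub_zero, zero_sub,
      zero_div, neg_zero] at e1 e2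
    have e3 := congrArg₂ (· + ·) e1 e2
    simp only [← mul_add] at e3
    -- Pairing with `X_i` or `Y_i` multiplies the corresponding component by `φ`.
    refine mul_left_cancel₀ hp' (e3.trans ?_)
    field_simp
    ring
  have eZ := hh.inner_riemann hp (frameZ p) v w (frameZ p)
  have eF := hh.inner_riemann hp (framePhi p) v w (framePhi p)
  simp only [heisMetric] at eZ eF
  simp only [frameZ, framePhi, spaceFormCurv, metricH, metricV, formH, formV, phi_ofFrame,
    horiz_base_ofFrame_left, horiz_base_ofFrame_right, zeta_base_ofFrame, rot_base_ofFrame,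
    rot_zero, horiz_zero_left, horiz_comm _ (0 : HIdx n → ℝ), horiz_rot_right, horizXY, Pi.zero_apply,
    mul_zero, zero_mul, mul_one, one_mul, Finset.sum_const_zero, add_zero, zero_add, sub_zero,
    zero_sub, zero_div] at eZ eF
  -- Pairing with `Z` multiplies the `ζ`-component by `h`, and pairing with `∂_φ` divides the
  -- `φ`-component by `h`.
  have eZ' := (eq_div_iff hpos).mpr ((mul_comm _ _).trans eZ)
  have eF' := (div_eq_iff hpos).mp eF
  simp only [key, Finset.sum_add_distrib, Finset.sum_const, Finset.card_univ, Fintype.card_fin,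
    nsmul_eq_mul, ← Finset.mul_sum]
  rw [frameZ, framePhi, eZ', eF']
  simp only [ricciH, ricciV, metricH, metricV, horiz]
  simp only [Finset.sum_add_distrib]
  field_simp
  ring

/-- The Ricci endomorphism is a scalar on the `2n` horizontal and a scalar on the two vertical
directions. -/
theorem scalarCurv_heisMetric :
    scalarCurv (heisMetric n h) p = 2 * n * ricciH n h (phi p) + 2 * ricciV n h (phi p) := by
  have hpos : h (phi p) ≠ 0 := (hh.pos _ hp).ne'
  have hsharp : ∀ v, sharp (heisMetric n h) p (fun w => ricci (heisMetric n h) p v w) =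
      ofFrame p (ricciH n h (phi p) • base v) (ricciV n h (phi p) * zeta (base p) (base v))
        (ricciV n h (phi p) * phi v) := fun v => by
    refine hh.isRiemannianMetricOn.sharp_eq hp fun k => ?_
    rw [hh.ricci_heisMetric hp]
    simp only [heisMetric, metricH, metricV, phi_ofFrame, horiz_base_ofFrame_left,
      zeta_base_ofFrame, horiz_smul_left]
    ring
  have hlin : IsLinearMap ℝ fun v : MIdx n → ℝ =>
      ofFrame p (ricciH n h (phi p) • base v) (ricciV n h (phi p) * zeta (base p) (base v))
        (ricciV n h (phi p) * phi v) := by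
    constructor
    · intro u v
      rw [ofFrame_add]
      simp only [base_add, zeta_add, phi_add, smul_add, mul_add]
    · intro c v
      rw [smul_ofFrame]
      simp only [base_smul, zeta_smul, phi_smul]
      congr 1
      · rw [smul_comm]
      · ring
      · ring
  simp only [scalarCurv, hsharp]
  rw [trace_eq_frame p hlin]
  simp only [frameX, frameY, frameZ, framePhi, zeta_base_ofFrame, phi_ofFrame]
  simp [base, ofFrame]
  ring

end IsProfile

/-! ### Bounds for the curvature; holomorphic curvature; the Hessian of the potential. -/

namespace IsRiemannianMetricOn

variable {ι : Type} [Fintype ι] {U : Set (ι → ℝ)} {g : TwoTensor ι}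

theorem self_nonneg (hg : IsRiemannianMetricOn U g) {p : ι → ℝ} (hp : p ∈ U) (v : ι → ℝ) :
    0 ≤ g p v v := by
  by_cases hv : v = 0
  · have := hg.smul_left p hp 0 v v
    simp only [zero_smul, zero_mul] at this
    rw [hv] at this ⊢
    exact this.ge
  · exact (hg.pos p hp v hv).le

theorem add_smul_self (hg : IsRiemannianMetricOn U g) {p : ι → ℝ} (hp : p ∈ U) (t : ℝ)
    (v w : ι → ℝ) :
    g p (v + t • w) (v + t • w) = g p v v + 2 * t * g p v w + t ^ 2 * g p w w := by
  rw [hg.add_left p hp, hg.smul_left p hp, hg.symm p hp v (v + t • w),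
    hg.symm p hp w (v + t • w), hg.add_left p hp, hg.smul_left p hp, hg.add_left p hp,
    hg.smul_left p hp, hg.symm p hp w v]
  ring

/-- Cauchy–Schwarz, from the discriminant of `t ↦ g(v + t w, v + t w) ≥ 0`. -/
theorem abs_inner_le (hg : IsRiemannianMetricOn U g) {p : ι → ℝ} (hp : p ∈ U) (v w : ι → ℝ) :
    |g p v w| ≤ √(g p v v) * √(g p w w) := by
  rw [← Real.sqrt_mul (hg.self_nonneg hp v)]
  refine Real.abs_le_sqrt ?_
  have h := discrim_le_zero (a := g p w w) (b := 2 * g p v w) (c := g p v v) fun t => by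
    have := hg.self_nonneg hp (v + t • w)
    rw [hg.add_smul_self hp] at this
    linarith
  rw [discrim] at h
  linarith

end IsRiemannianMetricOn

/-- The constant is `(1 + 1 + 1 + 1 + 2) / 4`, the sum of the absolute values of the coefficients.
-/
theorem abs_spaceFormCurv_le {E : Type*} {a a' b b' : E → E → ℝ} {N : E → ℝ} (hN : ∀ v, 0 ≤ N v)
    (ha : ∀ v w, |a v w| ≤ N v * N w) (ha' : ∀ v w, |a' v w| ≤ N v * N w)
    (hb : ∀ v w, |b v w| ≤ N v * N w) (hb' : ∀ v w, |b' v w| ≤ N v * N w) (u v w x : E) :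
    |spaceFormCurv a a' b b' u v w x| ≤ 3 / 2 * (N u * N v * N w * N x) := by
  have key : ∀ {c d : E → E → ℝ}, (∀ v w, |c v w| ≤ N v * N w) → (∀ v w, |d v w| ≤ N v * N w) →
      ∀ v w x y, |c v w * d x y| ≤ N v * N w * (N x * N y) := fun hc hd v w x y => by
    rw [abs_mul]
    exact mul_le_mul (hc _ _) (hd _ _) (abs_nonneg _) (mul_nonneg (hN _) (hN _))
  have h1 := abs_le.mp (key ha hb v w u x)
  have h2 := abs_le.mp (key ha hb u w v x)
  have h3 := abs_le.mp (key ha' hb' v w u x)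
  have h4 := abs_le.mp (key ha' hb' u w v x)
  have h5 := abs_le.mp (key ha' hb' u v w x)
  have e1 : N v * N w * (N u * N x) = N u * N v * N w * N x := by ring
  have e2 : N u * N w * (N v * N x) = N u * N v * N w * N x := by ring
  have e3 : N u * N v * (N w * N x) = N u * N v * N w * N x := by ring
  rw [e1] at h1 h3
  rw [e2] at h2 h4
  rw [e3] at h5
  unfold spaceFormCurv
  rw [abs_le]
  constructor <;> linarith [h1.1, h1.2, h2.1, h2.2, h3.1, h3.2, h4.1, h4.2, h5.1, h5.2]

/-- In an orthonormal basis there are `(card ι)^4` components, each at most `C` in absolute value;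
the square root leaves `(card ι)^2`. -/
theorem curvNormLE_of_bound {ι : Type} [Fintype ι] [DecidableEq ι] {g : TwoTensor ι} {p : ι → ℝ}
    {C : ℝ} (hC : 0 ≤ C)
    (h : ∀ u v w x, |g p (riemann g p u v w) x|
      ≤ C * (√(g p u u) * √(g p v v) * √(g p w w) * √(g p x x))) :
    CurvNormLE g p ((Fintype.card ι : ℝ) ^ 2 * C) := by
  intro e he
  have h1 : ∀ i, √(g p (e i) (e i)) = 1 := fun i => by simp [he]
  have h2 : ∀ i j k l, g p (riemann g p (e i) (e j) (e k)) (e l) ^ 2 ≤ C ^ 2 := fun i j k l => by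
    rw [← sq_abs]
    have := h (e i) (e j) (e k) (e l)
    simp only [h1, mul_one] at this
    exact pow_le_pow_left₀ (abs_nonneg _) this 2
  refine Real.sqrt_le_iff.mpr ⟨by positivity, ?_⟩
  calc ∑ i, ∑ j, ∑ k, ∑ l, g p (riemann g p (e i) (e j) (e k)) (e l) ^ 2
      ≤ ∑ _i : ι, ∑ _j : ι, ∑ _k : ι, ∑ _l : ι, C ^ 2 :=
        Finset.sum_le_sum fun i _ => Finset.sum_le_sum fun j _ => Finset.sum_le_sum fun k _ =>
          Finset.sum_le_sum fun l _ => h2 i j k l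
    _ = ((Fintype.card ι : ℝ) ^ 2 * C) ^ 2 := by
        simp only [Finset.sum_const, Finset.card_univ, nsmul_eq_mul]
        ring

namespace IsProfile

variable {n : ℕ} {h : ℝ → ℝ} (hh : IsProfile h) {p : MIdx n → ℝ} (hp : p ∈ halfSpace n)

include hh hp

/-- `metricH p v w` is the inner product of `w` with the horizontal projection of `v`, and the
projection does not increase norms. The vertical estimate is the same with the other projection. -/
theorem abs_metricH_le (v w : MIdx n → ℝ) :
    |metricH p v w| ≤ √(heisMetric n h p v v) * √(heisMetric n h p w w) := by
  have hpos := hh.pos _ hp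
  have e : metricH p v w = heisMetric n h p (ofFrame p (base v) 0 0) w := by
    simp [metricH, heisMetric]
  rw [e]
  refine (hh.isRiemannianMetricOn.abs_inner_le hp _ _).trans ?_
  gcongr
  simp only [heisMetric, phi_ofFrame, zeta_base_ofFrame, horiz_base_ofFrame_left,
    horiz_base_ofFrame_right, mul_zero, zero_div, add_zero]
  have h1 := mul_nonneg hpos.le (mul_self_nonneg (zeta (base p) (base v)))
  have h2 := div_nonneg (mul_self_nonneg (phi v)) hpos.le
  linarith

theorem abs_metricV_le (v w : MIdx n → ℝ) :
    |metricV h p v w| ≤ √(heisMetric n h p v v) * √(heisMetric n h p w w) := by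
  have hp' : 0 < phi p := hp
  have e : metricV h p v w =
      heisMetric n h p (ofFrame p 0 (zeta (base p) (base v)) (phi v)) w := by
    simp [metricV, heisMetric, horiz_zero_left]
  rw [e]
  refine (hh.isRiemannianMetricOn.abs_inner_le hp _ _).trans ?_
  gcongr
  simp only [heisMetric, phi_ofFrame, zeta_base_ofFrame, horiz_base_ofFrame_left, horiz_zero_left,
    mul_zero, zero_add]
  have h1 := mul_nonneg hp'.le (horiz_self_nonneg (base v))
  linarith

/-- The 2-form is the symmetric form with `J` applied to one argument, and `J` is an isometry. -/
theorem abs_formH_le (v w : MIdx n → ℝ) :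
    |formH p v w| ≤ √(heisMetric n h p v v) * √(heisMetric n h p w w) := by
  have e : formH p v w = metricH p (heisJ n h p v) w := by
    rw [heisJ_eq_ofFrame]
    rfl
  rw [e]
  refine (hh.abs_metricH_le hp _ _).trans_eq ?_
  rw [hh.isKahlerOn.orthogonal p hp]

theorem abs_formV_le (v w : MIdx n → ℝ) :
    |formV p v w| ≤ √(heisMetric n h p v v) * √(heisMetric n h p w w) := by
  have hpos : h (phi p) ≠ 0 := (hh.pos _ hp).ne'
  have e : formV p v w = metricV h p (heisJ n h p v) w := by
    rw [heisJ_eq_ofFrame]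
    simp only [formV, metricV, phi_ofFrame, zeta_base_ofFrame]
    field_simp
    ring
  rw [e]
  refine (hh.abs_metricV_le hp _ _).trans_eq ?_
  rw [hh.isKahlerOn.orthogonal p hp]

theorem abs_riemann_le (u v w x : MIdx n → ℝ) :
    |heisMetric n h p (riemann (heisMetric n h) p u v w) x| ≤
      3 / 2 * (|curvH h (phi p)| + |curvV h (phi p)| + 2 * |curvM h (phi p)|)
        * (√(heisMetric n h p u u) * √(heisMetric n h p v v) * √(heisMetric n h p w w)
          * √(heisMetric n h p x x)) := by
  rw [hh.inner_riemann hp]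
  have hN : ∀ v, 0 ≤ √(heisMetric n h p v v) := fun v => Real.sqrt_nonneg _
  have mH := hh.abs_metricH_le hp
  have mV := hh.abs_metricV_le hp
  have fH := hh.abs_formH_le hp
  have fV := hh.abs_formV_le hp
  have e1 := abs_spaceFormCurv_le hN mH fH mH fH u v w x
  have e2 := abs_spaceFormCurv_le hN mV fV mV fV u v w x
  have e3 := abs_spaceFormCurv_le hN mH fH mV fV u v w x
  have e4 := abs_spaceFormCurv_le hN mV fV mH fH u v w x
  refine (abs_add_le _ _).trans ((add_le_add (abs_add_le _ _) le_rfl).trans ?_)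
  simp only [abs_mul]
  have e5 := (abs_add_le _ _).trans (add_le_add e3 e4)
  have f1 := mul_le_mul_of_nonneg_left e1 (abs_nonneg (curvH h (phi p)))
  have f2 := mul_le_mul_of_nonneg_left e2 (abs_nonneg (curvV h (phi p)))
  have f3 := mul_le_mul_of_nonneg_left e5 (abs_nonneg (curvM h (phi p)))
  linarith

/-- The numerator of the sectional curvature does not change when a multiple of `v` is added to `w`,
so the second vector may be made orthogonal to the first. -/
theorem inner_riemann_shear (v w : MIdx n → ℝ) (t : ℝ) :
    heisMetric n h p (riemann (heisMetric n h) p v (w + t • v) (w + t • v)) v =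
      heisMetric n h p (riemann (heisMetric n h) p v w w) v := by
  simp only [hh.inner_riemann hp, spaceFormCurv, metricH, metricV, formH, formV, base_add, phi_add,
    base_smul, phi_smul, horiz_add_left, horiz_smul_left, horiz_add_right, horiz_smul_right,
    rot_add, rot_smul, zeta_add, zeta_smul, horiz_rot_left, horiz_comm (base w) (base v)]
  ring

theorem abs_secCurv_le {v w : MIdx n → ℝ} (hvw : LinearIndependent ℝ ![v, w]) :
    |secCurv (heisMetric n h) p v w| ≤
      3 / 2 * (|curvH h (phi p)| + |curvV h (phi p)| + 2 * |curvM h (phi p)|) := by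
  have hg := hh.isRiemannianMetricOn (n := n)
  have hv : v ≠ 0 := hvw.ne_zero 0
  have hvv := hg.pos p hp v hv
  set t := heisMetric n h p v w / heisMetric n h p v v with ht
  -- Gram–Schmidt: for orthogonal `v` and `w'` the denominator is a product of squared norms, which
  -- matches the bound on the numerator.
  set w' := w + (-t) • v with hw'
  have hw : w = w' + t • v := by rw [hw', add_assoc, ← add_smul, neg_add_cancel, zero_smul, add_zero]
  have hw0 : w' ≠ 0 := by
    intro h0
    rw [h0, zero_add] at hw
    have := LinearIndependent.pair_iff.mp hvw t (-1) (by rw [hw, neg_one_smul, add_neg_cancel])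
    linarith [this.2]
  have hww := hg.pos p hp w' hw0
  have hvt : t * heisMetric n h p v v = heisMetric n h p v w := div_mul_cancel₀ _ hvv.ne'
  have hden : heisMetric n h p v v * heisMetric n h p w w - heisMetric n h p v w ^ 2
      = heisMetric n h p v v * heisMetric n h p w' w' := by
    rw [hw', hg.add_smul_self hp, hg.symm p hp w v, ← hvt]
    ring
  rw [secCurv, hden]
  conv_lhs => rw [hw, hh.inner_riemann_shear hp]
  rw [abs_div, abs_of_pos (mul_pos hvv hww), div_le_iff₀ (mul_pos hvv hww)]
  refine (hh.abs_riemann_le hp v w' w' v).trans_eq ?_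
  congr 1
  have e1 := Real.mul_self_sqrt hvv.le
  have e2 := Real.mul_self_sqrt hww.le
  calc _ = (√(heisMetric n h p v v) * √(heisMetric n h p v v))
        * (√(heisMetric n h p w' w') * √(heisMetric n h p w' w')) := by ring
    _ = _ := by rw [e1, e2]

/-- `spaceFormCurv` is additive in the pairs `(a, a')` and `(b, b')`. With equal coefficients the
four terms of the curvature add up to `c` times the space form tensor of the whole metric and the
whole Kähler form. -/
theorem secCurv_heisJ {c : ℝ} (hH : curvH h (phi p) = c) (hV : curvV h (phi p) = c)
    (hM : curvM h (phi p) = c) {v : MIdx n → ℝ} (hv : v ≠ 0) :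
    secCurv (heisMetric n h) p v (heisJ n h p v) = c := by
  have hg := hh.isRiemannianMetricOn (n := n)
  have hvv := hg.pos p hp v hv
  have hpos : h (phi p) ≠ 0 := (hh.pos _ hp).ne'
  have h0 : heisMetric n h p v (heisJ n h p v) = 0 := by
    rw [heisJ_eq_ofFrame]
    simp only [heisMetric, phi_ofFrame, zeta_base_ofFrame, horiz_base_ofFrame_right,
      horiz_rot_right]
    field_simp
    ring
  have h1 : heisMetric n h p (riemann (heisMetric n h) p v (heisJ n h p v) (heisJ n h p v)) v
      = c * heisMetric n h p v v ^ 2 := by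
    rw [hh.inner_riemann hp, hH, hV, hM, heisJ_eq_ofFrame]
    simp only [heisMetric, spaceFormCurv, metricH, metricV, formH, formV, phi_ofFrame,
      zeta_base_ofFrame, horiz_base_ofFrame_right, horiz_base_ofFrame_left, rot_base_ofFrame,
      horiz_rot_left, horiz_rot_right, horizXY_rot_left, horizXY_base_ofFrame_left,
      horizXY_base_ofFrame_right]
    field_simp
    ring
  rw [secCurv, h1, h0, hh.isKahlerOn.orthogonal p hp]
  field_simp
  ring

/-- As `φ` is a coordinate, its second derivatives vanish and only the `φ`-component of the
Christoffel symbol remains. The result has the same two blocks as the Ricci tensor, so the soliton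
equation becomes two scalar equations. -/
theorem hessian_neg_phi (v w : MIdx n → ℝ) :
    hessian (heisMetric n h) (solPotential n) p v w =
      -(h (phi p) / (2 * phi p)) * metricH p v w
        - deriv h (phi p) / 2 * metricV h p v w := by
  have hpos : h (phi p) ≠ 0 := (hh.pos _ hp).ne'
  have hp' : phi p ≠ 0 := ne_of_gt hp
  let L : (MIdx n → ℝ) →L[ℝ] ℝ := -ContinuousLinearMap.proj (.inr ())
  have hL : ∀ q v, fderiv ℝ (solPotential n) q v = -phi v := fun q v => by
    have : fderiv ℝ (solPotential n) q = L := L.fderiv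
    rw [this]
    rfl
  simp only [hessian, hL, fderiv_fun_const, Pi.zero_apply, zero_apply]
  rw [hh.christoffel_heisMetric hp]
  simp only [heisGamma, phi_ofFrame, metricH, metricV]
  field_simp
  ring

theorem gradField_neg_phi :
    gradField (heisMetric n h) (solPotential n) p = ofFrame p 0 0 (-h (phi p)) := by
  have hpos : h (phi p) ≠ 0 := (hh.pos _ hp).ne'
  let L : (MIdx n → ℝ) →L[ℝ] ℝ := -ContinuousLinearMap.proj (.inr ())
  have hL : ∀ v, fderiv ℝ (solPotential n) p v = -phi v := fun v => by
    have : fderiv ℝ (solPotential n) p = L := L.fderiv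
    rw [this]
    rfl
  refine hh.isRiemannianMetricOn.sharp_eq hp fun k => ?_
  rw [hL]
  simp only [heisMetric, phi_ofFrame, zeta_base_ofFrame, horiz_base_ofFrame_left, horiz_zero_left]
  field_simp
  ring

end IsProfile

/-! ### The soliton ODE and estimates of the profile. -/

/-- A function vanishing at `0` with `f' + f > 0` is positive on `(0, ∞)`. -/
theorem pos_of_deriv_add_self_pos {f f' : ℝ → ℝ} (hf : ∀ s, HasDerivAt f (f' s) s) (h0 : f 0 = 0)
    (h : ∀ s, 0 < s → 0 < f' s + f s) {s : ℝ} (hs : 0 < s) : 0 < f s := by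
  have hd : ∀ s, HasDerivAt (fun t => Real.exp t * f t) (Real.exp s * (f' s + f s)) s := fun s => by
    refine ((Real.hasDerivAt_exp s).fun_mul (hf s)).congr_deriv ?_
    ring
  have hmono : StrictMonoOn (fun t => Real.exp t * f t) (Ici 0) := by
    refine strictMonoOn_of_deriv_pos (convex_Ici 0)
      (fun t _ => (hd t).continuousAt.continuousWithinAt) fun t ht => ?_
    rw [interior_Ici] at ht
    rw [(hd t).deriv]
    exact mul_pos (Real.exp_pos t) (h t ht)
  have := hmono self_mem_Ici hs.le hs
  simp only [h0, mul_zero] at this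
  exact pos_of_mul_pos_right this (Real.exp_pos s).le

/-- The Taylor polynomial of degree `N - 1` of `e^{-s}`. -/
def expNegTaylor (N : ℕ) (s : ℝ) : ℝ := ∑ k ∈ Finset.range N, (-1) ^ k / (k.factorial : ℝ) * s ^ k

theorem hasDerivAt_expNegTaylor (N : ℕ) (s : ℝ) :
    HasDerivAt (expNegTaylor (N + 1)) (-expNegTaylor N s) s := by
  induction N with
  | zero =>
    have : expNegTaylor (0 + 1) = fun _ => (1 : ℝ) := by funext t; simp [expNegTaylor]
    rw [this]
    simpa [expNegTaylor] using hasDerivAt_const s (1 : ℝ)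
  | succ N ih =>
    have e : expNegTaylor (N + 1 + 1) = fun t => expNegTaylor (N + 1) t
        + (-1) ^ (N + 1) / ((N + 1).factorial : ℝ) * t ^ (N + 1) := by
      funext t
      exact Finset.sum_range_succ _ _
    rw [e]
    refine (ih.fun_add ((hasDerivAt_pow (N + 1) s).const_mul _)).congr_deriv ?_
    rw [expNegTaylor, expNegTaylor, Finset.sum_range_succ, Nat.factorial_succ]
    have h1 : (N.factorial : ℝ) ≠ 0 := by positivity
    have h2 : ((N : ℝ) + 1) ≠ 0 := by positivity
    push_cast
    field_simp
    ring

/-- The function `φ^n h(φ)` for the profile `h` of the soliton. -/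
def solPrimitive (n : ℕ) (s : ℝ) : ℝ :=
  2 * (-1) ^ (n + 1) * ((n + 1).factorial : ℝ) * (expNegTaylor (n + 2) s - Real.exp (-s))

/-- This is the soliton equation in integrated form, `P' + P = 2 s^(n+1)`. Differentiation lowers
the Taylor polynomial by one degree and changes its sign, so only the top term survives in `P' + P`;
the prefactor of `P` normalises that term. -/
theorem hasDerivAt_solPrimitive (n : ℕ) (s : ℝ) :
    HasDerivAt (solPrimitive n) (2 * s ^ (n + 1) - solPrimitive n s) s := by
  have h1 : HasDerivAt (fun t : ℝ => Real.exp (-t)) (Real.exp (-s) * -1) s :=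
    (Real.hasDerivAt_exp (-s)).comp s (hasDerivAt_neg s)
  refine (((hasDerivAt_expNegTaylor (n + 1) s).fun_sub h1).const_mul
    (2 * (-1) ^ (n + 1) * ((n + 1).factorial : ℝ))).congr_deriv ?_
  have e : expNegTaylor (n + 2) s = expNegTaylor (n + 1) s
      + (-1) ^ (n + 1) / ((n + 1).factorial : ℝ) * s ^ (n + 1) := Finset.sum_range_succ _ _
  have h2 : ((n + 1).factorial : ℝ) ≠ 0 := by positivity
  have h3 : ((-1 : ℝ) ^ (n + 1)) * (-1) ^ (n + 1) = 1 := by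
    rw [← mul_pow]; norm_num
  rw [solPrimitive, e]
  field_simp
  linear_combination s ^ (n + 1) * h3

theorem solPrimitive_zero (n : ℕ) : solPrimitive n 0 = 0 := by
  have : expNegTaylor (n + 2) 0 = 1 := by
    rw [expNegTaylor, Finset.sum_range_succ']
    simp
  simp [solPrimitive, this]

theorem contDiff_solPrimitive (n : ℕ) : ContDiff ℝ ∞ (solPrimitive n) := by
  unfold solPrimitive expNegTaylor
  fun_prop

section Primitive

variable (n : ℕ) {s : ℝ} (hs : 0 < s)

include hs

/-- In this and the following estimates, with `f` the difference of the two sides, `f' + f` is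
computed from the ODE. Here it is `2 t^(n+1)`. -/
theorem solPrimitive_pos : 0 < solPrimitive n s := by
  refine pos_of_deriv_add_self_pos (hasDerivAt_solPrimitive n) (solPrimitive_zero n)
    (fun t ht => ?_) hs
  have := pow_pos ht (n + 1)
  linarith

/-- Here `f' + f = 2 (n+1) t^n`. -/
theorem solPrimitive_lt : solPrimitive n s < 2 * s ^ (n + 1) := by
  rw [← sub_pos]
  refine pos_of_deriv_add_self_pos (f := fun t => 2 * t ^ (n + 1) - solPrimitive n t)
    (fun t => ((hasDerivAt_pow (n + 1) t).const_mul 2).fun_sub (hasDerivAt_solPrimitive n t))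
    (by simp [solPrimitive_zero]) (fun t ht => ?_) hs
  have := pow_pos ht n
  push_cast
  have h2 : 0 < 2 * (((n : ℝ) + 1) * t ^ n) := by positivity
  linarith

/-- The comparison function is the leading term of `P` at `0`, whose derivative is the source `2
t^(n+1)`; hence `f' + f` is the comparison function itself. -/
theorem solPrimitive_lt' : solPrimitive n s < 2 / ((n : ℝ) + 2) * s ^ (n + 2) := by
  rw [← sub_pos]
  refine pos_of_deriv_add_self_pos
    (f := fun t => 2 / ((n : ℝ) + 2) * t ^ (n + 2) - solPrimitive n t)
    (fun t => ((hasDerivAt_pow (n + 2) t).const_mul _).fun_sub (hasDerivAt_solPrimitive n t))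
    (by simp [solPrimitive_zero]) (fun t ht => ?_) hs
  have := pow_pos ht (n + 2)
  have h2 : 0 < 2 / ((n : ℝ) + 2) * t ^ (n + 2) := by positivity
  have h3 : 2 / ((n : ℝ) + 2) * (((n + 2 : ℕ) : ℝ) * t ^ (n + 2 - 1)) = 2 * t ^ (n + 1) := by
    have : (n : ℝ) + 2 ≠ 0 := by positivity
    push_cast
    field_simp
  linarith

/-- Here `f' + f = 2 t^(n+2) + 2 t^(n+3) / (n+2)`. -/
theorem lt_solPrimitive' :
    2 / ((n : ℝ) + 2) * s ^ (n + 2) - 2 / ((n : ℝ) + 2) * s ^ (n + 3) < solPrimitive n s := by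
  rw [← sub_pos]
  refine pos_of_deriv_add_self_pos (f := fun t => solPrimitive n t
      - (2 / ((n : ℝ) + 2) * t ^ (n + 2) - 2 / ((n : ℝ) + 2) * t ^ (n + 3)))
    (fun t => (hasDerivAt_solPrimitive n t).fun_sub (((hasDerivAt_pow (n + 2) t).const_mul _).fun_sub
      ((hasDerivAt_pow (n + 3) t).const_mul _)))
    (by simp [solPrimitive_zero]) (fun t ht => ?_) hs
  have h3 : 2 / ((n : ℝ) + 2) * (((n + 2 : ℕ) : ℝ) * t ^ (n + 2 - 1)) = 2 * t ^ (n + 1) := by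
    have : (n : ℝ) + 2 ≠ 0 := by positivity
    push_cast
    field_simp
  have h4 : 2 / ((n : ℝ) + 2) * (((n + 3 : ℕ) : ℝ) * t ^ (n + 3 - 1))
      = 2 * t ^ (n + 2) + 2 / ((n : ℝ) + 2) * t ^ (n + 2) := by
    have : (n : ℝ) + 2 ≠ 0 := by positivity
    push_cast
    field_simp
    ring
  have h5 : 0 < 2 / ((n : ℝ) + 2) * t ^ (n + 3) := by positivity
  have h6 : 0 < t ^ (n + 2) := by positivity
  linarith

/-- By the ODE this is equivalent to `h' > 0`. Here `f' + f = 4 t^(n+1) - P`, which is positive by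
`solPrimitive_lt`. -/
theorem mul_solPrimitive_lt : (s + n) * solPrimitive n s < 2 * s ^ (n + 2) := by
  rw [← sub_pos]
  refine pos_of_deriv_add_self_pos (f := fun t => 2 * t ^ (n + 2) - (t + n) * solPrimitive n t)
    (fun t => ((hasDerivAt_pow (n + 2) t).const_mul _).fun_sub
      (((hasDerivAt_id' t).add_const (n : ℝ)).fun_mul (hasDerivAt_solPrimitive n t)))
    (by simp [solPrimitive_zero]) (fun t ht => ?_) hs
  have h1 := solPrimitive_lt n ht
  have h2 : 0 < t ^ (n + 1) := by positivity
  have h3 : t ^ (n + 2) = t ^ (n + 1) * t := pow_succ _ _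
  push_cast
  linear_combination h1 + 2 * h2 - 2 * h3

variable (hn : 1 ≤ n)

include hn

/-- The first two terms of the expansion of `P` at infinity. Here `f' + f = 2 n (n+1) t^(n-1)`; both
its positivity and `f(0) = 0` use `n ≥ 1`. -/
theorem lt_solPrimitive : 2 * s ^ (n + 1) - 2 * ((n : ℝ) + 1) * s ^ n < solPrimitive n s := by
  rw [← sub_pos]
  refine pos_of_deriv_add_self_pos (f := fun t => solPrimitive n t
      - (2 * t ^ (n + 1) - 2 * ((n : ℝ) + 1) * t ^ n))
    (fun t => (hasDerivAt_solPrimitive n t).fun_sub (((hasDerivAt_pow (n + 1) t).const_mul _).fun_sub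
      ((hasDerivAt_pow n t).const_mul _)))
    (by simp [solPrimitive_zero, show n ≠ 0 by omega]) (fun t ht => ?_) hs
  have h6 : 0 < 2 * ((n : ℝ) + 1) * (n * t ^ (n - 1)) := by
    have : (0 : ℝ) < n := by exact_mod_cast hn
    positivity
  push_cast
  linarith

/-- By the ODE this is equivalent to `h' < 2`. Here `f' + f = P - 2 t^(n+1) + 2 (n+1) t^n`, which is
positive by `lt_solPrimitive`. -/
theorem lt_mul_solPrimitive :
    2 * s ^ (n + 2) - 2 * s ^ (n + 1) < (s + n) * solPrimitive n s := by
  rw [← sub_pos]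
  refine pos_of_deriv_add_self_pos
    (f := fun t => (t + n) * solPrimitive n t - (2 * t ^ (n + 2) - 2 * t ^ (n + 1)))
    (fun t => (((hasDerivAt_id' t).add_const (n : ℝ)).fun_mul (hasDerivAt_solPrimitive n t)).fun_sub
      (((hasDerivAt_pow (n + 2) t).const_mul _).fun_sub ((hasDerivAt_pow (n + 1) t).const_mul _)))
    (by simp [solPrimitive_zero]) (fun t ht => ?_) hs
  have h1 := lt_solPrimitive n ht hn
  have h3 : t ^ (n + 2) = t ^ (n + 1) * t := pow_succ _ _
  push_cast
  linear_combination h1 + 2 * h3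

end Primitive

/-- The factor `1/φ` in `F_n` raises the exponent `n - 1` to `n`; with truncated subtraction this
needs `n ≥ 1`. -/
theorem solProfile_eq {n : ℕ} (hn : 1 ≤ n) (s : ℝ) : solProfile n s = solPrimitive n s / s ^ n := by
  obtain ⟨m, rfl⟩ : ∃ m, n = m + 1 := ⟨n - 1, by omega⟩
  simp only [solProfile, profileF, solPrimitive, expNegTaylor, Nat.add_sub_cancel,
    div_eq_mul_inv, pow_succ s m, mul_inv]
  ring

section Profile

variable {n : ℕ} (hn : 1 ≤ n)

include hn

theorem isProfile_solProfile : IsProfile (solProfile n) where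
  pos s hs := by
    rw [solProfile_eq hn]
    exact div_pos (solPrimitive_pos n hs) (pow_pos hs n)
  smooth := by
    have : solProfile n = fun s => solPrimitive n s / s ^ n := funext (solProfile_eq hn)
    rw [this]
    exact (contDiff_solPrimitive n).contDiffOn.div (contDiff_id.pow n).contDiffOn
      fun s hs => (pow_pos hs n).ne'

theorem hasDerivAt_solProfile {s : ℝ} (hs : 0 < s) :
    HasDerivAt (solProfile n) (2 * s - solProfile n s - n * (solProfile n s / s)) s := by
  have e : solProfile n = fun s => solPrimitive n s / s ^ n := funext (solProfile_eq hn)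
  have h1 := (hasDerivAt_solPrimitive n s).fun_div (hasDerivAt_pow n s) (pow_pos hs n).ne'
  rw [← e] at h1
  refine h1.congr_deriv ?_
  rw [solProfile_eq hn]
  obtain ⟨m, rfl⟩ : ∃ m, n = m + 1 := ⟨n - 1, by omega⟩
  simp only [Nat.add_sub_cancel]
  field_simp
  ring

theorem deriv_solProfile {s : ℝ} (hs : 0 < s) :
    deriv (solProfile n) s = 2 * s - solProfile n s - n * (solProfile n s / s) :=
  (hasDerivAt_solProfile hn hs).deriv

theorem deriv_deriv_solProfile {s : ℝ} (hs : 0 < s) :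
    deriv (deriv (solProfile n)) s = 2 - deriv (solProfile n) s
      - n * (deriv (solProfile n) s / s - solProfile n s / s ^ 2) := by
  have e : deriv (solProfile n) =ᶠ[𝓝 s]
      fun t => 2 * t - solProfile n t - n * (solProfile n t / t) := by
    filter_upwards [Ioi_mem_nhds hs] with t ht
    exact deriv_solProfile hn ht
  rw [e.deriv_eq]
  have h1 := hasDerivAt_solProfile hn hs
  have h2 := ((((hasDerivAt_id' s).const_mul 2).fun_sub h1).fun_sub
    ((h1.fun_div (hasDerivAt_id' s) hs.ne').const_mul (n : ℝ)))
  rw [h2.deriv, deriv_solProfile hn hs]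
  field_simp

theorem solProfile_lt {s : ℝ} (hs : 0 < s) : solProfile n s < 2 * s := by
  rw [solProfile_eq hn, div_lt_iff₀ (pow_pos hs n)]
  have := solPrimitive_lt n hs
  rw [pow_succ] at this
  linarith

theorem solProfile_lt_sq {s : ℝ} (hs : 0 < s) : solProfile n s < 2 * s ^ 2 / ((n : ℝ) + 2) := by
  rw [solProfile_eq hn, div_lt_iff₀ (pow_pos hs n)]
  refine (solPrimitive_lt' n hs).trans_eq ?_
  rw [pow_add]
  ring

theorem lt_solProfile_sq {s : ℝ} (hs : 0 < s) :
    2 * s ^ 2 / ((n : ℝ) + 2) * (1 - s) < solProfile n s := by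
  rw [solProfile_eq hn, lt_div_iff₀ (pow_pos hs n)]
  refine lt_of_eq_of_lt ?_ (lt_solPrimitive' n hs)
  rw [pow_add, pow_add]
  ring

theorem lt_solProfile {s : ℝ} (hs : 0 < s) : 2 * s - 2 * ((n : ℝ) + 1) < solProfile n s := by
  rw [solProfile_eq hn, lt_div_iff₀ (pow_pos hs n)]
  refine lt_of_eq_of_lt ?_ (lt_solPrimitive n hs hn)
  rw [pow_succ]
  ring

theorem deriv_solProfile_pos {s : ℝ} (hs : 0 < s) : 0 < deriv (solProfile n) s := by
  have h1 := div_pos (sub_pos.mpr (mul_solPrimitive_lt n hs)) (pow_pos hs (n + 1))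
  rw [deriv_solProfile hn hs, solProfile_eq hn]
  refine lt_of_lt_of_eq h1 ?_
  field_simp
  ring

theorem deriv_solProfile_lt {s : ℝ} (hs : 0 < s) : deriv (solProfile n) s < 2 := by
  have h1 := div_pos (sub_pos.mpr (lt_mul_solPrimitive n hs hn)) (pow_pos hs (n + 1))
  rw [deriv_solProfile hn hs, solProfile_eq hn, ← sub_pos]
  refine lt_of_lt_of_eq h1 ?_
  field_simp
  ring

/-- For any profile this eigenvalue is `-(h' + n h/s) / (2s)`; the ODE replaces the bracket by `2s -
h`. The vertical eigenvalue is `-(h' + n h/s)' / 2` and is treated by the differentiated ODE. -/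
theorem ricciH_solProfile {s : ℝ} (hs : 0 < s) :
    ricciH n (solProfile n) s = -1 + solProfile n s / (2 * s) := by
  rw [ricciH, curvH, curvM, deriv_solProfile hn hs]
  field_simp
  ring

theorem ricciV_solProfile {s : ℝ} (hs : 0 < s) :
    ricciV n (solProfile n) s = -1 + deriv (solProfile n) s / 2 := by
  rw [ricciV, curvV, curvM, deriv_deriv_solProfile hn hs]
  ring

theorem curv_solProfile_bound : ∃ C : ℝ, 0 ≤ C ∧ ∀ s, 0 < s →
    3 / 2 * (|curvH (solProfile n) s| + |curvV (solProfile n) s| + 2 * |curvM (solProfile n) s|)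
      ≤ C := by
  -- The bounds used are `1` for `curvH`, `2 + n` for `curvV` and `2` for `curvM`.
  refine ⟨3 / 2 * (1 + (2 + n) + 2 * 2), by positivity, fun s hs => ?_⟩
  have hpos := (isProfile_solProfile hn).pos s hs
  have h1 : solProfile n s / s ^ 2 ≤ 1 := by
    rw [div_le_one (by positivity)]
    refine (solProfile_lt_sq hn hs).le.trans ?_
    rw [div_le_iff₀ (by positivity)]
    nlinarith [mul_nonneg (sq_nonneg s) (Nat.cast_nonneg (α := ℝ) n)]
  have h0 : 0 < solProfile n s / s ^ 2 := by positivity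
  have h2 : 0 < deriv (solProfile n) s / s := div_pos (deriv_solProfile_pos hn hs) hs
  -- The estimate `h' < 2` would be useless near `s = 0`; the ODE gives `h'/s ≤ 2` uniformly.
  have h3 : deriv (solProfile n) s / s ≤ 2 := by
    rw [div_le_iff₀ hs, deriv_solProfile hn hs]
    have : 0 ≤ (n : ℝ) * (solProfile n s / s) := by positivity
    linarith
  have hM : |curvM (solProfile n) s| ≤ 2 := by
    rw [curvM, abs_le]
    constructor <;> linarith
  have hH : |curvH (solProfile n) s| ≤ 1 := by
    rw [curvH, abs_le]
    constructor <;> linarith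
  have hV : |curvV (solProfile n) s| ≤ 2 + n := by
    -- The vertical soliton equation expresses `h''` through `h'` and `curvM`, which are already
    -- bounded.
    have e : curvV (solProfile n) s
        = -1 + deriv (solProfile n) s / 2 - (n : ℝ) / 2 * curvM (solProfile n) s := by
      rw [curvV, deriv_deriv_solProfile hn hs, curvM]
      ring
    have e2 : |(n : ℝ) / 2 * curvM (solProfile n) s| ≤ n := by
      rw [abs_mul, abs_of_nonneg (by positivity)]
      nlinarith [Nat.cast_nonneg (α := ℝ) n]
    have e3 := abs_le.mp e2
    have h4 := deriv_solProfile_pos hn hs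
    have h5 := deriv_solProfile_lt hn hs
    rw [e, abs_le]
    constructor <;> linarith [e3.1, e3.2]
  linarith

end Profile

/-! ### Calculus of bilinear fields along a map. -/

section BilinearField

variable {ι : Type} [Fintype ι] [DecidableEq ι] {F : Type*} [NormedAddCommGroup F] [NormedSpace ℝ F]

/-- `B` is a field of bilinear maps on `U`. -/
structure IsBilinearFieldOn (U : Set (ι → ℝ)) (B : (ι → ℝ) → (ι → ℝ) → (ι → ℝ) → F) : Prop where
  left : ∀ p ∈ U, ∀ w, IsLinearMap ℝ fun v => B p v w
  right : ∀ p ∈ U, ∀ v, IsLinearMap ℝ fun w => B p v w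

namespace IsBilinearFieldOn

variable {U : Set (ι → ℝ)} {B : (ι → ℝ) → (ι → ℝ) → (ι → ℝ) → F} (hB : IsBilinearFieldOn U B)

include hB

theorem eq_sum {p : ι → ℝ} (hp : p ∈ U) (v w : ι → ℝ) :
    B p v w = ∑ i, ∑ j, (v i * w j) • B p (coordVec i) (coordVec j) := by
  rw [(hB.left p hp w).eq_sum_coordVec v]
  refine Finset.sum_congr rfl fun i _ => ?_
  rw [(hB.right p hp _).eq_sum_coordVec w, Finset.smul_sum]
  simp only [mul_smul]

variable (hU : IsOpen U) (hd : ∀ v w, DifferentiableOn ℝ (fun p => B p v w) U)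

include hU hd

/-- Bilinearity holds only on `U`, so the expansion in coordinate vectors is valid near `p` and is
differentiated there term by term. -/
theorem hasFDerivAt_comp {E : Type*} [NormedAddCommGroup E] [NormedSpace ℝ E]
    {ψ a b : E → ι → ℝ} {ψ' a' b' : E →L[ℝ] ι → ℝ} {p : E}
    (hp : ψ p ∈ U) (hψ : HasFDerivAt ψ ψ' p) (ha : HasFDerivAt a a' p) (hb : HasFDerivAt b b' p) :
    HasFDerivAt (fun q => B (ψ q) (a q) (b q))
      (∑ i, ∑ j, ((a p i * b p j) • (fderiv ℝ (fun r => B r (coordVec i) (coordVec j)) (ψ p)).comp ψ'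
        + ((a p i • (ContinuousLinearMap.proj j).comp b'
            + b p j • (ContinuousLinearMap.proj i).comp a').smulRight
          (B (ψ p) (coordVec i) (coordVec j))))) p := by
  have h1 : ∀ i j, HasFDerivAt (fun q => (a q i * b q j) • B (ψ q) (coordVec i) (coordVec j))
      ((a p i * b p j) • (fderiv ℝ (fun r => B r (coordVec i) (coordVec j)) (ψ p)).comp ψ'
        + ((a p i • (ContinuousLinearMap.proj j).comp b'
            + b p j • (ContinuousLinearMap.proj i).comp a').smulRight
          (B (ψ p) (coordVec i) (coordVec j)))) p := fun i j => by
    have e1 : HasFDerivAt (fun r => B r (coordVec i) (coordVec j))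
        (fderiv ℝ (fun r => B r (coordVec i) (coordVec j)) (ψ p)) (ψ p) :=
      ((hd _ _).differentiableAt (hU.mem_nhds hp)).hasFDerivAt
    exact ((hasFDerivAt_pi'.mp ha i).mul (hasFDerivAt_pi'.mp hb j)).smul (e1.comp p hψ)
  have h2 := HasFDerivAt.fun_sum (u := Finset.univ) fun i _ =>
    HasFDerivAt.fun_sum (u := Finset.univ) fun j _ => h1 i j
  refine h2.congr_of_eventuallyEq ?_
  filter_upwards [hψ.continuousAt.preimage_mem_nhds (hU.mem_nhds hp)] with q hq
  exact hB.eq_sum hq _ _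

theorem fderiv_isBilinear : IsBilinearFieldOn U
    fun p v w => fderiv ℝ (fun q => B q v w) p := by
  constructor
  · intro p hp w
    refine ⟨fun u v => ?_, fun c v => ?_⟩
    · rw [← fderiv_fun_add ((hd _ _).differentiableAt (hU.mem_nhds hp))
        ((hd _ _).differentiableAt (hU.mem_nhds hp))]
      refine Filter.EventuallyEq.fderiv_eq ?_
      filter_upwards [hU.mem_nhds hp] with q hq
      exact (hB.left q hq w).map_add u v
    · rw [← fderiv_fun_const_smul ((hd _ _).differentiableAt (hU.mem_nhds hp))]
      refine Filter.EventuallyEq.fderiv_eq ?_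
      filter_upwards [hU.mem_nhds hp] with q hq
      exact (hB.left q hq w).map_smul c v
  · intro p hp w
    refine ⟨fun u v => ?_, fun c v => ?_⟩
    · rw [← fderiv_fun_add ((hd _ _).differentiableAt (hU.mem_nhds hp))
        ((hd _ _).differentiableAt (hU.mem_nhds hp))]
      refine Filter.EventuallyEq.fderiv_eq ?_
      filter_upwards [hU.mem_nhds hp] with q hq
      exact (hB.right q hq w).map_add u v
    · rw [← fderiv_fun_const_smul ((hd _ _).differentiableAt (hU.mem_nhds hp))]
      refine Filter.EventuallyEq.fderiv_eq ?_
      filter_upwards [hU.mem_nhds hp] with q hq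
      exact (hB.right q hq w).map_smul c v

/-- The Leibniz rule for a field of bilinear maps evaluated on vector fields along a map. -/
theorem fderiv_comp_apply {E : Type*} [NormedAddCommGroup E] [NormedSpace ℝ E]
    {ψ a b : E → ι → ℝ} {p : E} (hp : ψ p ∈ U) (hψ : DifferentiableAt ℝ ψ p)
    (ha : DifferentiableAt ℝ a p) (hb : DifferentiableAt ℝ b p) (u : E) :
    fderiv ℝ (fun q => B (ψ q) (a q) (b q)) p u =
      fderiv ℝ (fun r => B r (a p) (b p)) (ψ p) (fderiv ℝ ψ p u)
        + (B (ψ p) (fderiv ℝ a p u) (b p) + B (ψ p) (a p) (fderiv ℝ b p u)) := by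
  rw [(hB.hasFDerivAt_comp hU hd hp hψ.hasFDerivAt ha.hasFDerivAt hb.hasFDerivAt).fderiv,
    (hB.fderiv_isBilinear hU hd).eq_sum hp, hB.eq_sum hp (fderiv ℝ a p u), hB.eq_sum hp (a p) (fderiv ℝ b p u)]
  simp only [FunLike.coe_sum, Finset.sum_apply, add_apply, smul_apply,
    ContinuousLinearMap.comp_apply, ContinuousLinearMap.smulRight_apply,
    ContinuousLinearMap.proj_apply, ← Finset.sum_add_distrib]
  refine Finset.sum_congr rfl fun i _ => Finset.sum_congr rfl fun j _ => ?_
  simp only [smul_eq_mul, add_smul, mul_comm (b p j)]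
  abel

end IsBilinearFieldOn

theorem fderiv_fderiv_apply_comm {E : Type*} [NormedAddCommGroup E] [NormedSpace ℝ E] {f : E → F}
    {p : E} (hf : ContDiffAt ℝ ∞ f p) (u v : E) :
    fderiv ℝ (fun q => fderiv ℝ f q v) p u = fderiv ℝ (fun q => fderiv ℝ f q u) p v := by
  have hd : DifferentiableAt ℝ (fderiv ℝ f) p :=
    (hf.fderiv_right (m := ∞) (by simp)).differentiableAt (by simp)
  have h := hf.isSymmSndFDerivAt (by
    rw [minSmoothness_of_isRCLikeNormedField]
    exact WithTop.coe_le_coe.mpr (le_top : (2 : ℕ∞) ≤ ⊤))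
  have e : ∀ v w, fderiv ℝ (fun q => fderiv ℝ f q v) p w = fderiv ℝ (fderiv ℝ f) p w v := fun v w => by
    rw [fderiv_clm_apply hd (differentiableAt_const v)]
    simp
  rw [e, e]
  exact h u v

end BilinearField

/-! ### Naturality of the connection and the curvature under diffeomorphisms and scaling. -/

section Naturality

variable {ι : Type} [Fintype ι] [DecidableEq ι] {U : Set (ι → ℝ)} {g : TwoTensor ι}

namespace IsRiemannianMetricOn

variable (hg : IsRiemannianMetricOn U g)

include hg

theorem isBilinearFieldOn : IsBilinearFieldOn U g :=
  ⟨fun _ hp => hg.isLinearMap_left hp, fun _ hp => hg.isLinearMap_right hp⟩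

theorem differentiableOn (v w : ι → ℝ) : DifferentiableOn ℝ (fun p => g p v w) U :=
  (hg.smooth v w).differentiableOn (by simp)

variable (hU : IsOpen U)

include hU

theorem metricDeriv_isLinearMap_left {p : ι → ℝ} (hp : p ∈ U) (u w : ι → ℝ) :
    IsLinearMap ℝ fun v => metricDeriv g p u v w := by
  have h := (hg.isBilinearFieldOn.fderiv_isBilinear hU hg.differentiableOn).left p hp w
  exact ⟨fun v v' => congrArg (fun L => L u) (h.map_add v v'),
    fun c v => congrArg (fun L => L u) (h.map_smul c v)⟩

theorem metricDeriv_isLinearMap_right {p : ι → ℝ} (hp : p ∈ U) (u v : ι → ℝ) :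
    IsLinearMap ℝ fun w => metricDeriv g p u v w := by
  have h := (hg.isBilinearFieldOn.fderiv_isBilinear hU hg.differentiableOn).right p hp v
  exact ⟨fun w w' => congrArg (fun L => L u) (h.map_add w w'),
    fun c w => congrArg (fun L => L u) (h.map_smul c w)⟩

theorem inner_christoffel {p : ι → ℝ} (hp : p ∈ U) (v w x : ι → ℝ) :
    g p (christoffel g p v w) x =
      (1 / 2) * (metricDeriv g p v w x + metricDeriv g p w v x - metricDeriv g p x v w) := by
  refine hg.inner_sharp hp ⟨fun x y => ?_, fun c x => ?_⟩ x
  · rw [(hg.metricDeriv_isLinearMap_right hU hp v w).map_add,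
      (hg.metricDeriv_isLinearMap_right hU hp w v).map_add]
    simp only [metricDeriv, map_add]
    ring
  · rw [(hg.metricDeriv_isLinearMap_right hU hp v w).map_smul,
      (hg.metricDeriv_isLinearMap_right hU hp w v).map_smul]
    simp only [metricDeriv, map_smul, smul_eq_mul]
    ring

/-- Needed because in the transformation laws the Christoffel symbols are evaluated on the moving
vectors `dψ(v)`, and the Leibniz rule for bilinear fields is applied to them. -/
theorem christoffel_isBilinearFieldOn : IsBilinearFieldOn U (christoffel g) := by
  constructor
  · refine fun p hp w => hg.isLinearMap_of_inner hp fun x => ?_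
    simp only [hg.inner_christoffel hU hp]
    refine ⟨fun u v => ?_, fun c v => ?_⟩
    · rw [(hg.metricDeriv_isLinearMap_left hU hp w x).map_add,
        (hg.metricDeriv_isLinearMap_left hU hp x w).map_add]
      simp only [metricDeriv, map_add]
      ring
    · rw [(hg.metricDeriv_isLinearMap_left hU hp w x).map_smul,
        (hg.metricDeriv_isLinearMap_left hU hp x w).map_smul]
      simp only [metricDeriv, map_smul, smul_eq_mul]
      ring
  · refine fun p hp w => hg.isLinearMap_of_inner hp fun x => ?_
    simp only [hg.inner_christoffel hU hp]
    refine ⟨fun u v => ?_, fun c v => ?_⟩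
    · rw [(hg.metricDeriv_isLinearMap_left hU hp w x).map_add,
        (hg.metricDeriv_isLinearMap_right hU hp x w).map_add]
      simp only [metricDeriv, map_add]
      ring
    · rw [(hg.metricDeriv_isLinearMap_left hU hp w x).map_smul,
        (hg.metricDeriv_isLinearMap_right hU hp x w).map_smul]
      simp only [metricDeriv, map_smul, smul_eq_mul]
      ring

end IsRiemannianMetricOn

namespace IsDiffeoOn

variable {ψ : (ι → ℝ) → (ι → ℝ)} (hψ : IsDiffeoOn U ψ) (hU : IsOpen U)

include hψ hU

theorem contDiffAt {p : ι → ℝ} (hp : p ∈ U) : ContDiffAt ℝ ∞ ψ p :=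
  hψ.1.contDiffAt (hU.mem_nhds hp)

theorem differentiableAt_fderiv_apply {p : ι → ℝ} (hp : p ∈ U) (v : ι → ℝ) :
    ContDiffAt ℝ ∞ (fun q => fderiv ℝ ψ q v) p :=
  ((hψ.1.contDiffAt (hU.mem_nhds hp)).fderiv_right (m := ∞) (by simp)).clm_apply contDiffAt_const

/-- The differential of a diffeomorphism has an inverse that depends smoothly on the point. -/
theorem exists_inverse_fderiv : ∃ L : (ι → ℝ) → (ι → ℝ) →L[ℝ] (ι → ℝ), ContDiffOn ℝ ∞ L U ∧
    ∀ p ∈ U, (∀ v, L p (fderiv ℝ ψ p v) = v) ∧ ∀ v, fderiv ℝ ψ p (L p v) = v := by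
  obtain ⟨h1, h2, χ, h3, h4, h5⟩ := hψ
  have dψ : ∀ p ∈ U, DifferentiableAt ℝ ψ p := fun p hp =>
    (h1.contDiffAt (hU.mem_nhds hp)).differentiableAt (by simp)
  have dχ : ∀ p ∈ U, DifferentiableAt ℝ χ p := fun p hp =>
    (h3.contDiffAt (hU.mem_nhds hp)).differentiableAt (by simp)
  refine ⟨fun p => fderiv ℝ χ (ψ p), ?_, fun p hp => ⟨fun v => ?_, fun v => ?_⟩⟩
  · exact (h3.fderiv_of_isOpen hU (m := ∞) (by simp)).comp h1 h2
  · have e : (χ ∘ ψ) =ᶠ[𝓝 p] id := by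
      filter_upwards [hU.mem_nhds hp] with q hq
      exact h5.1 hq
    have e2 := e.fderiv_eq (𝕜 := ℝ)
    rw [fderiv_comp p (dχ _ (h2 hp)) (dψ p hp), fderiv_id] at e2
    exact congrArg (fun L => L v) e2
  · have e : (ψ ∘ χ) =ᶠ[𝓝 (ψ p)] id := by
      filter_upwards [hU.mem_nhds (h2 hp)] with q hq
      exact h5.2 hq
    have e2 := e.fderiv_eq (𝕜 := ℝ)
    have hχψ : χ (ψ p) = p := h5.1 hp
    rw [fderiv_comp (ψ p) (by rw [hχψ]; exact dψ p hp) (dχ _ (h2 hp)), fderiv_id, hχψ] at e2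
    exact congrArg (fun L => L v) e2

end IsDiffeoOn

/-- The rescaled pull-back `c ψ^* g`. -/
def scaledPullback (c : ℝ) (ψ : (ι → ℝ) → (ι → ℝ)) (g : TwoTensor ι) : TwoTensor ι :=
  fun p v w => c * pullback ψ g p v w

variable {ψ : (ι → ℝ) → (ι → ℝ)} {c : ℝ}

section

variable (hg : IsRiemannianMetricOn U g) (hψ : IsDiffeoOn U ψ) (hU : IsOpen U) (hc : 0 < c)

include hg hψ hU hc

theorem isRiemannianMetricOn_scaledPullback :
    IsRiemannianMetricOn U (scaledPullback c ψ g) where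
  add_left p hp u v w := by
    simp only [scaledPullback, pullback, map_add, hg.add_left _ (hψ.2.1 hp), mul_add]
  smul_left p hp t v w := by
    simp only [scaledPullback, pullback, map_smul, hg.smul_left _ (hψ.2.1 hp)]
    ring
  symm p hp v w := by
    simp only [scaledPullback, pullback, hg.symm _ (hψ.2.1 hp) (fderiv ℝ ψ p v)]
  pos p hp v hv := by
    obtain ⟨L, -, hL⟩ := hψ.exists_inverse_fderiv hU
    refine mul_pos hc (hg.pos _ (hψ.2.1 hp) _ fun h0 => hv ?_)
    rw [← (hL p hp).1 v, h0, map_zero]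
  smooth v w := by
    have e : ∀ p ∈ U, scaledPullback c ψ g p v w = c * ∑ i, ∑ j,
        (fderiv ℝ ψ p v i * fderiv ℝ ψ p w j) * g (ψ p) (coordVec i) (coordVec j) := fun p hp => by
      rw [scaledPullback, pullback, hg.isBilinearFieldOn.eq_sum (hψ.2.1 hp)]
      simp only [smul_eq_mul]
    refine ContDiffOn.congr ?_ e
    have h1 : ∀ v, ContDiffOn ℝ ∞ (fun p => fderiv ℝ ψ p v) U := fun v p hp =>
      (hψ.differentiableAt_fderiv_apply hU hp v).contDiffWithinAt
    refine contDiffOn_const.mul (ContDiffOn.sum fun i _ => ContDiffOn.sum fun j _ => ?_)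
    exact ((contDiffOn_pi.mp (h1 v) i).mul (contDiffOn_pi.mp (h1 w) j)).mul
      ((hg.smooth _ _).comp hψ.1 hψ.2.1)

/-- The transformation law of the Christoffel symbols. -/
theorem fderiv_christoffel_scaledPullback {p : ι → ℝ} (hp : p ∈ U) (v w : ι → ℝ) :
    fderiv ℝ ψ p (christoffel (scaledPullback c ψ g) p v w) =
      fderiv ℝ (fun q => fderiv ℝ ψ q w) p v
        + christoffel g (ψ p) (fderiv ℝ ψ p v) (fderiv ℝ ψ p w) := by
  have hq := hψ.2.1 hp
  have hψp := hψ.contDiffAt hU hp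
  obtain ⟨L, -, hL⟩ := hψ.exists_inverse_fderiv hU
  have hm : ∀ u v w, metricDeriv (scaledPullback c ψ g) p u v w =
      c * (metricDeriv g (ψ p) (fderiv ℝ ψ p u) (fderiv ℝ ψ p v) (fderiv ℝ ψ p w)
        + (g (ψ p) (fderiv ℝ (fun q => fderiv ℝ ψ q v) p u) (fderiv ℝ ψ p w)
          + g (ψ p) (fderiv ℝ ψ p v) (fderiv ℝ (fun q => fderiv ℝ ψ q w) p u))) := fun u v w => by
    have d : ∀ v, DifferentiableAt ℝ (fun q => fderiv ℝ ψ q v) p := fun v =>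
      (hψ.differentiableAt_fderiv_apply hU hp v).differentiableAt (by simp)
    have dψ : DifferentiableAt ℝ ψ p := hψp.differentiableAt (by simp)
    have h1 := hg.isBilinearFieldOn.fderiv_comp_apply hU hg.differentiableOn hq dψ (d v) (d w) u
    simp only [metricDeriv, ← h1, scaledPullback, pullback]
    have h2 := (hg.isBilinearFieldOn.hasFDerivAt_comp hU hg.differentiableOn hq dψ.hasFDerivAt
      (d v).hasFDerivAt (d w).hasFDerivAt).differentiableAt
    rw [fderiv_const_mul h2]
    rfl
  -- The candidate is the transformation law solved for the symbol by means of the inverse `L p` of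
  -- the differential. In the Koszul formula six terms contain second derivatives of `ψ`; by their
  -- symmetry four cancel and the other two coincide. The factor `c` stands on both sides.
  rw [(isRiemannianMetricOn_scaledPullback hg hψ hU hc).christoffel_eq hp
    (s := L p (fderiv ℝ (fun q => fderiv ℝ ψ q w) p v
        + christoffel g (ψ p) (fderiv ℝ ψ p v) (fderiv ℝ ψ p w))), (hL p hp).2]
  intro x
  rw [hm, hm, hm, scaledPullback, pullback, (hL p hp).2, hg.add_left _ hq,
    hg.inner_christoffel hU hq, fderiv_fderiv_apply_comm hψp w v,
    fderiv_fderiv_apply_comm hψp x v, fderiv_fderiv_apply_comm hψp x w,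
    hg.symm _ hq (fderiv ℝ ψ p v) (fderiv ℝ (fun q => fderiv ℝ ψ q x) p w),
    hg.symm _ hq (fderiv ℝ ψ p w) (fderiv ℝ (fun q => fderiv ℝ ψ q x) p v)]
  ring

variable (hΓ : ∀ v w, ContDiffOn ℝ ∞ (fun p => christoffel g p v w) U)

include hΓ

/-- Applying the smooth inverse of the differential to the transformation law expresses the symbol
through differentiable functions. -/
theorem differentiableAt_christoffel_scaledPullback {p : ι → ℝ} (hp : p ∈ U) (v w : ι → ℝ) :
    DifferentiableAt ℝ (fun q => christoffel (scaledPullback c ψ g) q v w) p := by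
  obtain ⟨L, hLs, hL⟩ := hψ.exists_inverse_fderiv hU
  have hq := hψ.2.1 hp
  have d1 : ContDiffAt ℝ ∞ (fun q => fderiv ℝ (fun r => fderiv ℝ ψ r w) q v) p :=
    ((hψ.differentiableAt_fderiv_apply hU hp w).fderiv_right (m := ∞) (by simp)).clm_apply
      contDiffAt_const
  have d : ∀ v, DifferentiableAt ℝ (fun q => fderiv ℝ ψ q v) p := fun v =>
    (hψ.differentiableAt_fderiv_apply hU hp v).differentiableAt (by simp)
  have d2 := ((hg.christoffel_isBilinearFieldOn hU).hasFDerivAt_comp hU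
    (fun v w => (hΓ v w).differentiableOn (by simp)) hq
    ((hψ.contDiffAt hU hp).differentiableAt (by simp)).hasFDerivAt
    (d v).hasFDerivAt (d w).hasFDerivAt).differentiableAt
  have dL : DifferentiableAt ℝ L p := (hLs.contDiffAt (hU.mem_nhds hp)).differentiableAt (by simp)
  refine (dL.clm_apply ((d1.differentiableAt (by simp)).fun_add d2)).congr_of_eventuallyEq ?_
  filter_upwards [hU.mem_nhds hp] with q hq
  rw [← fderiv_christoffel_scaledPullback hg hψ hU hc hq, (hL q hq).1]

/-- The naturality of the curvature tensor. -/
theorem fderiv_riemann_scaledPullback {p : ι → ℝ} (hp : p ∈ U) (u v w : ι → ℝ) :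
    fderiv ℝ ψ p (riemann (scaledPullback c ψ g) p u v w) =
      riemann g (ψ p) (fderiv ℝ ψ p u) (fderiv ℝ ψ p v) (fderiv ℝ ψ p w) := by
  have hq := hψ.2.1 hp
  have hB := hg.christoffel_isBilinearFieldOn hU
  have hBd : ∀ v w, DifferentiableOn ℝ (fun p => christoffel g p v w) U := fun v w =>
    (hΓ v w).differentiableOn (by simp)
  have d : ∀ v, DifferentiableAt ℝ (fun q => fderiv ℝ ψ q v) p := fun v =>
    (hψ.differentiableAt_fderiv_apply hU hp v).differentiableAt (by simp)
  have dψ : DifferentiableAt ℝ ψ p := (hψ.contDiffAt hU hp).differentiableAt (by simp)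
  have dψ' : DifferentiableAt ℝ (fderiv ℝ ψ) p :=
    ((hψ.contDiffAt hU hp).fderiv_right (m := ∞) (by simp)).differentiableAt (by simp)
  have law := fun {q} (hq : q ∈ U) v w => fderiv_christoffel_scaledPullback hg hψ hU hc hq v w
  -- The derivative of the transformation law in the direction `u`. The terms on the right that
  -- involve second or third derivatives of `ψ` are together symmetric in `u` and `v`, so they drop
  -- out of the curvature.
  have half : ∀ u v, fderiv ℝ ψ p
        (fderiv ℝ (fun q => christoffel (scaledPullback c ψ g) q v w) p u
          + christoffel (scaledPullback c ψ g) p u (christoffel (scaledPullback c ψ g) p v w)) =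
      fderiv ℝ (fun q => fderiv ℝ (fun r => fderiv ℝ ψ r w) q v) p u
        + fderiv ℝ (fun r => christoffel g r (fderiv ℝ ψ p v) (fderiv ℝ ψ p w)) (ψ p)
          (fderiv ℝ ψ p u)
        + christoffel g (ψ p) (fderiv ℝ (fun q => fderiv ℝ ψ q v) p u) (fderiv ℝ ψ p w)
        + christoffel g (ψ p) (fderiv ℝ ψ p v) (fderiv ℝ (fun q => fderiv ℝ ψ q w) p u)
        + christoffel g (ψ p) (fderiv ℝ ψ p u) (fderiv ℝ (fun q => fderiv ℝ ψ q w) p v)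
        + christoffel g (ψ p) (fderiv ℝ ψ p u)
          (christoffel g (ψ p) (fderiv ℝ ψ p v) (fderiv ℝ ψ p w)) := by
    intro u v
    have dΓ := differentiableAt_christoffel_scaledPullback hg hψ hU hc hΓ hp v w
    have e : (fun q => fderiv ℝ ψ q (christoffel (scaledPullback c ψ g) q v w)) =ᶠ[𝓝 p]
        fun q => fderiv ℝ (fun r => fderiv ℝ ψ r w) q v
          + christoffel g (ψ q) (fderiv ℝ ψ q v) (fderiv ℝ ψ q w) := by
      filter_upwards [hU.mem_nhds hp] with q hq
      exact law hq v w
    have e1 := congrArg (fun L => L u) (e.fderiv_eq (𝕜 := ℝ))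
    have d1 : DifferentiableAt ℝ (fun q => fderiv ℝ (fun r => fderiv ℝ ψ r w) q v) p :=
      (((hψ.differentiableAt_fderiv_apply hU hp w).fderiv_right (m := ∞) (by simp)).clm_apply
        contDiffAt_const).differentiableAt (by simp)
    have d2 := (hB.hasFDerivAt_comp hU hBd hq dψ.hasFDerivAt (d v).hasFDerivAt
      (d w).hasFDerivAt).differentiableAt
    have e2 : fderiv ℝ (fderiv ℝ ψ) p u (christoffel (scaledPullback c ψ g) p v w) =
        fderiv ℝ (fun q => fderiv ℝ ψ q (christoffel (scaledPullback c ψ g) p v w)) p u := by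
      rw [fderiv_clm_apply dψ' (differentiableAt_const _)]
      simp
    rw [fderiv_clm_apply dψ' dΓ, fderiv_fun_add d1 d2] at e1
    simp only [add_apply, ContinuousLinearMap.comp_apply, ContinuousLinearMap.flip_apply] at e1
    rw [hB.fderiv_comp_apply hU hBd hq dψ (d v) (d w) u, e2] at e1
    rw [map_add, eq_sub_of_add_eq e1, law hp u, law hp v, (hB.right _ hq _).map_add]
    abel
  have hu := half u v
  have hv := half v u
  have comm1 : fderiv ℝ (fun q => fderiv ℝ (fun r => fderiv ℝ ψ r w) q v) p u =
      fderiv ℝ (fun q => fderiv ℝ (fun r => fderiv ℝ ψ r w) q u) p v :=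
    fderiv_fderiv_apply_comm (hψ.differentiableAt_fderiv_apply hU hp w) u v
  have comm2 := fderiv_fderiv_apply_comm (hψ.contDiffAt hU hp) u v
  rw [comm1, comm2] at hu
  have split : riemann (scaledPullback c ψ g) p u v w =
      (fderiv ℝ (fun q => christoffel (scaledPullback c ψ g) q v w) p u
          + christoffel (scaledPullback c ψ g) p u (christoffel (scaledPullback c ψ g) p v w))
        - (fderiv ℝ (fun q => christoffel (scaledPullback c ψ g) q u w) p v
          + christoffel (scaledPullback c ψ g) p v (christoffel (scaledPullback c ψ g) p u w)) := by
    rw [riemann]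
    abel
  rw [split, map_sub, hu, hv, riemann]
  abel

/-- The endomorphisms whose traces are compared are conjugate under `dψ`, and the trace does not see
conjugation. The factor `c` disappears because the Levi-Civita connection is scale invariant. -/
theorem ricci_scaledPullback (hR : ∀ p ∈ U, ∀ v w, IsLinearMap ℝ fun u => riemann g p u v w)
    {p : ι → ℝ} (hp : p ∈ U) (v w : ι → ℝ) :
    ricci (scaledPullback c ψ g) p v w =
      ricci g (ψ p) (fderiv ℝ ψ p v) (fderiv ℝ ψ p w) := by
  obtain ⟨L, -, hL⟩ := hψ.exists_inverse_fderiv hU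
  let A := (hR _ (hψ.2.1 hp) (fderiv ℝ ψ p v) (fderiv ℝ ψ p w)).mk'
  let D : (ι → ℝ) →ₗ[ℝ] (ι → ℝ) := (fderiv ℝ ψ p : (ι → ℝ) →ₗ[ℝ] (ι → ℝ))
  let M : (ι → ℝ) →ₗ[ℝ] (ι → ℝ) := (L p : (ι → ℝ) →ₗ[ℝ] (ι → ℝ))
  have trace_eq : ∀ T : (ι → ℝ) →ₗ[ℝ] (ι → ℝ), ∑ i, T (coordVec i) i = LinearMap.trace ℝ _ T :=
    fun T => by
      rw [LinearMap.trace_eq_matrix_trace ℝ (Pi.basisFun ℝ ι), Matrix.trace]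
      exact Finset.sum_congr rfl fun i _ => by simp [coordVec]
  have hDM : D * M = 1 := LinearMap.ext fun v => (hL p hp).2 v
  have e1 : ricci (scaledPullback c ψ g) p v w = LinearMap.trace ℝ _ (M * (A * D)) := by
    rw [← trace_eq, ricci]
    refine Finset.sum_congr rfl fun i _ => ?_
    have : (M * (A * D)) (coordVec i) = L p (riemann g (ψ p) (fderiv ℝ ψ p (coordVec i))
        (fderiv ℝ ψ p v) (fderiv ℝ ψ p w)) := rfl
    rw [this, ← fderiv_riemann_scaledPullback hg hψ hU hc hΓ hp, (hL p hp).1]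
  have e2 : ricci g (ψ p) (fderiv ℝ ψ p v) (fderiv ℝ ψ p w) = LinearMap.trace ℝ _ A := by
    rw [← trace_eq]
    rfl
  rw [e1, e2, LinearMap.trace_mul_comm, mul_assoc, hDM, mul_one]

/-- Scaling multiplies `g(R(u, v)w, x)` by `c` and the product of the four norms by `c²`, whence the
bound `C / c`. -/
theorem curvNormLE_scaledPullback {p : ι → ℝ} (hp : p ∈ U) {C : ℝ} (hC : 0 ≤ C)
    (h : ∀ u v w x, |g (ψ p) (riemann g (ψ p) u v w) x|
      ≤ C * (√(g (ψ p) u u) * √(g (ψ p) v v) * √(g (ψ p) w w) * √(g (ψ p) x x))) :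
    CurvNormLE (scaledPullback c ψ g) p ((Fintype.card ι : ℝ) ^ 2 * (C / c)) := by
  refine curvNormLE_of_bound (by positivity) fun u v w x => ?_
  have e : ∀ u, √(scaledPullback c ψ g p u u) =
      √c * √(g (ψ p) (fderiv ℝ ψ p u) (fderiv ℝ ψ p u)) := fun u => by
    rw [scaledPullback, pullback, Real.sqrt_mul hc.le]
  have hsq : √c * √c = c := Real.mul_self_sqrt hc.le
  rw [e, e, e, e, scaledPullback, pullback, fderiv_riemann_scaledPullback hg hψ hU hc hΓ hp,
    abs_mul, abs_of_pos hc]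
  refine (mul_le_mul_of_nonneg_left (h _ _ _ _) hc.le).trans_eq ?_
  generalize √(g (ψ p) (fderiv ℝ ψ p u) (fderiv ℝ ψ p u)) = a
  generalize √(g (ψ p) (fderiv ℝ ψ p v) (fderiv ℝ ψ p v)) = b
  generalize √(g (ψ p) (fderiv ℝ ψ p w) (fderiv ℝ ψ p w)) = d
  generalize √(g (ψ p) (fderiv ℝ ψ p x) (fderiv ℝ ψ p x)) = e
  have : C / c * (√c * a * (√c * b) * (√c * d) * (√c * e)) =
      C / c * (a * b * d * e) * ((√c * √c) * (√c * √c)) := by ring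
  rw [this, hsq]
  field_simp

end

end Naturality

/-! ### The gradient flow on the half-line and its lift to the manifold. -/

/-- The flow of the vector field `-h` on `(0, ∞)`. -/
structure IsFlowOfNeg (h : ℝ → ℝ) (σ : ℝ → ℝ → ℝ) : Prop where
  pos : ∀ τ s, 0 < σ τ s
  smooth : ContDiffOn ℝ ∞ (fun x : ℝ × ℝ => σ x.1 x.2) (univ ×ˢ Ioi 0)
  zero : ∀ s, 0 < s → σ 0 s = s
  neg : ∀ τ s, 0 < s → σ (-τ) (σ τ s) = s
  deriv_time : ∀ τ s, 0 < s → HasDerivAt (fun τ => σ τ s) (-h (σ τ s)) τ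
  deriv_space : ∀ τ s, 0 < s → HasDerivAt (σ τ) (h (σ τ s) / h s) s

/-- A positive vector field on `(0, ∞)` with linear growth is complete. -/
theorem IsProfile.exists_flow {h : ℝ → ℝ} (hh : IsProfile h) (hlt : ∀ s, 0 < s → h s < 2 * s) :
    ∃ σ, IsFlowOfNeg h σ := by
  -- In the coordinate `r = log s` the field `-h` becomes `-1/q`; its primitive `L` below is the
  -- coordinate in which the field is `-1`.
  set q : ℝ → ℝ := fun r => Real.exp r / h (Real.exp r) with hq
  have qpos : ∀ r, 1 / 2 < q r := fun r => by
    have := hlt _ (Real.exp_pos r)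
    rw [hq, lt_div_iff₀ (hh.pos _ (Real.exp_pos r))]
    linarith
  have qsmooth : ContDiff ℝ ∞ q := by
    refine Real.contDiff_exp.div ?_ fun r => (hh.pos _ (Real.exp_pos r)).ne'
    exact hh.smooth.comp_contDiff Real.contDiff_exp fun r => Real.exp_pos r
  set L : ℝ → ℝ := fun x => ∫ r in (0 : ℝ)..x, q r with hL
  have dL : ∀ x, HasDerivAt L (q x) x := fun x =>
    (qsmooth.continuous.integral_hasStrictDerivAt 0 x).hasDerivAt
  have L0 : L 0 = 0 := intervalIntegral.integral_same
  have Lsmooth : ContDiff ℝ ∞ L := by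
    rw [contDiff_infty_iff_deriv]
    refine ⟨fun x => (dL x).differentiableAt, ?_⟩
    have : deriv L = q := funext fun x => (dL x).deriv
    rwa [this]
  have Lmono : StrictMono L := strictMono_of_deriv_pos fun x => by
    rw [(dL x).deriv]
    linarith [qpos x]
  -- As `q > 1/2`, the function `L` is unbounded in both directions, so neither end is reached in
  -- finite time.
  have Lmono' : Monotone fun x => L x - x / 2 := by
    refine monotone_of_hasDerivAt_nonneg (f' := fun x => q x - 1 / 2)
      (fun x => (dL x).fun_sub ((hasDerivAt_id' x).div_const 2)) fun x => ?_
    simp only [Pi.zero_apply]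
    linarith [qpos x]
  have Lsurj : Function.Surjective L := by
    refine Lsmooth.continuous.surjective ?_ ?_
    · refine tendsto_atTop_mono' atTop ?_ (tendsto_id.atTop_div_const (two_pos : (0 : ℝ) < 2))
      filter_upwards [eventually_ge_atTop 0] with x hx
      have := Lmono' hx
      simp only [L0, zero_div, sub_zero, sub_nonneg] at this
      exact this
    · refine tendsto_atBot_mono' atBot ?_ (tendsto_id.atBot_div_const (two_pos : (0 : ℝ) < 2))
      filter_upwards [eventually_le_atBot 0] with x hx
      have := Lmono' hx
      simp only [L0, zero_div, sub_zero, sub_nonpos] at this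
      exact this
  set E : ℝ ≃ₜ ℝ := (Lmono.orderIsoOfSurjective L Lsurj).toHomeomorph with hE
  have Eapp : ∀ x, E x = L x := fun x => rfl
  have dE : ∀ x, HasDerivAt E (q x) x := dL
  have Ssmooth : ContDiff ℝ ∞ E.symm :=
    E.contDiff_symm_deriv (fun x => (one_half_pos.trans (qpos x)).ne') dE Lsmooth
  have dS : ∀ y, HasDerivAt E.symm (q (E.symm y))⁻¹ y := fun y =>
    HasDerivAt.of_local_left_inverse E.symm.continuous.continuousAt (dE _)
      (one_half_pos.trans (qpos _)).ne' (Eventually.of_forall E.apply_symm_apply)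
  have key : ∀ x, Real.exp x * (q x)⁻¹ = h (Real.exp x) := fun x => by
    have := (hh.pos _ (Real.exp_pos x)).ne'
    rw [hq]
    field_simp
  -- The flow is translation by `-τ` in the coordinate `L(log s)`.
  refine ⟨fun τ s => Real.exp (E.symm (E (Real.log s) - τ)), ⟨fun τ s => Real.exp_pos _, ?_, ?_, ?_,
    ?_, ?_⟩⟩
  · refine Real.contDiff_exp.comp_contDiffOn (Ssmooth.comp_contDiffOn (ContDiffOn.sub ?_ ?_))
    · refine ContDiff.comp_contDiffOn (g := E) Lsmooth ?_
      exact contDiff_snd.contDiffOn.log fun x hx => (ne_of_gt hx.2)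
    · exact contDiff_fst.contDiffOn
  · intro s hs
    simp [Real.exp_log hs]
  · intro τ s hs
    simp [Real.exp_log hs]
  · intro τ s hs
    have h1 := ((dS (E (Real.log s) - τ)).comp τ ((hasDerivAt_id' τ).const_sub _)).exp
    refine h1.congr_deriv ?_
    rw [← key]
    simp only [Function.comp_apply]
    ring
  · intro τ s hs
    have h2 : HasDerivAt (fun s => E (Real.log s) - τ) (q (Real.log s) * s⁻¹) s :=
      ((dE (Real.log s)).comp s (Real.hasDerivAt_log hs.ne')).sub_const τ
    have h1 := ((dS (E (Real.log s) - τ)).comp s h2).exp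
    refine h1.congr_deriv ?_
    have e1 : q (Real.log s) * s⁻¹ = 1 / h s := by
      rw [hq]
      simp only [Real.exp_log hs]
      field_simp
    simp only [Function.comp_apply]
    rw [e1, ← key]
    ring

section Lift

variable {n : ℕ}

/-- The map `(x, y, z, φ) ↦ (x, y, z, f φ)`. -/
def liftPhi (f : ℝ → ℝ) (p : MIdx n → ℝ) : MIdx n → ℝ := Sum.elim (base p) fun _ => f (phi p)

@[simp] theorem phi_liftPhi (f : ℝ → ℝ) (p : MIdx n → ℝ) : phi (liftPhi f p) = f (phi p) := rfl

@[simp] theorem base_liftPhi (f : ℝ → ℝ) (p : MIdx n → ℝ) : base (liftPhi f p) = base p := rfl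

theorem ext_base_phi {v w : MIdx n → ℝ} (h1 : base v = base w) (h2 : phi v = phi w) : v = w := by
  ext (i | i)
  · exact congrFun h1 i
  · exact h2

theorem fderiv_liftPhi {f : ℝ → ℝ} {f' : ℝ} {p : MIdx n → ℝ} (hf : HasDerivAt f f' (phi p))
    (v : MIdx n → ℝ) :
    base (fderiv ℝ (liftPhi f) p v) = base v ∧ phi (fderiv ℝ (liftPhi f) p v) = f' * phi v := by
  let P : (MIdx n → ℝ) →L[ℝ] ℝ := ContinuousLinearMap.proj (.inr ())
  have h1 : HasFDerivAt (liftPhi f) (ContinuousLinearMap.pi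
      (Sum.elim (fun a => (ContinuousLinearMap.proj (.inl a) : (MIdx n → ℝ) →L[ℝ] ℝ))
        fun _ => f' • P)) p := by
    rw [hasFDerivAt_pi']
    rintro (a | a)
    · exact (ContinuousLinearMap.proj (.inl a) : (MIdx n → ℝ) →L[ℝ] ℝ).hasFDerivAt
    · exact hf.comp_hasFDerivAt p P.hasFDerivAt
  rw [h1.fderiv]
  exact ⟨rfl, rfl⟩

theorem ContDiffOn.liftPhi {f : ℝ → ℝ} (hf : ContDiffOn ℝ ∞ f (Ioi 0)) :
    ContDiffOn ℝ ∞ (liftPhi f) (halfSpace n) := by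
  rw [contDiffOn_pi]
  rintro (a | a)
  · exact (contDiff_apply ℝ ℝ (Sum.inl a)).contDiffOn
  · exact hf.comp contDiff_phi.contDiffOn fun p hp => hp

theorem isDiffeoOn_liftPhi {f f₁ : ℝ → ℝ} (hf : ContDiffOn ℝ ∞ f (Ioi 0))
    (hf₁ : ContDiffOn ℝ ∞ f₁ (Ioi 0)) (hpos : ∀ s, 0 < s → 0 < f s) (hpos₁ : ∀ s, 0 < s → 0 < f₁ s)
    (hl : ∀ s, 0 < s → f₁ (f s) = s) (hr : ∀ s, 0 < s → f (f₁ s) = s) :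
    IsDiffeoOn (halfSpace n) (liftPhi f) :=
  ⟨hf.liftPhi, fun _ hp => hpos _ hp, liftPhi f₁, hf₁.liftPhi, fun _ hp => hpos₁ _ hp,
    fun _ hp => ext_base_phi rfl (hl _ hp), fun _ hp => ext_base_phi rfl (hr _ hp)⟩

end Lift

/-! ### The self-similar Ricci flow. -/

section Flow

variable {n : ℕ}

/-- The diffeomorphisms generating the self-similar flow of the soliton. -/
def solDiffeo (n : ℕ) (σ : ℝ → ℝ → ℝ) (t : ℝ) : (MIdx n → ℝ) → (MIdx n → ℝ) :=
  liftPhi (σ (1 / 2 * Real.log (1 - 2 * -1 * t)))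

theorem contDiffOn_time : ContDiffOn ℝ ∞ (fun t : ℝ => 1 / 2 * Real.log (1 - 2 * -1 * t))
    (lifeSpan (-1)) := by
  refine contDiffOn_const.mul (ContDiffOn.log (by fun_prop) fun t ht => ?_)
  exact ne_of_gt ht

/-- The time change `τ = ½ log(1 + 2t)` satisfies `dτ/dt = 1/(1 + 2t)`, so it absorbs the
time-dependent factor of the vector field. The form `1 - 2 * -1 * t` is `1 - 2 lam t` at `lam = -1`,
kept to agree with `lifeSpan`. -/
theorem hasDerivAt_time {t : ℝ} (ht : t ∈ lifeSpan (-1)) :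
    HasDerivAt (fun t : ℝ => 1 / 2 * Real.log (1 - 2 * -1 * t)) (1 - 2 * -1 * t)⁻¹ t := by
  have h1 : HasDerivAt (fun t : ℝ => 1 - 2 * -1 * t) (-(2 * -1 * 1)) t :=
    ((hasDerivAt_id' t).const_mul (2 * -1)).const_sub 1
  refine ((h1.log (ne_of_gt ht)).const_mul (1 / 2)).congr_deriv ?_
  rw [div_eq_mul_inv]
  ring

namespace IsFlowOfNeg

variable {h : ℝ → ℝ} {σ : ℝ → ℝ → ℝ} (hσ : IsFlowOfNeg h σ)

include hσ

theorem smooth_space (τ : ℝ) : ContDiffOn ℝ ∞ (σ τ) (Ioi 0) :=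
  hσ.smooth.comp (contDiff_prodMk_right τ).contDiffOn fun _ hs => ⟨mem_univ _, hs⟩

theorem isDiffeoOn_solDiffeo (t : ℝ) : IsDiffeoOn (halfSpace n) (solDiffeo n σ t) :=
  isDiffeoOn_liftPhi (hσ.smooth_space _) (hσ.smooth_space (-(1 / 2 * Real.log (1 - 2 * -1 * t))))
    (fun _ _ => hσ.pos _ _) (fun _ _ => hσ.pos _ _) (fun s hs => hσ.neg _ s hs)
    fun s hs => by
      have := hσ.neg (-(1 / 2 * Real.log (1 - 2 * -1 * t))) s hs
      rwa [neg_neg] at this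

theorem contDiffOn_flow : ContDiffOn ℝ ∞ (fun x : ℝ × (MIdx n → ℝ) =>
    σ (1 / 2 * Real.log (1 - 2 * -1 * x.1)) (phi x.2)) (lifeSpan (-1) ×ˢ halfSpace n) := by
  refine hσ.smooth.comp (ContDiffOn.prodMk ?_ ?_) fun x hx => ⟨mem_univ _, hx.2⟩
  · exact contDiffOn_time.comp contDiff_fst.contDiffOn fun x hx => hx.1
  · exact contDiff_phi.comp_contDiffOn contDiff_snd.contDiffOn

theorem hasDerivAt_flow {s t : ℝ} (hs : 0 < s) (ht : t ∈ lifeSpan (-1)) :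
    HasDerivAt (fun t => σ (1 / 2 * Real.log (1 - 2 * -1 * t)) s)
      (-h (σ (1 / 2 * Real.log (1 - 2 * -1 * t)) s) * (1 - 2 * -1 * t)⁻¹) t := by
  have h1 := hσ.deriv_time (1 / 2 * Real.log (1 - 2 * -1 * t)) s hs
  exact h1.comp t (hasDerivAt_time ht)

theorem isSolitonDiffeos (hh : IsProfile h) : IsSolitonDiffeos (halfSpace n) (heisMetric n h)
    (solPotential n) (-1) (solDiffeo n σ) where
  smooth := by
    rw [contDiffOn_pi]
    rintro (a | a)
    · exact ((contDiff_apply ℝ ℝ (Sum.inl a)).comp contDiff_snd).contDiffOn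
    · exact hσ.contDiffOn_flow
  diffeo t _ := hσ.isDiffeoOn_solDiffeo t
  zero p hp := ext_base_phi rfl (by
    have := hσ.zero _ hp
    simpa [solDiffeo] using this)
  ode t ht p hp := by
    have hq : solDiffeo n σ t p ∈ halfSpace n := (hσ.isDiffeoOn_solDiffeo t).2.1 hp
    rw [hh.gradField_neg_phi hq, smul_ofFrame, hasDerivAt_pi]
    rintro ((i | i | i) | i)
    · exact (hasDerivAt_const _ _).congr_deriv (by simp [ofFrame])
    · exact (hasDerivAt_const _ _).congr_deriv (by simp [ofFrame])
    · exact (hasDerivAt_const _ _).congr_deriv (by simp [ofFrame, horizXY])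
    · exact (hσ.hasDerivAt_flow hp ht).congr_deriv (mul_comm _ _)

theorem fderiv_solDiffeo (t : ℝ) {p : MIdx n → ℝ} (hp : p ∈ halfSpace n) (v : MIdx n → ℝ) :
    base (fderiv ℝ (solDiffeo n σ t) p v) = base v ∧
      phi (fderiv ℝ (solDiffeo n σ t) p v) =
        h (σ (1 / 2 * Real.log (1 - 2 * -1 * t)) (phi p)) / h (phi p) * phi v :=
  fderiv_liftPhi (hσ.deriv_space _ _ hp) v

/-- With `S` the flowed value of `φ`, the last term is `(h(S)/h(φ))² / h(S) = h(S)/h(φ)²`. Time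
enters only through `1 + 2t`, `S` and `h(S)`, so the time derivative is elementary. -/
theorem selfSimilarFlow_eq (hh : IsProfile h) (t : ℝ) {p : MIdx n → ℝ} (hp : p ∈ halfSpace n)
    (v w : MIdx n → ℝ) :
    selfSimilarFlow (heisMetric n h) (-1) (solDiffeo n σ) t p v w =
      (1 - 2 * -1 * t) * (σ (1 / 2 * Real.log (1 - 2 * -1 * t)) (phi p) * horiz (base v) (base w)
        + h (σ (1 / 2 * Real.log (1 - 2 * -1 * t)) (phi p))
          * (zeta (base p) (base v) * zeta (base p) (base w))
        + h (σ (1 / 2 * Real.log (1 - 2 * -1 * t)) (phi p)) * (phi v * phi w / h (phi p) ^ 2)) := by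
  have h1 := (hh.pos _ hp).ne'
  have h2 := (hh.pos _ (hσ.pos (1 / 2 * Real.log (1 - 2 * -1 * t)) (phi p))).ne'
  have e := hσ.fderiv_solDiffeo t hp
  rw [selfSimilarFlow, pullback, heisMetric, (e v).1, (e v).2, (e w).1, (e w).2]
  simp only [solDiffeo, phi_liftPhi, base_liftPhi]
  field_simp

end IsFlowOfNeg

/-- The self-similar flow of the soliton is a Ricci flow. -/
theorem isRicciFlowOn_selfSimilarFlow (hn : 1 ≤ n) {σ : ℝ → ℝ → ℝ}
    (hσ : IsFlowOfNeg (solProfile n) σ) :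
    IsRicciFlowOn (lifeSpan (-1)) (halfSpace n)
      (selfSimilarFlow (solMetric n) (-1) (solDiffeo n σ)) where
  metric t ht := isRiemannianMetricOn_scaledPullback (isProfile_solProfile hn).isRiemannianMetricOn
    (hσ.isDiffeoOn_solDiffeo t) isOpen_halfSpace ht
  smooth v w := by
    have hh := isProfile_solProfile hn
    have e : ∀ x ∈ lifeSpan (-1) ×ˢ halfSpace n, _ = _ := fun x hx =>
      hσ.selfSimilarFlow_eq hh x.1 hx.2 v w
    refine ContDiffOn.congr ?_ e
    have s1 := hσ.contDiffOn_flow (n := n)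
    have s2 : ContDiffOn ℝ ∞ (fun x : ℝ × (MIdx n → ℝ) =>
        solProfile n (σ (1 / 2 * Real.log (1 - 2 * -1 * x.1)) (phi x.2)))
        (lifeSpan (-1) ×ˢ halfSpace n) := hh.smooth.comp s1 fun x _ => hσ.pos _ _
    have s3 : ContDiffOn ℝ ∞ (fun x : ℝ × (MIdx n → ℝ) => solProfile n (phi x.2) ^ 2)
        (lifeSpan (-1) ×ˢ halfSpace n) :=
      (hh.comp_phi.comp contDiff_snd.contDiffOn fun x hx => hx.2).pow 2
    have s4 : ∀ v : HIdx n → ℝ, ContDiffOn ℝ ∞ (fun x : ℝ × (MIdx n → ℝ) => zeta (base x.2) v)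
        (lifeSpan (-1) ×ˢ halfSpace n) := fun v =>
      ((contDiff_zeta v).comp contDiff_snd).contDiffOn
    refine ContDiffOn.mul (by fun_prop) (((s1.mul contDiffOn_const).add
      (s2.mul ((s4 _).mul (s4 _)))).add (s2.mul (contDiffOn_const.div s3 fun x hx => ?_)))
    exact pow_ne_zero 2 (hh.pos _ hx.2).ne'
  flow t ht p hp v w := by
    have hh := isProfile_solProfile hn
    have ht' : 1 - 2 * -1 * t ≠ 0 := ne_of_gt ht
    have hS := hσ.pos (1 / 2 * Real.log (1 - 2 * -1 * t)) (phi p)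
    have h1 := (hh.pos _ hp).ne'
    have h2 := (hh.pos _ hS).ne'
    refine HasDerivAt.hasDerivWithinAt ?_
    have e : (fun s => selfSimilarFlow (solMetric n) (-1) (solDiffeo n σ) s p v w) = _ :=
      funext fun s => hσ.selfSimilarFlow_eq hh s hp v w
    have hR : ricci (selfSimilarFlow (solMetric n) (-1) (solDiffeo n σ) t) p v w = _ :=
      ricci_scaledPullback hh.isRiemannianMetricOn
      (hσ.isDiffeoOn_solDiffeo t) isOpen_halfSpace ht hh.contDiffOn_christoffel
      (fun p hp => hh.isLinearMap_riemann hp) hp v w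
    have f := hσ.fderiv_solDiffeo t hp
    rw [e, hR, hh.ricci_heisMetric (show solDiffeo n σ t p ∈ halfSpace n from hS)]
    simp only [metricH, metricV]
    rw [(f v).1, (f v).2, (f w).1, (f w).2]
    simp only [solDiffeo, phi_liftPhi, base_liftPhi]
    rw [ricciH_solProfile hn hS, ricciV_solProfile hn hS]
    -- With `c = 1 + 2t` one has `c S' = -h(S)`. Hence `(c S)' = 2S - h(S)` and `(c h(S))' = (2 -
    -- h'(S)) h(S)`, which are `-2` times the two Ricci eigenvalues multiplied by `S` and `h(S)`.
    have d1 := hσ.hasDerivAt_flow hp ht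
    have d2 := (hh.hasDerivAt hS).comp t d1
    have d3 : HasDerivAt (fun t : ℝ => 1 - 2 * -1 * t) (-(2 * -1 * 1)) t :=
      ((hasDerivAt_id' t).const_mul (2 * -1)).const_sub 1
    refine (d3.fun_mul (((d1.mul_const (horiz (base v) (base w))).fun_add
      (d2.mul_const (zeta (base p) (base v) * zeta (base p) (base w)))).fun_add
      (d2.mul_const (phi v * phi w / solProfile n (phi p) ^ 2)))).congr_deriv ?_
    simp only [Function.comp_apply]
    generalize σ (1 / 2 * Real.log (1 - 2 * -1 * t)) (phi p) = S at *
    generalize deriv (solProfile n) S = D at *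
    generalize solProfile n S = H at *
    generalize solProfile n (phi p) = H0 at *
    generalize 1 - 2 * -1 * t = c at *
    field_simp
    ring

end Flow

/-! ### Lengths of curves and Cauchy sequences. -/

section Length

variable {ι : Type} [Fintype ι] [DecidableEq ι] {U : Set (ι → ℝ)} {g : TwoTensor ι}

theorem hasDerivAt_of_contDiffOn_Icc {γ : ℝ → ι → ℝ} (hγ : ContDiffOn ℝ 1 γ (Icc 0 1)) {t : ℝ}
    (ht : t ∈ Ioo (0 : ℝ) 1) : HasDerivAt γ (deriv γ t) t :=
  ((hγ.contDiffAt (Icc_mem_nhds ht.1 ht.2)).differentiableAt (by simp)).hasDerivAt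

/-- The speed of a `C^1` curve is continuous and its integral is the length. -/
theorem IsRiemannianMetricOn.exists_speed (hg : IsRiemannianMetricOn U g) {γ : ℝ → ι → ℝ}
    (hγ : ContDiffOn ℝ 1 γ (Icc 0 1)) (hm : MapsTo γ (Icc 0 1) U) :
    ∃ s : ℝ → ℝ, ContinuousOn s (Icc 0 1) ∧ (∀ t, 0 ≤ s t) ∧
      (∀ t ∈ Ioo (0 : ℝ) 1, √(g (γ t) (deriv γ t) (deriv γ t)) = s t) ∧
      curveLength g γ = ENNReal.ofReal (∫ t in (0 : ℝ)..1, s t) := by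
  -- At the endpoints `deriv γ` is not controlled by the behaviour on `[0, 1]`. The one-sided
  -- derivative is continuous there and agrees with `deriv` on the open interval, which suffices for
  -- integrals.
  set δ := derivWithin γ (Icc 0 1) with hδ
  set s : ℝ → ℝ := fun t => √(g (γ t) (δ t) (δ t)) with hs
  have hδc : ContinuousOn δ (Icc 0 1) :=
    hγ.continuousOn_derivWithin (uniqueDiffOn_Icc zero_lt_one) le_rfl
  have hsc : ContinuousOn s (Icc 0 1) := by
    refine ContinuousOn.sqrt ?_
    have e : ∀ t ∈ Icc (0 : ℝ) 1, g (γ t) (δ t) (δ t) =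
        ∑ i, ∑ j, (δ t i * δ t j) • g (γ t) (coordVec i) (coordVec j) := fun t ht =>
      hg.isBilinearFieldOn.eq_sum (hm ht) _ _
    refine ContinuousOn.congr ?_ e
    refine continuousOn_finsetSum _ fun i _ => continuousOn_finsetSum _ fun j _ => ?_
    exact ((continuousOn_pi.mp hδc i).mul (continuousOn_pi.mp hδc j)).smul
      ((hg.smooth _ _).continuousOn.comp hγ.continuousOn hm)
  have hse : ∀ t ∈ Ioo (0 : ℝ) 1, √(g (γ t) (deriv γ t) (deriv γ t)) = s t := fun t ht => by
    rw [hs, hδ]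
    simp only [derivWithin_of_mem_nhds (Icc_mem_nhds ht.1 ht.2)]
  refine ⟨s, hsc, fun t => Real.sqrt_nonneg _, hse, ?_⟩
  have hint : MeasureTheory.IntegrableOn s (Icc 0 1) := hsc.integrableOn_Icc
  rw [intervalIntegral.integral_of_le zero_le_one, ← MeasureTheory.integral_Icc_eq_integral_Ioc,
    MeasureTheory.ofReal_integral_eq_lintegral_ofReal hint
      (Eventually.of_forall fun t => Real.sqrt_nonneg _), curveLength,
    ← MeasureTheory.setLIntegral_congr (MeasureTheory.Ioo_ae_eq_Icc),
    ← MeasureTheory.setLIntegral_congr (MeasureTheory.Ioo_ae_eq_Icc)]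
  exact MeasureTheory.setLIntegral_congr_fun measurableSet_Ioo fun t ht => by rw [hse t ht]

/-- A function with gradient bounded by `K` along a curve of length less than `ℓ` varies by at most
`K ℓ`. -/
theorem IsRiemannianMetricOn.abs_sub_le_of_curve (hg : IsRiemannianMetricOn U g) {γ : ℝ → ι → ℝ}
    (hγ : ContDiffOn ℝ 1 γ (Icc 0 1)) (hm : MapsTo γ (Icc 0 1) U) {ℓ : ℝ}
    (hℓ : curveLength g γ < ENNReal.ofReal ℓ) {f : (ι → ℝ) → ℝ} {K : ℝ} (hK : 0 ≤ K)
    (hf : ∀ t ∈ Icc (0 : ℝ) 1, DifferentiableAt ℝ f (γ t))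
    (hb : ∀ t ∈ Icc (0 : ℝ) 1, ∀ v, |fderiv ℝ f (γ t) v| ≤ K * √(g (γ t) v v))
    {t : ℝ} (ht : t ∈ Icc (0 : ℝ) 1) : |f (γ t) - f (γ 0)| ≤ K * ℓ := by
  obtain ⟨s, hsc, hs0, hse, hlen⟩ := hg.exists_speed hγ hm
  have hint : MeasureTheory.IntegrableOn s (Icc 0 1) := hsc.integrableOn_Icc
  have hsub : Icc 0 t ⊆ Icc (0 : ℝ) 1 := Icc_subset_Icc_right ht.2
  have hlt : ∫ t in (0 : ℝ)..1, s t < ℓ := by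
    rw [hlen] at hℓ
    exact (ENNReal.ofReal_lt_ofReal_iff'.mp hℓ).1
  have hmono : ∫ y in (0 : ℝ)..t, K * s y ≤ K * ℓ := by
    rw [intervalIntegral.integral_const_mul]
    refine mul_le_mul_of_nonneg_left (le_trans ?_ hlt.le) hK
    refine intervalIntegral.integral_mono_interval le_rfl ht.1 ht.2
      (Eventually.of_forall fun t => hs0 t) ?_
    rw [intervalIntegrable_iff_integrableOn_Icc_of_le zero_le_one]
    exact hint
  have hcont : ContinuousOn (fun y => f (γ y)) (Icc 0 t) := fun y hy =>
    (hf y (hsub hy)).continuousAt.comp_continuousWithinAt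
      ((hγ.continuousOn y (hsub hy)).mono hsub)
  have hder : ∀ y ∈ Ioo 0 t, HasDerivAt (fun y => f (γ y)) (fderiv ℝ f (γ y) (deriv γ y)) y :=
    fun y hy => (hf y ⟨hy.1.le, hy.2.le.trans ht.2⟩).hasFDerivAt.comp_hasDerivAt y
      (hasDerivAt_of_contDiffOn_Icc hγ ⟨hy.1, hy.2.trans_le ht.2⟩)
  have hbd : ∀ y ∈ Ioo 0 t, |fderiv ℝ f (γ y) (deriv γ y)| ≤ K * s y := fun y hy => by
    rw [← hse y ⟨hy.1, hy.2.trans_le ht.2⟩]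
    exact hb y ⟨hy.1.le, hy.2.le.trans ht.2⟩ _
  have hint' : MeasureTheory.IntegrableOn (fun y => K * s y) (Icc 0 t) :=
    ((hint.mono_set hsub).const_mul K)
  -- The inequality form of the fundamental theorem, for `f ∘ γ` and for its negative, does not
  -- require the derivative of `f ∘ γ` to be integrable.
  have h1 := intervalIntegral.sub_le_integral_of_hasDeriv_right_of_le ht.1 hcont
    (fun y hy => (hder y hy).hasDerivWithinAt) hint' fun y hy => (le_abs_self _).trans (hbd y hy)
  have h2 := intervalIntegral.sub_le_integral_of_hasDeriv_right_of_le ht.1 hcont.neg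
    (fun y hy => (hder y hy).neg.hasDerivWithinAt) hint' fun y hy =>
      (neg_le_abs _).trans (hbd y hy)
  simp only [Pi.neg_apply] at h2
  rw [abs_le]
  constructor <;> linarith

/-- The sequence `a` is Cauchy for the Riemannian distance. -/
def IsRiemCauchy (U : Set (ι → ℝ)) (g : TwoTensor ι) (a : ℕ → ι → ℝ) : Prop :=
  ∀ ε : ℝ≥0∞, 0 < ε → ∃ N, ∀ k ≥ N, ∀ l ≥ N, riemDist U g (a k) (a l) < ε

/-- A function that is Lipschitz along short curves maps Cauchy sequences to Cauchy sequences. -/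
theorem IsRiemCauchy.cauchySeq {a : ℕ → ι → ℝ} (ha : IsRiemCauchy U g a) {X : Type*}
    [PseudoMetricSpace X] {f : (ι → ℝ) → X} {K : ℝ} (hK : 0 ≤ K)
    (h : ∀ γ : ℝ → ι → ℝ, ContDiffOn ℝ 1 γ (Icc 0 1) → MapsTo γ (Icc 0 1) U →
      (∃ k, γ 0 = a k) → (∃ k, γ 1 = a k) → ∀ ℓ ≤ 1, curveLength g γ < ENNReal.ofReal ℓ →
        dist (f (γ 1)) (f (γ 0)) ≤ K * ℓ) :
    CauchySeq fun k => f (a k) := by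
  rw [Metric.cauchySeq_iff]
  intro ε hε
  -- The cap `1` provides the bound `ℓ ≤ 1` granted to `h`; `K + 1` avoids division by zero.
  have hℓ : 0 < min 1 (ε / (K + 1)) := by positivity
  obtain ⟨N, hN⟩ := ha (ENNReal.ofReal (min 1 (ε / (K + 1)))) (by simpa using hℓ)
  refine ⟨N, fun k hk l hl => ?_⟩
  have h1 := hN l hl k hk
  simp only [riemDist, iInf_lt_iff] at h1
  obtain ⟨γ, ⟨hγ, hm, h0, h1'⟩, hlen⟩ := h1
  have h2 := h γ hγ hm ⟨l, h0⟩ ⟨k, h1'⟩ _ (min_le_left _ _) hlen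
  rw [h0, h1'] at h2
  refine h2.trans_lt ?_
  have h3 : K * min 1 (ε / (K + 1)) ≤ K * (ε / (K + 1)) :=
    mul_le_mul_of_nonneg_left (min_le_right _ _) hK
  refine h3.trans_lt ?_
  rw [← mul_div_assoc, div_lt_iff₀ (by positivity)]
  nlinarith

/-- Completeness is invariant under diffeomorphisms and rescalings. -/
theorem IsCompleteOn.scaledPullback (hcomp : IsCompleteOn U g) (hU : IsOpen U)
    {ψ : (ι → ℝ) → (ι → ℝ)} (hψ : IsDiffeoOn U ψ) {c : ℝ} (hc : 0 < c) :
    IsCompleteOn U (scaledPullback c ψ g) := by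
  intro a ha hcauchy
  obtain ⟨h1, h2, χ, h3, h4, h5⟩ := hψ
  have hsqrt : 0 < √c := Real.sqrt_pos.mpr hc
  have hlen : ∀ γ : ℝ → ι → ℝ, ContDiffOn ℝ 1 γ (Icc 0 1) → MapsTo γ (Icc 0 1) U →
      curveLength (_root_.scaledPullback c ψ g) γ = ENNReal.ofReal √c * curveLength g (ψ ∘ γ) := by
    intro γ hγ hm
    rw [curveLength, curveLength, ← MeasureTheory.lintegral_const_mul' _ _ ENNReal.ofReal_ne_top,
      ← MeasureTheory.setLIntegral_congr (MeasureTheory.Ioo_ae_eq_Icc),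
      ← MeasureTheory.setLIntegral_congr (MeasureTheory.Ioo_ae_eq_Icc)]
    refine MeasureTheory.setLIntegral_congr_fun measurableSet_Ioo fun t ht => ?_
    have hd : DifferentiableAt ℝ ψ (γ t) :=
      (h1.contDiffAt (hU.mem_nhds (hm ⟨ht.1.le, ht.2.le⟩))).differentiableAt (by simp)
    have hder := hd.hasFDerivAt.comp_hasDerivAt t (hasDerivAt_of_contDiffOn_Icc hγ ht)
    simp only [hder.deriv, _root_.scaledPullback, pullback, Function.comp_apply]
    rw [Real.sqrt_mul hc.le, ENNReal.ofReal_mul hsqrt.le]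
  obtain ⟨q, hq, hlim⟩ := hcomp (fun k => ψ (a k)) (fun k => h2 (ha k)) fun ε hε => by
    have hε' : 0 < ENNReal.ofReal √c * ε :=
      ENNReal.mul_pos (by simpa using hsqrt) hε.ne'
    obtain ⟨N, hN⟩ := hcauchy _ hε'
    refine ⟨N, fun k hk l hl => ?_⟩
    have h6 := hN k hk l hl
    simp only [riemDist, iInf_lt_iff] at h6 ⊢
    obtain ⟨γ, ⟨hγ, hm, e0, e1⟩, hlt⟩ := h6
    rw [hlen γ hγ hm] at hlt
    refine ⟨ψ ∘ γ, ⟨(h1.of_le (by simp)).comp hγ hm, h2.comp hm, by simp [e0], by simp [e1]⟩, ?_⟩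
    exact (ENNReal.mul_lt_mul_iff_right (by simpa using hsqrt) ENNReal.ofReal_ne_top).mp hlt
  refine ⟨χ q, h4 hq, ?_⟩
  have h6 : Tendsto (fun k => χ (ψ (a k))) atTop (𝓝 (χ q)) :=
    ((h3.contDiffAt (hU.mem_nhds hq)).continuousAt.tendsto).comp hlim
  exact h6.congr fun k => h5.1 (ha k)

end Length

/-! ### Completeness. -/

theorem abs_le_sqrt_horiz {n : ℕ} (v : HIdx n → ℝ) (i : Fin n) :
    |v (.inl i)| ≤ √(horiz v v) ∧ |v (.inr (.inl i))| ≤ √(horiz v v) := by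
  have h1 : v (.inl i) * v (.inl i) + v (.inr (.inl i)) * v (.inr (.inl i)) ≤ horiz v v :=
    Finset.single_le_sum (f := fun i => v (.inl i) * v (.inl i)
      + v (.inr (.inl i)) * v (.inr (.inl i)))
      (fun j _ => add_nonneg (mul_self_nonneg _) (mul_self_nonneg _)) (Finset.mem_univ i)
  constructor
  · refine Real.abs_le_sqrt ?_
    linarith [mul_self_nonneg (v (.inr (.inl i)))]
  · refine Real.abs_le_sqrt ?_
    linarith [mul_self_nonneg (v (.inl i))]

section Complete

variable {n : ℕ} {h : ℝ → ℝ} (hh : IsProfile h)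

include hh

/-- The gradient of `φ` has norm `√h`. -/
theorem IsProfile.abs_phi_le {p : MIdx n → ℝ} (hp : p ∈ halfSpace n) (v : MIdx n → ℝ) :
    |phi v| ≤ √(h (phi p)) * √(heisMetric n h p v v) := by
  have hpos := hh.pos _ hp
  have hp' : 0 < phi p := hp
  rw [← Real.sqrt_mul hpos.le]
  refine Real.abs_le_sqrt ?_
  have h1 := mul_nonneg hp'.le (horiz_self_nonneg (base v))
  have h2 := mul_nonneg hpos.le (mul_self_nonneg (zeta (base p) (base v)))
  have h3 : h (phi p) * (phi v * phi v / h (phi p)) = phi v ^ 2 := by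
    field_simp
  have h4 := mul_nonneg hpos.le (add_nonneg h1 h2)
  rw [heisMetric, mul_add, h3]
  linarith

theorem IsProfile.sqrt_horiz_le {p : MIdx n → ℝ} {a : ℝ} (ha : 0 < a) (hp : a ≤ phi p)
    (v : MIdx n → ℝ) : √(horiz (base v) (base v)) ≤ 1 / √a * √(heisMetric n h p v v) := by
  have hpos := hh.pos _ (ha.trans_le hp)
  have h2 := mul_nonneg hpos.le (mul_self_nonneg (zeta (base p) (base v)))
  have h3 := div_nonneg (mul_self_nonneg (phi v)) hpos.le
  have h4 := mul_le_mul_of_nonneg_right hp (horiz_self_nonneg (base v))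
  rw [one_div, ← div_eq_inv_mul, le_div_iff₀ (Real.sqrt_pos.mpr ha),
    ← Real.sqrt_mul (horiz_self_nonneg _)]
  refine Real.sqrt_le_sqrt ?_
  rw [heisMetric]
  linarith

theorem IsProfile.abs_zeta_le {p : MIdx n → ℝ} (hp : p ∈ halfSpace n) {c : ℝ} (hc : 0 < c)
    (hcp : c ≤ h (phi p)) (v : MIdx n → ℝ) :
    |zeta (base p) (base v)| ≤ 1 / √c * √(heisMetric n h p v v) := by
  have hp' : 0 < phi p := hp
  have hpos := hh.pos _ hp
  have h1 := mul_nonneg hp'.le (horiz_self_nonneg (base v))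
  have h3 := div_nonneg (mul_self_nonneg (phi v)) hpos.le
  have h4 := mul_le_mul_of_nonneg_right hcp (mul_self_nonneg (zeta (base p) (base v)))
  rw [one_div, ← div_eq_inv_mul, le_div_iff₀ (Real.sqrt_pos.mpr hc), ← Real.sqrt_sq_eq_abs,
    ← Real.sqrt_mul (sq_nonneg _)]
  refine Real.sqrt_le_sqrt ?_
  rw [heisMetric]
  linarith

/-- The gradient of `log φ` has norm `√h / φ ≤ 1`, so `φ` stays in a compact interval of `(0, ∞)`
along the short curves joining members of the sequence. There `dx`, `dy` and `ζ` are bounded in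
terms of `g`, and each coordinate of the sequence is Cauchy in `ℝ`. -/
theorem IsProfile.isCompleteOn (hle : ∀ s, 0 < s → h s ≤ s ^ 2) :
    IsCompleteOn (halfSpace n) (heisMetric n h) := by
  intro a ha hcauchy
  have hg := hh.isRiemannianMetricOn (n := n)
  have hcauchy' : IsRiemCauchy (halfSpace n) (heisMetric n h) a := hcauchy
  let P : (MIdx n → ℝ) →L[ℝ] ℝ := ContinuousLinearMap.proj (.inr ())
  have dlog : ∀ p ∈ halfSpace n, HasFDerivAt (fun p : MIdx n → ℝ => Real.log (phi p))
      ((phi p)⁻¹ • P) p := fun p hp => by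
    have hP : HasFDerivAt phi P p := P.hasFDerivAt
    exact (Real.hasDerivAt_log (ne_of_gt hp)).comp_hasFDerivAt p hP
  have hlog : ∀ γ : ℝ → MIdx n → ℝ, ContDiffOn ℝ 1 γ (Icc 0 1) →
      MapsTo γ (Icc 0 1) (halfSpace n) → ∀ ℓ, curveLength (heisMetric n h) γ < ENNReal.ofReal ℓ →
      ∀ t ∈ Icc (0 : ℝ) 1, |Real.log (phi (γ t)) - Real.log (phi (γ 0))| ≤ 1 * ℓ := by
    intro γ hγ hm ℓ hℓ t ht
    refine hg.abs_sub_le_of_curve hγ hm hℓ (f := fun p => Real.log (phi p)) zero_le_one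
      (fun t ht => (dlog _ (hm ht)).differentiableAt) (fun t ht v => ?_) ht
    have hp : 0 < phi (γ t) := hm ht
    rw [(dlog _ (hm ht)).fderiv]
    have e : ((phi (γ t))⁻¹ • P) v
      = (phi (γ t))⁻¹ * phi v := rfl
    rw [e, abs_mul, abs_of_pos (inv_pos.mpr hp), one_mul, inv_mul_le_iff₀ hp]
    refine (hh.abs_phi_le (hm ht) v).trans ?_
    refine mul_le_mul_of_nonneg_right ?_ (Real.sqrt_nonneg _)
    exact Real.sqrt_le_iff.mpr ⟨hp.le, hle _ hp⟩
  have c1 : CauchySeq fun k => Real.log (phi (a k)) :=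
    hcauchy'.cauchySeq (f := fun p => Real.log (phi p)) zero_le_one fun γ hγ hm _ _ ℓ _ hℓ =>
      hlog γ hγ hm ℓ hℓ 1 (right_mem_Icc.mpr zero_le_one)
  obtain ⟨B, hB⟩ := c1.isBounded_range.exists_norm_le
  have hB' : ∀ k, |Real.log (phi (a k))| ≤ B := fun k => hB _ (mem_range_self k)
  have hrange : ∀ γ : ℝ → MIdx n → ℝ, ContDiffOn ℝ 1 γ (Icc 0 1) →
      MapsTo γ (Icc 0 1) (halfSpace n) → (∃ k, γ 0 = a k) → ∀ ℓ ≤ 1,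
      curveLength (heisMetric n h) γ < ENNReal.ofReal ℓ →
      ∀ t ∈ Icc (0 : ℝ) 1, phi (γ t) ∈ Icc (Real.exp (-(B + 1))) (Real.exp (B + 1)) := by
    rintro γ hγ hm ⟨k, hk⟩ ℓ hℓ1 hℓ t ht
    have h1 := abs_le.mp (hlog γ hγ hm ℓ hℓ t ht)
    have h2 := abs_le.mp (hB' k)
    rw [hk] at h1
    rw [← Real.exp_log (hm ht : 0 < phi (γ t))]
    exact ⟨Real.exp_le_exp.mpr (by linarith), Real.exp_le_exp.mpr (by linarith)⟩
  -- the horizontal coordinates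
  set m := Real.exp (-(B + 1)) with hm_def
  have mpos : 0 < m := Real.exp_pos _
  have dcoord : ∀ (j : MIdx n) (p v : MIdx n → ℝ),
      DifferentiableAt ℝ (fun p : MIdx n → ℝ => p j) p ∧
        fderiv ℝ (fun p : MIdx n → ℝ => p j) p v = v j := fun j p v => by
    have := (ContinuousLinearMap.proj j : (MIdx n → ℝ) →L[ℝ] ℝ).hasFDerivAt (x := p)
    exact ⟨this.differentiableAt, congrArg (fun L => L v) this.fderiv⟩
  have hcoord : ∀ j : Fin n ⊕ Fin n, ∀ γ : ℝ → MIdx n → ℝ, ContDiffOn ℝ 1 γ (Icc 0 1) →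
      MapsTo γ (Icc 0 1) (halfSpace n) → (∃ k, γ 0 = a k) → ∀ ℓ ≤ 1,
      curveLength (heisMetric n h) γ < ENNReal.ofReal ℓ → ∀ t ∈ Icc (0 : ℝ) 1,
      |γ t (.inl (Sum.elim Sum.inl (fun i => .inr (.inl i)) j))
        - γ 0 (.inl (Sum.elim Sum.inl (fun i => .inr (.inl i)) j))| ≤ 1 / √m * ℓ := by
    intro j γ hγ hm hk ℓ hℓ1 hℓ t ht
    refine hg.abs_sub_le_of_curve hγ hm hℓ (f := fun p => p _) (by positivity)
      (fun t ht => (dcoord _ _ 0).1) (fun t ht v => ?_) ht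
    rw [(dcoord _ _ v).2]
    refine le_trans ?_ (hh.sqrt_horiz_le mpos (hrange γ hγ hm hk ℓ hℓ1 hℓ t ht).1 v)
    rcases j with i | i
    · exact (abs_le_sqrt_horiz (base v) i).1
    · exact (abs_le_sqrt_horiz (base v) i).2
  have c2 : ∀ j : Fin n ⊕ Fin n, CauchySeq fun k =>
      a k (.inl (Sum.elim Sum.inl (fun i => .inr (.inl i)) j)) := fun j =>
    hcauchy'.cauchySeq (f := fun p => p (.inl (Sum.elim Sum.inl (fun i => .inr (.inl i)) j)))
      (by positivity) fun γ hγ hm hk _ ℓ hℓ1 hℓ =>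
      hcoord j γ hγ hm hk ℓ hℓ1 hℓ 1 (right_mem_Icc.mpr zero_le_one)
  choose R hR using fun j => (c2 j).isBounded_range.exists_norm_le
  have hR' : ∀ j k, |a k (.inl (Sum.elim Sum.inl (fun i => .inr (.inl i)) j))| ≤ R j :=
    fun j k => hR j _ (mem_range_self k)
  -- the central coordinate
  obtain ⟨s₀, hs₀, hmin⟩ := (isCompact_Icc (a := m) (b := Real.exp (B + 1))).exists_isMinOn
    (nonempty_Icc.mpr (Real.exp_le_exp.mpr (by
      have := (abs_nonneg _).trans (hB' 0)
      linarith)))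
    (hh.smooth.continuousOn.mono fun s hs => mpos.trans_le hs.1)
  have cpos : 0 < h s₀ := hh.pos _ (mpos.trans_le hs₀.1)
  have c3 : CauchySeq fun k => a k (.inl (.inr (.inr ()))) := by
    -- Since `dz = ∑ x_i dy_i - ζ`, the bound needs the `x_i` bounded along the whole curve: they
    -- start within `R` and move by at most `1 / √m`, the length being less than `1`.
    refine hcauchy'.cauchySeq (f := fun p => p (.inl (.inr (.inr ()))))
      (K := ∑ i, (|R (.inl i)| + 1 / √m) * (1 / √m) + 1 / √(h s₀)) (by positivity)
      fun γ hγ hm hk _ ℓ hℓ1 hℓ => ?_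
    refine hg.abs_sub_le_of_curve hγ hm hℓ (f := fun p => p (.inl (.inr (.inr ()))))
      (by positivity) (fun t ht => (dcoord _ _ 0).1) (fun t ht v => ?_)
      (right_mem_Icc.mpr zero_le_one)
    have hφ := hrange γ hγ hm hk ℓ hℓ1 hℓ t ht
    rw [(dcoord _ _ v).2]
    have e : v (.inl (.inr (.inr ()))) = horizXY (base (γ t)) (base v)
        - zeta (base (γ t)) (base v) := by
      rw [zeta_eq]
      simp [base]
    have hx : ∀ i, |γ t (.inl (.inl i))| ≤ |R (.inl i)| + 1 / √m := fun i => by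
      obtain ⟨k, hk'⟩ := hk
      have h1 := hcoord (.inl i) γ hγ hm ⟨k, hk'⟩ ℓ hℓ1 hℓ t ht
      have h2 := hR' (.inl i) k
      rw [hk'] at h1
      simp only [Sum.elim_inl] at h1 h2
      have h3 : 1 / √m * ℓ ≤ 1 / √m := mul_le_of_le_one_right (by positivity) hℓ1
      have h4 := abs_sub_abs_le_abs_sub (γ t (.inl (.inl i))) (a k (.inl (.inl i)))
      linarith [le_abs_self (R (.inl i))]
    rw [e]
    refine (abs_sub _ _).trans ?_
    rw [add_mul, Finset.sum_mul]
    refine add_le_add ((Finset.abs_sum_le_sum_abs _ _).trans (Finset.sum_le_sum fun i _ => ?_))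
      (hh.abs_zeta_le (hm ht) cpos (hmin hφ) v)
    rw [abs_mul, mul_assoc]
    refine mul_le_mul (hx i) ?_ (abs_nonneg _) (by positivity)
    exact ((abs_le_sqrt_horiz (base v) i).2).trans (hh.sqrt_horiz_le mpos hφ.1 v)
  -- the limit
  obtain ⟨u, hu⟩ := cauchySeq_tendsto_of_complete c1
  choose x hx using fun j => cauchySeq_tendsto_of_complete (c2 j)
  obtain ⟨z, hz⟩ := cauchySeq_tendsto_of_complete c3
  refine ⟨Sum.elim (Sum.elim (fun i => x (.inl i)) (Sum.elim (fun i => x (.inr i)) fun _ => z))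
    fun _ => Real.exp u, Real.exp_pos u, ?_⟩
  rw [tendsto_pi_nhds]
  rintro ((i | i | i) | i)
  · exact hx (.inl i)
  · exact hx (.inr i)
  · exact hz
  · exact ((Real.continuous_exp.tendsto u).comp hu).congr fun k => Real.exp_log (ha k)

end Complete

/-! ### Ends of a space with an exhaustion whose complements have two components -/

section Ends

variable {X : Type} [TopologicalSpace X]

/-- An exhaustion of `X` by compact sets `K m` whose complements have the two components
`U true m` and `U false m`. -/
structure IsTwoEndedExhaustion (K : ℕ → Set X) (U : Bool → ℕ → Set X) : Prop where
  compact : ∀ m, IsCompact (K m)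
  mono : Monotone K
  exhaust : ∀ L, IsCompact L → ∃ m, L ⊆ K m
  union : ∀ m, (K m)ᶜ = U true m ∪ U false m
  disjoint : ∀ m, Disjoint (U true m) (U false m)
  isOpen : ∀ b m, IsOpen (U b m)
  preconnected : ∀ b m, IsPreconnected (U b m)
  nonempty : ∀ b m, (U b m).Nonempty
  anti : ∀ b, Antitone (U b)

namespace IsTwoEndedExhaustion

variable {K : ℕ → Set X} {U : Bool → ℕ → Set X} (h : IsTwoEndedExhaustion K U)

include h

theorem compl_eq (b : Bool) (m : ℕ) : (K m)ᶜ = U b m ∪ U (!b) m := by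
  cases b
  · simpa [union_comm] using h.union m
  · exact h.union m

theorem disjoint' (b : Bool) (m : ℕ) : Disjoint (U b m) (U (!b) m) := by
  cases b
  · exact (h.disjoint m).symm
  · exact h.disjoint m

/-- The two disjoint open pieces cover the complement, so a connected set meeting one piece lies in
it; conversely the piece is itself connected. -/
theorem component_eq {b : Bool} {m : ℕ} {x : X} (hx : x ∈ U b m) :
    connectedComponentIn (K m)ᶜ x = U b m := by
  have hsub : U b m ⊆ (K m)ᶜ := by
    rw [h.compl_eq b]
    exact subset_union_left
  refine Subset.antisymm ?_ ((h.preconnected b m).subset_connectedComponentIn hx hsub)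
  refine IsPreconnected.subset_left_of_subset_union (h.isOpen b m) (h.isOpen (!b) m)
    (h.disjoint' b m) ?_ ⟨x, mem_connectedComponentIn (hsub hx), hx⟩
    isPreconnected_connectedComponentIn
  rw [← h.compl_eq b]
  exact connectedComponentIn_subset _ _

theorem isEnd_iInf (b : Bool) : IsEnd (⨅ m, 𝓟 (U b m)) := by
  classical
  choose m hm using h.exhaust
  -- For compact `L` inside `K m` take the component of `Lᶜ` that contains `U b m`. The value at
  -- non-compact sets is irrelevant.
  let C : Set X → Set X := fun L =>
    if hL : IsCompact L then connectedComponentIn Lᶜ (h.nonempty b (m L hL)).some else ∅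
  have hsub : ∀ L (hL : IsCompact L), U b (m L hL) ⊆ Lᶜ := fun L hL =>
    ((subset_union_left (t := U (!b) (m L hL))).trans_eq (h.compl_eq b _).symm).trans
      (compl_subset_compl.mpr (hm L hL))
  have hC : ∀ L (hL : IsCompact L), C L = connectedComponentIn Lᶜ (h.nonempty b (m L hL)).some :=
    fun L hL => dif_pos hL
  have hsub' : ∀ L (hL : IsCompact L), U b (m L hL) ⊆ C L := fun L hL => by
    rw [hC L hL]
    exact (h.preconnected b _).subset_connectedComponentIn (h.nonempty b _).some_mem (hsub L hL)
  refine ⟨C, fun L hL => ⟨_, hsub L hL (h.nonempty b (m L hL)).some_mem, hC L hL⟩, ?_, ?_⟩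
  · intro L L' hL hL' hLL'
    -- Both components contain a common point far out in the end, and may be described as the
    -- components of that point.
    have hmeet : (U b (m L hL) ∩ U b (m L' hL')).Nonempty :=
      (h.nonempty b (max (m L hL) (m L' hL'))).mono
        (subset_inter (h.anti b (le_max_left _ _)) (h.anti b (le_max_right _ _)))
    obtain ⟨y, hy, hy'⟩ := hmeet
    have e1 : C L = connectedComponentIn Lᶜ y := by
      have hy1 := hsub' L hL hy
      rw [hC L hL] at hy1 ⊢
      exact connectedComponentIn_eq hy1
    have e2 : C L' = connectedComponentIn L'ᶜ y := by
      have hy1 := hsub' L' hL' hy'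
      rw [hC L' hL'] at hy1 ⊢
      exact connectedComponentIn_eq hy1
    rw [e1, e2]
    exact connectedComponentIn_mono y (compl_subset_compl.mpr hLL')
  · refine le_antisymm (le_iInf₂ fun L hL => (iInf_le _ (m L hL)).trans ?_)
      (le_iInf fun k => (iInf₂_le (K k) (h.compact k)).trans ?_)
    · exact principal_mono.mpr (hsub' L hL)
    · refine principal_mono.mpr ?_
      have hmeet : (U b k ∩ U b (m (K k) (h.compact k))).Nonempty :=
        (h.nonempty b (max k (m (K k) (h.compact k)))).mono
          (subset_inter (h.anti b (le_max_left _ _)) (h.anti b (le_max_right _ _)))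
      obtain ⟨y, hy, hy'⟩ := hmeet
      have hy1 := hsub' (K k) (h.compact k) hy'
      rw [hC _ (h.compact k)] at hy1 ⊢
      rw [connectedComponentIn_eq hy1, h.component_eq hy]

theorem isEnd_iff (F : Filter X) :
    IsEnd F ↔ F = ⨅ m, 𝓟 (U false m) ∨ F = ⨅ m, 𝓟 (U true m) := by
  refine ⟨?_, by rintro (rfl | rfl) <;> exact h.isEnd_iInf _⟩
  rintro ⟨C, hC, hmono, rfl⟩
  have h1 : ∀ m, ∃ b, C (K m) = U b m := fun m => by
    obtain ⟨x, hx, e⟩ := hC (K m) (h.compact m)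
    rw [h.compl_eq true] at hx
    rcases hx with hx | hx
    · exact ⟨true, e.trans (h.component_eq hx)⟩
    · exact ⟨false, e.trans (h.component_eq hx)⟩
  choose b hb using h1
  -- Nestedness forbids a change of side: the chosen piece at level `m` lies in the chosen piece at
  -- level `0`, which is disjoint from the other side. Since the `K m` exhaust the space, the side
  -- then determines the filter.
  have hconst : ∀ m, b m = b 0 := fun m => by
    by_contra hne
    have h2 := hmono _ _ (h.compact 0) (h.compact m) (h.mono (Nat.zero_le m))
    rw [hb, hb] at h2
    obtain ⟨y, hy⟩ := h.nonempty (b m) m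
    have hne' : b m = !(b 0) := by
      revert hne
      cases b m <;> cases b 0 <;> simp
    have h3 := h.anti (b m) (Nat.zero_le m) hy
    rw [hne'] at h3
    exact (h.disjoint' (b 0) 0).le_bot ⟨h2 hy, h3⟩
  have e : (⨅ (L : Set X) (_ : IsCompact L), 𝓟 (C L)) = ⨅ m, 𝓟 (U (b 0) m) := by
    refine le_antisymm (le_iInf fun k => (iInf₂_le (K k) (h.compact k)).trans_eq ?_)
      (le_iInf₂ fun L hL => ?_)
    · rw [hb, hconst]
    · obtain ⟨k, hk⟩ := h.exhaust L hL
      refine (iInf_le _ k).trans (principal_mono.mpr ?_)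
      have := hmono _ _ hL (h.compact k) hk
      rwa [hb, hconst] at this
  rw [e]
  cases b 0
  · exact Or.inl rfl
  · exact Or.inr rfl

end IsTwoEndedExhaustion

/-- The exhaustion of `N × (0, ∞)` by the sets `N × [1/(m+1), m+1]`. -/
theorem isTwoEndedExhaustion_prod (N : Type) [TopologicalSpace N] [CompactSpace N]
    [ConnectedSpace N] :
    IsTwoEndedExhaustion (X := N × Ioi (0 : ℝ))
      (fun m => {q | (q.2 : ℝ) ∈ Icc (1 / ((m : ℝ) + 1)) ((m : ℝ) + 1)})
      (fun b m => {q | if b then (m : ℝ) + 1 < q.2 else (q.2 : ℝ) < 1 / ((m : ℝ) + 1)}) := by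
  have hpos : ∀ m : ℕ, (0 : ℝ) < (m : ℝ) + 1 := fun m => by positivity
  have hinv : ∀ m : ℕ, 1 / ((m : ℝ) + 1) ≤ (m : ℝ) + 1 := fun m => by
    rw [div_le_iff₀ (hpos m)]
    nlinarith [(Nat.cast_nonneg m : (0 : ℝ) ≤ m)]
  have hcont : Continuous fun q : N × Ioi (0 : ℝ) => (q.2 : ℝ) :=
    continuous_subtype_val.comp continuous_snd
  refine ⟨fun m => ?_, fun m m' hmm q hq => ?_, fun L hL => ?_, fun m => ?_, fun m => ?_,
    fun b m => ?_, fun b m => ?_, fun b m => ?_, fun b m m' hmm q hq => ?_⟩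
  · have h1 : IsCompact ((↑) ⁻¹' Icc (1 / ((m : ℝ) + 1)) ((m : ℝ) + 1) : Set (Ioi (0 : ℝ))) := by
      refine Topology.IsInducing.subtypeVal.isCompact_preimage_iff ?_ |>.mpr isCompact_Icc
      rw [Subtype.range_coe]
      exact fun s hs => (one_div_pos.mpr (hpos m)).trans_le hs.1
    have h2 := (isCompact_univ (X := N)).prod h1
    convert h2 using 1
    ext q
    simp
  · have : (m : ℝ) ≤ m' := by exact_mod_cast hmm
    exact ⟨(one_div_le_one_div_of_le (hpos m) (by linarith)).trans hq.1, hq.2.trans (by linarith)⟩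
  · obtain ⟨B, hB⟩ := (hL.image hcont).isBounded.bddAbove
    have hcont' : Continuous fun q : N × Ioi (0 : ℝ) => 1 / (q.2 : ℝ) :=
      continuous_const.div hcont fun q => (q.2.2 : (0 : ℝ) < q.2).ne'
    obtain ⟨B', hB'⟩ := (hL.image hcont').isBounded.bddAbove
    obtain ⟨m, hm⟩ := exists_nat_ge (max B B')
    refine ⟨m, fun q hq => ⟨?_, ?_⟩⟩
    · have h1 : 1 / (q.2 : ℝ) ≤ B' := hB' (mem_image_of_mem _ hq)
      have h2 : (0 : ℝ) < q.2 := q.2.2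
      have h3 : 1 / (q.2 : ℝ) ≤ (m : ℝ) + 1 := by linarith [le_max_right B B']
      rwa [one_div_le h2 (hpos m)] at h3
    · have h1 : (q.2 : ℝ) ≤ B := hB (mem_image_of_mem _ hq)
      linarith [le_max_left B B']
  · ext q
    simp only [mem_compl_iff, mem_ofPred_eq, mem_Icc, not_and_or, not_le, mem_union, if_true,
      Bool.false_eq_true, if_false]
    exact or_comm
  · refine Set.disjoint_left.mpr fun q hq hq' => ?_
    simp only [mem_ofPred_eq, if_true, Bool.false_eq_true, if_false] at hq hq'
    linarith [hinv m]
  · cases b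
    · simpa using isOpen_lt hcont continuous_const
    · simpa using isOpen_lt continuous_const hcont
  · have key : ∀ S : Set ℝ, S ⊆ Ioi 0 → S.OrdConnected →
        IsPreconnected {q : N × Ioi (0 : ℝ) | (q.2 : ℝ) ∈ S} := fun S hS hord => by
      have h1 : IsPreconnected ((↑) ⁻¹' S : Set (Ioi (0 : ℝ))) := by
        refine Topology.IsInducing.subtypeVal.isPreconnected_image.mp ?_
        rw [Subtype.image_preimage_coe, inter_eq_right.mpr hS]
        exact hord.isPreconnected
      have h2 := (isPreconnected_univ (α := N)).prod h1
      convert h2 using 1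
      ext q
      simp
    cases b
    · convert key (Ioo 0 (1 / ((m : ℝ) + 1))) (fun s hs => hs.1) ordConnected_Ioo using 1
      ext q
      have : (0 : ℝ) < q.2 := q.2.2
      simp [this]
    · convert key (Ioi ((m : ℝ) + 1)) (fun s hs => (hpos m).trans hs) ordConnected_Ioi using 1
      ext q
      simp
  · obtain ⟨x⟩ := (inferInstance : Nonempty N)
    cases b
    · refine ⟨(x, ⟨1 / ((m : ℝ) + 1) / 2, mem_Ioi.mpr (by positivity)⟩), ?_⟩
      have : (0 : ℝ) < 1 / ((m : ℝ) + 1) := by positivity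
      simp only [mem_ofPred_eq, Bool.false_eq_true, if_false]
      linarith
    · refine ⟨(x, ⟨(m : ℝ) + 2, mem_Ioi.mpr (by positivity)⟩), ?_⟩
      simp
  · have h1 : (m : ℝ) ≤ m' := by exact_mod_cast hmm
    cases b
    · simp only [mem_ofPred_eq, Bool.false_eq_true, if_false] at hq ⊢
      exact hq.trans_le (one_div_le_one_div_of_le (hpos m) (by linarith))
    · simp only [mem_ofPred_eq, if_true] at hq ⊢
      linarith

end Ends

/-- A discrete subgroup of a locally compact Hausdorff group acts properly discontinuously by left
translations. -/
theorem Subgroup.properlyDiscontinuousSMul_of_discreteTopology {G : Type} [Group G]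
    [TopologicalSpace G] [IsTopologicalGroup G] [T2Space G] (S : Subgroup G) [DiscreteTopology S] :
    ProperlyDiscontinuousSMul S G :=
  S.properlyDiscontinuousSMul_of_tendsto_cofinite
    (Subgroup.tendsto_coe_cofinite_of_discrete S (isDiscrete_iff_discreteTopology.mpr inferInstance))

namespace Heis

variable {n : ℕ}

/-! ### The topology of the Heisenberg group -/

theorem coords_ofCoords (q : HIdx n → ℝ) : (ofCoords q).coords = q := by
  ext (i | i | i) <;> rfl

theorem ofCoords_coords (a : Heis n) : ofCoords a.coords = a := rfl

theorem continuous_coords : Continuous (coords : Heis n → HIdx n → ℝ) := continuous_induced_dom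

/-- The coordinates as a homeomorphism. -/
def coordsHomeomorph (n : ℕ) : Heis n ≃ₜ (HIdx n → ℝ) where
  toFun := coords
  invFun := ofCoords
  left_inv := ofCoords_coords
  right_inv := coords_ofCoords
  continuous_toFun := continuous_coords
  continuous_invFun := continuous_induced_rng.mpr <| by
    convert continuous_id using 1
    exact funext coords_ofCoords

theorem continuous_x (i : Fin n) : Continuous fun a : Heis n => a.x i :=
  (continuous_apply (Sum.inl i : HIdx n)).comp continuous_coords

theorem continuous_y (i : Fin n) : Continuous fun a : Heis n => a.y i :=
  (continuous_apply (Sum.inr (Sum.inl i) : HIdx n)).comp continuous_coords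

theorem continuous_z : Continuous fun a : Heis n => a.z :=
  (continuous_apply (Sum.inr (Sum.inr ()) : HIdx n)).comp continuous_coords

theorem continuous_of_entries {X : Type} [TopologicalSpace X] {f : X → Heis n}
    (hx : ∀ i, Continuous fun t => (f t).x i) (hy : ∀ i, Continuous fun t => (f t).y i)
    (hz : Continuous fun t => (f t).z) : Continuous f :=
  continuous_induced_rng.mpr <| continuous_pi fun i => match i with
    | .inl i => hx i
    | .inr (.inl i) => hy i
    | .inr (.inr _) => hz

instance : IsTopologicalGroup (Heis n) where
  continuous_mul := by
    refine continuous_of_entries (fun i => ?_) (fun i => ?_) ?_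
    · exact ((continuous_x i).comp continuous_fst).add ((continuous_x i).comp continuous_snd)
    · exact ((continuous_y i).comp continuous_fst).add ((continuous_y i).comp continuous_snd)
    · exact ((continuous_z.comp continuous_fst).add (continuous_z.comp continuous_snd)).add
        (continuous_finsetSum _ fun i _ =>
          ((continuous_x i).comp continuous_fst).mul ((continuous_y i).comp continuous_snd))
  continuous_inv := by
    refine continuous_of_entries (fun i => ?_) (fun i => ?_) ?_
    · exact (continuous_x i).neg
    · exact (continuous_y i).neg
    · exact continuous_z.neg.add
        (continuous_finsetSum _ fun i _ => (continuous_x i).mul (continuous_y i))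

instance : T2Space (Heis n) := (coordsHomeomorph n).symm.t2Space

instance : LocallyCompactSpace (Heis n) :=
  (coordsHomeomorph n).isClosedEmbedding.locallyCompactSpace

instance : ConnectedSpace (Heis n) :=
  (coordsHomeomorph n).symm.surjective.connectedSpace (coordsHomeomorph n).symm.continuous

/-! ### Quotients by lattices -/

theorem IsLattice.properlyDiscontinuousSMul {Γ : Subgroup (Heis n)} (hΓ : IsLattice Γ) :
    ProperlyDiscontinuousSMul Γ (Heis n) :=
  have := hΓ.discrete
  Γ.properlyDiscontinuousSMul_of_discreteTopology

theorem IsLattice.t2Space {Γ : Subgroup (Heis n)} (hΓ : IsLattice Γ) : T2Space (Nil Γ) :=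
  have := hΓ.properlyDiscontinuousSMul
  t2Space_of_properlyDiscontinuousSMul_of_t2Space

theorem IsLattice.isQuotientCoveringMap {Γ : Subgroup (Heis n)} (hΓ : IsLattice Γ) :
    IsQuotientCoveringMap (Quotient.mk (MulAction.orbitRel Γ (Heis n))) Γ :=
  have := hΓ.properlyDiscontinuousSMul
  isQuotientCoveringMap_quotientMk_of_properlyDiscontinuousSMul

instance (Γ : Subgroup (Heis n)) : ConnectedSpace (Nil Γ) :=
  inferInstanceAs (ConnectedSpace (Quotient _))

theorem endZero_eq (Γ : Subgroup (Heis n)) :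
    endZero Γ = ⨅ m : ℕ, 𝓟 {q : QuotSpace Γ | (q.2 : ℝ) < 1 / ((m : ℝ) + 1)} := by
  refine le_antisymm (le_iInf fun m => le_principal_iff.mpr ?_) fun s hs => ?_
  · exact preimage_mem_comap (Iio_mem_nhds (by positivity))
  · obtain ⟨t, ht, hts⟩ := hs
    obtain ⟨ε, hε, hb⟩ := Metric.mem_nhds_iff.mp ht
    obtain ⟨m, hm⟩ := exists_nat_one_div_lt hε
    refine mem_iInf_of_mem m (mem_principal.mpr fun q hq => hts (hb ?_))
    have h1 : (0 : ℝ) < q.2 := q.2.2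
    have h2 : (q.2 : ℝ) < 1 / ((m : ℝ) + 1) := hq
    rw [Metric.mem_ball, Real.dist_eq, sub_zero, abs_of_pos h1]
    exact h2.trans hm

theorem endInfty_eq (Γ : Subgroup (Heis n)) :
    endInfty Γ = ⨅ m : ℕ, 𝓟 {q : QuotSpace Γ | (m : ℝ) + 1 < q.2} := by
  refine le_antisymm (le_iInf fun m => le_principal_iff.mpr ?_) fun s hs => ?_
  · exact preimage_mem_comap (Ioi_mem_atTop _)
  · obtain ⟨t, ht, hts⟩ := hs
    obtain ⟨B, hB⟩ := mem_atTop_sets.mp ht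
    obtain ⟨m, hm⟩ := exists_nat_ge B
    refine mem_iInf_of_mem m (mem_principal.mpr fun q hq => hts (hB _ ?_))
    have h2 : (m : ℝ) + 1 < q.2 := hq
    linarith

theorem IsLattice.isEnd_iff {Γ : Subgroup (Heis n)} (hΓ : IsLattice Γ) (F : Filter (QuotSpace Γ)) :
    IsEnd F ↔ F = endZero Γ ∨ F = endInfty Γ := by
  have := hΓ.cocompact
  rw [(isTwoEndedExhaustion_prod (Nil Γ)).isEnd_iff, endZero_eq, endInfty_eq]
  simp

theorem endZero_ne_endInfty (Γ : Subgroup (Heis n)) : endZero Γ ≠ endInfty Γ := fun h => by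
  have h0 : {q : QuotSpace Γ | (q.2 : ℝ) < 1} ∈ endZero Γ :=
    preimage_mem_comap (Iio_mem_nhds one_pos)
  have h1 : {q : QuotSpace Γ | (1 : ℝ) < q.2} ∈ endInfty Γ := preimage_mem_comap (Ioi_mem_atTop 1)
  have h2 : (endInfty Γ).NeBot := by
    refine comap_neBot_iff.mpr fun t ht => ?_
    obtain ⟨B, hB⟩ := mem_atTop_sets.mp ht
    exact ⟨(Quotient.mk _ 1, ⟨max B 1, mem_Ioi.mpr (by positivity)⟩), hB _ (le_max_left _ _)⟩
  rw [h] at h0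
  obtain ⟨q, hq0, hq1⟩ := h2.nonempty_of_mem (inter_mem h0 h1)
  exact lt_asymm (show (q.2 : ℝ) < 1 from hq0) hq1

/-! ### The integer lattice -/

theorem discreteTopology_integerLattice (n : ℕ) : DiscreteTopology (integerLattice n) := by
  refine discreteTopology_iff_isOpen_singleton.mpr fun a => ?_
  let V : Set (Heis n) := {b | (∀ i, |b.x i - a.1.x i| < 1) ∧ (∀ i, |b.y i - a.1.y i| < 1) ∧
    |b.z - a.1.z| < 1}
  have hV : IsOpen V := by
    have e : V = (⋂ i, {b | |b.x i - a.1.x i| < 1}) ∩ (⋂ i, {b | |b.y i - a.1.y i| < 1}) ∩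
        {b | |b.z - a.1.z| < 1} := by
      ext b
      simp [V, and_assoc]
    rw [e]
    refine ((isOpen_iInter_of_finite fun i => ?_).inter (isOpen_iInter_of_finite fun i => ?_)).inter
      ?_
    · exact isOpen_lt ((continuous_x i).sub continuous_const).abs continuous_const
    · exact isOpen_lt ((continuous_y i).sub continuous_const).abs continuous_const
    · exact isOpen_lt (continuous_z.sub continuous_const).abs continuous_const
  have key : ∀ s t : ℝ, (∃ k : ℤ, s = k) → (∃ k : ℤ, t = k) → |s - t| < 1 → s = t := by
    rintro _ _ ⟨k, rfl⟩ ⟨l, rfl⟩ h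
    have h1 : |k - l| < 1 := by exact_mod_cast h
    have h2 := Int.abs_lt_one_iff.mp h1
    rw [sub_eq_zero.mp h2]
  convert hV.preimage continuous_subtype_val using 1
  ext b
  simp only [mem_singleton_iff, mem_preimage]
  constructor
  · rintro rfl
    simp [V]
  · rintro ⟨hx, hy, hz⟩
    exact Subtype.ext (Heis.ext (funext fun i => key _ _ (b.2.1 i) (a.2.1 i) (hx i))
      (funext fun i => key _ _ (b.2.2.1 i) (a.2.2.1 i) (hy i)) (key _ _ b.2.2.2 a.2.2.2 hz))

theorem compactSpace_nil_integerLattice (n : ℕ) : CompactSpace (Nil (integerLattice n)) := by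
  let B : Set (Heis n) := ofCoords '' Icc 0 1
  have hB : IsCompact B := (isCompact_Icc (a := (0 : HIdx n → ℝ)) (b := 1)).image
    (coordsHomeomorph n).symm.continuous
  have hq : Continuous (Quotient.mk (MulAction.orbitRel (integerLattice n) (Heis n))) :=
    continuous_quotient_mk'
  refine ⟨?_⟩
  convert hB.image hq using 1
  refine (eq_univ_of_forall fun q => ?_).symm
  obtain ⟨a, rfl⟩ := Quotient.exists_rep q
  -- Removing the integer parts of the `x_i` by a left translation changes the central coordinate to
  -- `w`, so it is the integer part of `w` that must be removed there. The product then lies in the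
  -- unit cube.
  let w : ℝ := a.z + ∑ i, -(⌊a.x i⌋ : ℝ) * a.y i
  let c : Heis n := ⟨fun i => -(⌊a.x i⌋ : ℝ), fun i => -(⌊a.y i⌋ : ℝ), -(⌊w⌋ : ℝ)⟩
  have hc : c ∈ integerLattice n :=
    ⟨fun i => ⟨-⌊a.x i⌋, by simp [c]⟩, fun i => ⟨-⌊a.y i⌋, by simp [c]⟩, -⌊w⌋, by simp [c]⟩
  have hz : (c * a).z = Int.fract w := by
    simp only [mul_z, c, Int.fract, w]
    ring
  have hx : ∀ i, (c * a).x i = Int.fract (a.x i) := fun i => by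
    simp only [mul_x, Pi.add_apply, c, Int.fract]
    ring
  have hy : ∀ i, (c * a).y i = Int.fract (a.y i) := fun i => by
    simp only [mul_y, Pi.add_apply, c, Int.fract]
    ring
  refine ⟨c * a, ⟨(c * a).coords, ⟨?_, ?_⟩, ofCoords_coords _⟩, ?_⟩
  · rintro (i | i | i)
    · exact (Int.fract_nonneg (a.x i)).trans_eq (hx i).symm
    · exact (Int.fract_nonneg (a.y i)).trans_eq (hy i).symm
    · exact (Int.fract_nonneg w).trans_eq hz.symm
  · rintro (i | i | i)
    · exact (hx i).trans_le (Int.fract_lt_one (a.x i)).le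
    · exact (hy i).trans_le (Int.fract_lt_one (a.y i)).le
    · exact hz.trans_le (Int.fract_lt_one w).le
  · exact Quotient.sound ⟨⟨c, hc⟩, rfl⟩

theorem isLattice_integerLattice (n : ℕ) : IsLattice (integerLattice n) :=
  ⟨discreteTopology_integerLattice n, compactSpace_nil_integerLattice n⟩

end Heis

/-! ### Left translations -/

section Translations

variable {n : ℕ}

/-- The differential of the left translation by `a` of the Heisenberg group, in coordinates. -/
def translDiff (a : Heis n) (v : HIdx n → ℝ) : HIdx n → ℝ :=
  Sum.elim (fun i => v (.inl i)) (Sum.elim (fun i => v (.inr (.inl i)))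
    fun _ => v (.inr (.inr ())) + ∑ i, a.x i * v (.inr (.inl i)))

theorem translBase_line (a : Heis n) (q v : HIdx n → ℝ) (t : ℝ) :
    a.translBase (q + t • v) = a.translBase q + t • translDiff a v := by
  ext (i | i | i)
  · simp [Heis.translBase, translDiff, Heis.coords, Heis.ofCoords, add_assoc]
  · simp [Heis.translBase, translDiff, Heis.coords, Heis.ofCoords, add_assoc]
  · simp only [Heis.translBase, translDiff, Heis.coords, Heis.ofCoords, Heis.mul_z, Sum.elim_inr,
      Pi.add_apply, Pi.smul_apply, smul_eq_mul, mul_add, Finset.sum_add_distrib, Finset.mul_sum,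
      mul_left_comm t]
    ring

theorem contDiff_translBase (a : Heis n) : ContDiff ℝ ∞ a.translBase := by
  rw [contDiff_pi]
  rintro (i | i | i) <;>
    simp only [Heis.translBase, Heis.coords, Heis.ofCoords, Heis.mul_x, Heis.mul_y, Heis.mul_z,
      Sum.elim_inr, Sum.elim_inl, Pi.add_apply] <;> fun_prop

theorem hasDerivAt_add_smul {ι : Type} [Fintype ι] (p v : ι → ℝ) :
    HasDerivAt (fun t : ℝ => p + t • v) v 0 := by
  simpa using ((hasDerivAt_id (0 : ℝ)).smul_const v).const_add p

theorem fderiv_translBase (a : Heis n) (q v : HIdx n → ℝ) :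
    fderiv ℝ a.translBase q v = translDiff a v := by
  refine ((contDiff_translBase a).differentiable (by simp) q).fderiv_eq_of_line ?_
  simp only [translBase_line]
  exact hasDerivAt_add_smul _ _

theorem fderiv_transl (a : Heis n) (p v : MIdx n → ℝ) :
    fderiv ℝ (transl a) p v = Sum.elim (translDiff a (base v)) fun _ => phi v := by
  have hd : ContDiff ℝ ∞ (transl a) := by
    rw [contDiff_pi]
    rintro (i | i)
    · exact contDiff_pi.mp ((contDiff_translBase a).comp contDiff_base) i
    · exact contDiff_phi
  refine (hd.differentiable (by simp) p).fderiv_eq_of_line ?_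
  have e : ∀ t : ℝ, transl a (p + t • v) =
      transl a p + t • Sum.elim (translDiff a (base v)) fun _ => phi v := fun t => by
    ext (i | i)
    · exact congrFun (translBase_line a (base p) (base v) t) i
    · rfl
  simp only [e]
  exact hasDerivAt_add_smul _ _

/-- Left invariance: the change of `∑ x_i dy_i` under the translation cancels that of `dz`. -/
theorem zeta_translDiff (a : Heis n) (q v : HIdx n → ℝ) :
    zeta (a.translBase q) (translDiff a v) = zeta q v := by
  simp only [zeta, Heis.translBase, translDiff, Heis.coords, Heis.ofCoords, Heis.mul_x,
    Sum.elim_inl, Sum.elim_inr, Pi.add_apply, add_mul, Finset.sum_add_distrib]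
  ring

theorem base_fderiv_transl (a : Heis n) (p v : MIdx n → ℝ) :
    base (fderiv ℝ (transl a) p v) = translDiff a (base v) := by
  rw [fderiv_transl]
  rfl

theorem phi_fderiv_transl (a : Heis n) (p v : MIdx n → ℝ) :
    phi (fderiv ℝ (transl a) p v) = phi v := by
  rw [fderiv_transl]
  rfl

theorem zeta_fderiv_transl (a : Heis n) (p v : MIdx n → ℝ) :
    zeta (base (transl a p)) (base (fderiv ℝ (transl a) p v)) = zeta (base p) (base v) := by
  rw [base_fderiv_transl]
  exact zeta_translDiff a (base p) (base v)

theorem isIsometricTransl_heisMetric (a : Heis n) (h : ℝ → ℝ) :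
    IsIsometricTransl a (heisMetric n h) := fun p _ v w => by
  simp only [pullback, heisMetric, zeta_fderiv_transl, phi_fderiv_transl]
  rw [base_fderiv_transl, base_fderiv_transl]
  rfl

/-- In the coframe `dx`, `dy`, `ζ`, `dφ` the coefficients of `J` depend only on `φ`, and left
translations preserve both the coframe and `φ`. -/
theorem isHolomorphicTransl_heisJ (a : Heis n) (h : ℝ → ℝ) :
    IsHolomorphicTransl a (heisJ n h) := fun p _ v => by
  have e1 : phi (transl a p) = phi p := rfl
  refine ext_frame (transl a p) (fun i => ?_) (fun i => ?_) ?_ ?_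
  · rw [base_fderiv_transl, heisJ_eq_ofFrame, heisJ_eq_ofFrame, base_fderiv_transl]
    rfl
  · rw [base_fderiv_transl, heisJ_eq_ofFrame, heisJ_eq_ofFrame, base_fderiv_transl]
    rfl
  · rw [zeta_fderiv_transl, heisJ_eq_ofFrame, heisJ_eq_ofFrame, zeta_base_ofFrame,
      zeta_base_ofFrame, phi_fderiv_transl, e1]
  · rw [phi_fderiv_transl, heisJ_eq_ofFrame, heisJ_eq_ofFrame, phi_ofFrame, phi_ofFrame,
      zeta_fderiv_transl, e1]

end Translations

/-! ### Asymptotics at the ends of the quotients -/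

section Asymptotics

variable {n : ℕ}

theorem IsRiemannianMetricOn.congr {ι : Type} [Fintype ι] {U : Set (ι → ℝ)}
    {g g' : TwoTensor ι} (hg : IsRiemannianMetricOn U g) (h : ∀ p ∈ U, ∀ v w, g' p v w = g p v w) :
    IsRiemannianMetricOn U g' where
  add_left p hp u v w := by simp only [h p hp, hg.add_left p hp]
  smul_left p hp c v w := by simp only [h p hp, hg.smul_left p hp]
  symm p hp v w := by simp only [h p hp, hg.symm p hp v]
  pos p hp v hv := by simpa only [h p hp] using hg.pos p hp v hv
  smooth v w := (hg.smooth v w).congr fun p hp => h p hp v w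

theorem Heis.IsAsymptotic.congr_right {Γ : Subgroup (Heis n)} {F : Filter (Heis.QuotSpace Γ)}
    {g g' g'' : TwoTensor (MIdx n)} (hg : Heis.IsAsymptotic Γ F g g')
    (h : ∀ p ∈ halfSpace n, ∀ v w, g'' p v w = g' p v w) : Heis.IsAsymptotic Γ F g g'' where
  metric := hg.metric
  metric' := hg.metric'.congr h
  descends := hg.descends
  descends' a ha p hp v w := by
    have hp' : transl a p ∈ halfSpace n := hp
    have := hg.descends' a ha p hp v w
    simp only [pullback] at this ⊢
    rw [h _ hp', h _ hp, this]
  lim ε hε := by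
    filter_upwards [hg.lim ε hε] with q hq p hpq v
    rw [h _ p.2]
    exact hq p hpq v

/-- The horizontal parts cancel. The `ζ²` terms differ by the factor `h/h'` and the `dφ²` terms by
the inverse factor. -/
theorem abs_heisMetric_sub_le {h h' : ℝ → ℝ} {p : MIdx n → ℝ} (hp : p ∈ halfSpace n)
    (hpos : 0 < h (phi p)) (hpos' : 0 < h' (phi p)) {ε : ℝ} (hε : 0 ≤ ε)
    (h1 : |h (phi p) / h' (phi p) - 1| ≤ ε) (h2 : |h' (phi p) / h (phi p) - 1| ≤ ε)
    (v : MIdx n → ℝ) :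
    |heisMetric n h p v v - heisMetric n h' p v v| ≤ ε * heisMetric n h' p v v := by
  set s := h (phi p)
  set s' := h' (phi p)
  set z := zeta (base p) (base v)
  have e : heisMetric n h p v v - heisMetric n h' p v v =
      (s / s' - 1) * (s' * (z * z)) + (s' / s - 1) * (phi v * phi v / s') := by
    change phi p * horiz (base v) (base v) + s * (z * z) + phi v * phi v / s
      - (phi p * horiz (base v) (base v) + s' * (z * z) + phi v * phi v / s') = _
    field_simp
    ring
  have e' : heisMetric n h' p v v =
      phi p * horiz (base v) (base v) + (s' * (z * z) + phi v * phi v / s') := by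
    rw [← add_assoc]
    rfl
  have a1 : 0 ≤ s' * (z * z) := mul_nonneg hpos'.le (mul_self_nonneg z)
  have a2 : 0 ≤ phi v * phi v / s' := div_nonneg (mul_self_nonneg _) hpos'.le
  have a3 : 0 ≤ phi p * horiz (base v) (base v) :=
    mul_nonneg (le_of_lt hp) (horiz_self_nonneg _)
  rw [e, e']
  calc _ ≤ |s / s' - 1| * (s' * (z * z)) + |s' / s - 1| * (phi v * phi v / s') := by
        refine (abs_add_le _ _).trans_eq ?_
        rw [abs_mul, abs_mul (s' / s - 1), abs_of_nonneg a1, abs_of_nonneg a2]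
    _ ≤ ε * (s' * (z * z)) + ε * (phi v * phi v / s') :=
        add_le_add (mul_le_mul_of_nonneg_right h1 a1) (mul_le_mul_of_nonneg_right h2 a2)
    _ ≤ _ := by nlinarith [mul_nonneg hε a3]

/-- Two profiles with quotient tending to `1` give asymptotic metrics. -/
theorem isAsymptotic_heisMetric {h h' : ℝ → ℝ} (hh : IsProfile h) (hh' : IsProfile h')
    (Γ : Subgroup (Heis n)) {F : Filter (Heis.QuotSpace Γ)}
    (hlim : Tendsto (fun q : Heis.QuotSpace Γ => h q.2 / h' q.2) F (𝓝 1)) :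
    Heis.IsAsymptotic Γ F (heisMetric n h) (heisMetric n h') where
  metric := hh.isRiemannianMetricOn
  metric' := hh'.isRiemannianMetricOn
  descends a _ := isIsometricTransl_heisMetric a h
  descends' a _ := isIsometricTransl_heisMetric a h'
  lim ε hε := by
    have hlim' : Tendsto (fun q : Heis.QuotSpace Γ => h' q.2 / h q.2) F (𝓝 1) := by
      simpa using hlim.inv₀ one_ne_zero
    filter_upwards [Metric.tendsto_nhds.mp hlim ε hε, Metric.tendsto_nhds.mp hlim' ε hε]
    rintro q h1 h2 p rfl v
    exact abs_heisMetric_sub_le p.2 (hh.pos _ p.2) (hh'.pos _ p.2) hε.le h1.le h2.le v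

theorem isRiemannianMetricOn_linkMetric : IsRiemannianMetricOn univ (linkMetric n) where
  add_left p _ u v w := by
    simp only [linkMetric, horiz_add_left, zeta_add]; ring
  smul_left p _ c v w := by
    simp only [linkMetric, horiz_smul_left, zeta_smul]; ring
  symm p _ v w := by
    simp only [linkMetric, horiz_comm v, mul_comm (zeta p v)]
  pos p _ v hv := by
    have h1 := horiz_self_nonneg v
    have h2 := mul_self_nonneg (zeta p v)
    by_contra hle
    simp only [linkMetric, not_lt] at hle
    have h3 : horiz v v = 0 := by linarith
    have h4 : zeta p v = 0 := mul_self_eq_zero.mp (by linarith)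
    have h5 := fun i => abs_le_sqrt_horiz v i
    simp only [h3, Real.sqrt_zero, abs_nonpos_iff] at h5
    refine hv (funext fun i => ?_)
    rcases i with i | i | i
    · exact (h5 i).1
    · exact (h5 i).2
    · simpa [zeta, h5] using h4
  smooth v w := by
    unfold linkMetric zeta
    fun_prop

theorem pullback_translBase_linkMetric (a : Heis n) (q v w : HIdx n → ℝ) :
    pullback a.translBase (linkMetric n) q v w = linkMetric n q v w := by
  simp only [pullback, linkMetric, fderiv_translBase, zeta_translDiff]
  rfl

theorem isProfile_two_mul : IsProfile fun s => 2 * s :=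
  ⟨fun s hs => by positivity, by fun_prop⟩

theorem isProfile_cusp (n : ℕ) : IsProfile fun s => 2 * s ^ 2 / ((n : ℝ) + 2) :=
  ⟨fun s hs => by positivity, by fun_prop⟩

theorem toRadius_eq : toRadius n = liftPhi fun s => √(2 * s) := rfl

theorem isDiffeoOn_toRadius : IsDiffeoOn (halfSpace n) (toRadius n) := by
  refine isDiffeoOn_liftPhi (f₁ := fun s => s ^ 2 / 2) ?_ (by fun_prop)
    (fun s hs => Real.sqrt_pos.mpr (by positivity)) (fun s hs => by positivity) (fun s hs => ?_)
    fun s hs => ?_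
  · refine ContDiffOn.sqrt (by fun_prop) fun s hs => ?_
    have : (0 : ℝ) < s := hs
    positivity
  · rw [Real.sq_sqrt (by positivity)]
    ring
  · rw [mul_div_cancel₀ _ two_ne_zero, Real.sqrt_sq hs.le]

/-- With `r² = 2φ` one has `dr² = dφ²/(2φ)`, so the cone is the member of the family with `h = 2φ`.
-/
theorem pullback_toRadius_coneMetric {p : MIdx n → ℝ} (hp : p ∈ halfSpace n) (v w : MIdx n → ℝ) :
    pullback (toRadius n) (coneMetric (linkMetric n)) p v w =
      heisMetric n (fun s => 2 * s) p v w := by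
  have hpos : 0 < phi p := hp
  have h2 : (0 : ℝ) < 2 * phi p := by positivity
  have hd : HasDerivAt (fun s => √(2 * s)) (2 / (2 * √(2 * phi p))) (phi p) := by
    have := ((hasDerivAt_id' (phi p)).const_mul 2).sqrt h2.ne'
    simpa using this
  have hsq : √(2 * phi p) ^ 2 = 2 * phi p := Real.sq_sqrt h2.le
  have hne : √(2 * phi p) ≠ 0 := (Real.sqrt_pos.mpr h2).ne'
  obtain ⟨b1, f1⟩ := fderiv_liftPhi hd v
  obtain ⟨b2, f2⟩ := fderiv_liftPhi hd w
  have e : base (toRadius n p) = base p := rfl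
  have e' : phi (toRadius n p) = √(2 * phi p) := rfl
  simp only [pullback, coneMetric, linkMetric, heisMetric, e, e', hsq]
  rw [toRadius_eq, b1, b2, f1, f2]
  have e1 : 2 / (2 * √(2 * phi p)) * phi v * (2 / (2 * √(2 * phi p)) * phi w) =
      phi v * phi w / √(2 * phi p) ^ 2 := by field_simp
  rw [e1, hsq]
  ring

theorem tendsto_solProfile_div_atTop (hn : 1 ≤ n) :
    Tendsto (fun s => solProfile n s / (2 * s)) atTop (𝓝 1) := by
  have h1 : Tendsto (fun s : ℝ => 1 - ((n : ℝ) + 1) / s) atTop (𝓝 1) := by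
    simpa using (tendsto_const_nhds (x := (1 : ℝ))).sub
      (tendsto_const_nhds (x := (n : ℝ) + 1) |>.div_atTop tendsto_id)
  refine tendsto_of_tendsto_of_tendsto_of_le_of_le' h1 tendsto_const_nhds ?_ ?_
  · filter_upwards [eventually_gt_atTop 0] with s hs
    rw [le_div_iff₀ (by positivity)]
    refine le_of_eq_of_le ?_ (lt_solProfile hn hs).le
    field_simp
  · filter_upwards [eventually_gt_atTop 0] with s hs
    rw [div_le_one (by positivity)]
    exact (solProfile_lt hn hs).le

theorem tendsto_solProfile_div_zero (hn : 1 ≤ n) :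
    Tendsto (fun s => solProfile n s / (2 * s ^ 2 / ((n : ℝ) + 2))) (𝓝[>] 0) (𝓝 1) := by
  have h1 : Tendsto (fun s : ℝ => 1 - s) (𝓝[>] 0) (𝓝 1) := by
    have : Tendsto (fun s : ℝ => 1 - s) (𝓝 0) (𝓝 (1 - 0)) := tendsto_const_nhds.sub tendsto_id
    rw [sub_zero] at this
    exact this.mono_left nhdsWithin_le_nhds
  refine tendsto_of_tendsto_of_tendsto_of_le_of_le' h1 tendsto_const_nhds ?_ ?_
  · filter_upwards [self_mem_nhdsWithin] with s hs
    have hs' : (0 : ℝ) < s := hs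
    rw [le_div_iff₀ (by positivity), mul_comm]
    exact (lt_solProfile_sq hn hs').le
  · filter_upwards [self_mem_nhdsWithin] with s hs
    have hs' : (0 : ℝ) < s := hs
    rw [div_le_one (by positivity)]
    exact (solProfile_lt_sq hn hs').le

theorem Heis.tendsto_phi_endZero (Γ : Subgroup (Heis n)) :
    Tendsto (fun q : Heis.QuotSpace Γ => (q.2 : ℝ)) (Heis.endZero Γ) (𝓝[>] 0) :=
  tendsto_nhdsWithin_iff.mpr ⟨tendsto_comap, Eventually.of_forall fun q => q.2.2⟩

theorem isAsymptotic_solMetric_cuspMetric (hn : 1 ≤ n) (Γ : Subgroup (Heis n)) :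
    Heis.IsAsymptotic Γ (Heis.endZero Γ) (solMetric n) (cuspMetric n) :=
  isAsymptotic_heisMetric (isProfile_solProfile hn) (isProfile_cusp n) Γ
    ((tendsto_solProfile_div_zero hn).comp (Heis.tendsto_phi_endZero Γ))

theorem isAsymptoticallyConical_solMetric (hn : 1 ≤ n) (Γ : Subgroup (Heis n)) :
    Heis.IsAsymptoticallyConical Γ (Heis.endInfty Γ) (solMetric n) (linkMetric n)
      (toRadius n) where
  link := isRiemannianMetricOn_linkMetric
  link_descends a _ := pullback_translBase_linkMetric a
  diffeo := isDiffeoOn_toRadius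
  equivariant _ _ _ _ := rfl
  radius R := by
    have h1 : Tendsto (fun q : Heis.QuotSpace Γ => √(2 * (q.2 : ℝ))) (Heis.endInfty Γ) atTop :=
      Real.tendsto_sqrt_atTop.comp (tendsto_comap.const_mul_atTop two_pos)
    filter_upwards [h1.eventually_gt_atTop R]
    rintro q hq p rfl
    exact hq
  asymptotic := (isAsymptotic_heisMetric (isProfile_solProfile hn) isProfile_two_mul Γ
    ((tendsto_solProfile_div_atTop hn).comp tendsto_comap)).congr_right
      fun _ hp => pullback_toRadius_coneMetric hp

end Asymptotics

/-! ### The cusp -/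

/-- For `h = a s²` the coefficients `-h/s²`, `-h''/2` and `-(h/s)'` are all equal to `-a`. -/
theorem hasConstantHolSecCurvOn_cuspMetric (n : ℕ) :
    HasConstantHolSecCurvOn (halfSpace n) (cuspMetric n) (cuspJ n) (-2 / ((n : ℝ) + 2)) := by
  intro p hp v hv
  have hs : 0 < phi p := hp
  have d1 : deriv (fun s : ℝ => 2 * s ^ 2 / ((n : ℝ) + 2)) = fun s => 4 * s / ((n : ℝ) + 2) := by
    funext s
    have h := (((hasDerivAt_pow 2 s).const_mul 2).div_const ((n : ℝ) + 2)).deriv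
    rw [h]
    simp only [Nat.cast_ofNat]
    ring
  have d2 : ∀ s, deriv (fun s : ℝ => 4 * s / ((n : ℝ) + 2)) s = 4 / ((n : ℝ) + 2) := fun s => by
    have h := (((hasDerivAt_id' s).const_mul 4).div_const ((n : ℝ) + 2)).deriv
    rw [h, mul_one]
  refine (isProfile_cusp n).secCurv_heisJ hp ?_ ?_ ?_ hv
  · simp only [curvH]
    field_simp
  · simp only [curvV, d1, d2]
    ring
  · simp only [curvM, d1]
    field_simp
    ring

/-! ### The soliton -/

section Soliton

variable {n : ℕ} (hn : 1 ≤ n)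

include hn

theorem isCompleteOn_solMetric : IsCompleteOn (halfSpace n) (solMetric n) :=
  (isProfile_solProfile hn).isCompleteOn fun s hs => by
    refine (solProfile_lt_sq hn hs).le.trans ?_
    have h0 : (0 : ℝ) ≤ n := Nat.cast_nonneg n
    rw [div_le_iff₀ (by positivity)]
    nlinarith [mul_nonneg h0 (sq_nonneg s)]

theorem ricci_solMetric {p : MIdx n → ℝ} (hp : p ∈ halfSpace n) (v w : MIdx n → ℝ) :
    ricci (solMetric n) p v w =
      (-1 + solProfile n (phi p) / (2 * phi p)) * metricH p v w
        + (-1 + deriv (solProfile n) (phi p) / 2) * metricV (solProfile n) p v w := by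
  rw [solMetric, (isProfile_solProfile hn).ricci_heisMetric hp, ricciH_solProfile hn hp,
    ricciV_solProfile hn hp]

theorem isKahlerRicciSolitonOn_solMetric :
    IsKahlerRicciSolitonOn (halfSpace n) (solMetric n) (solJ n) (solPotential n) (-1) where
  kahler := (isProfile_solProfile hn).isKahlerOn
  smooth := contDiff_phi.neg.contDiffOn
  soliton p hp v w := by
    rw [ricci_solMetric hn hp, solMetric, (isProfile_solProfile hn).hessian_neg_phi hp,
      heisMetric_eq_add]
    ring

theorem solProfile_ratio_mem {s : ℝ} (hs : 0 < s) : solProfile n s / (2 * s) ∈ Ioo (0 : ℝ) 1 :=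
  ⟨div_pos ((isProfile_solProfile hn).pos s hs) (by positivity),
    (div_lt_one (by positivity)).mpr (solProfile_lt hn hs)⟩

theorem deriv_solProfile_half_mem {s : ℝ} (hs : 0 < s) :
    deriv (solProfile n) s / 2 ∈ Ioo (0 : ℝ) 1 :=
  ⟨half_pos (deriv_solProfile_pos hn hs), by linarith [deriv_solProfile_lt hn hs]⟩

theorem ricci_solMetric_bounds {p : MIdx n → ℝ} (hp : p ∈ halfSpace n) {v : MIdx n → ℝ}
    (hv : v ≠ 0) :
    -solMetric n p v v < ricci (solMetric n) p v v ∧ ricci (solMetric n) p v v < 0 := by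
  obtain ⟨a0, a1⟩ := solProfile_ratio_mem hn hp
  obtain ⟨b0, b1⟩ := deriv_solProfile_half_mem hn hp
  have hpos := (isProfile_solProfile hn).isRiemannianMetricOn.pos p hp v hv
  have hH : 0 ≤ metricH p v v := mul_nonneg (le_of_lt hp) (horiz_self_nonneg _)
  have hV : 0 ≤ metricV (solProfile n) p v v := by
    have := (isProfile_solProfile hn).pos _ hp
    exact add_nonneg (mul_nonneg this.le (mul_self_nonneg _))
      (div_nonneg (mul_self_nonneg _) this.le)
  rw [ricci_solMetric hn hp, solMetric]
  rw [heisMetric_eq_add] at hpos ⊢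
  set α := solProfile n (phi p) / (2 * phi p)
  set β := deriv (solProfile n) (phi p) / 2
  -- The two blocks are nonnegative with positive sum, so a combination with positive coefficients
  -- is positive. It is applied to the eigenvalues of `Ric + g` and of `-Ric`.
  have key : ∀ x y : ℝ, 0 < x → 0 < y →
      0 < x * metricH p v v + y * metricV (solProfile n) p v v := fun x y hx hy => by
    rcases hH.eq_or_lt with h0 | h0
    · have : 0 < metricV (solProfile n) p v v := by linarith
      exact add_pos_of_nonneg_of_pos (mul_nonneg hx.le hH) (mul_pos hy this)
    · exact add_pos_of_pos_of_nonneg (mul_pos hx h0) (mul_nonneg hy.le hV)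
  exact ⟨by linarith [key α β a0 b0], by linarith [key (1 - α) (1 - β) (by linarith) (by linarith)]⟩

/-- The scalar curvature is `-2n (1 - α) - 2 (1 - β)` with `α = h/(2φ)` and `β = h'/2`, both in `(0,
1)`. -/
theorem scalarCurv_solMetric_bounds {p : MIdx n → ℝ} (hp : p ∈ halfSpace n) :
    -2 * ((n : ℝ) + 1) < scalarCurv (solMetric n) p ∧ scalarCurv (solMetric n) p < 0 := by
  obtain ⟨a0, a1⟩ := solProfile_ratio_mem hn hp
  obtain ⟨b0, b1⟩ := deriv_solProfile_half_mem hn hp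
  have h0 : (1 : ℝ) ≤ n := by exact_mod_cast hn
  rw [solMetric, (isProfile_solProfile hn).scalarCurv_heisMetric hp, ricciH_solProfile hn hp,
    ricciV_solProfile hn hp]
  constructor <;> nlinarith

theorem exists_abs_secCurv_solMetric_le : ∃ C : ℝ, ∀ p ∈ halfSpace n, ∀ v w,
    LinearIndependent ℝ ![v, w] → |secCurv (solMetric n) p v w| ≤ C := by
  obtain ⟨C, -, hC⟩ := curv_solProfile_bound hn
  exact ⟨C, fun p hp v w hvw =>
    ((isProfile_solProfile hn).abs_secCurv_le hp hvw).trans (hC _ hp)⟩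

theorem exists_curvNormLE_selfSimilarFlow {σ : ℝ → ℝ → ℝ} (hσ : IsFlowOfNeg (solProfile n) σ) :
    ∃ K : ℝ, 0 ≤ K ∧ ∀ t, 0 ≤ t → ∀ p ∈ halfSpace n,
      CurvNormLE (selfSimilarFlow (solMetric n) (-1) (solDiffeo n σ) t) p (K / (1 + 2 * t)) := by
  obtain ⟨C, hC0, hC⟩ := curv_solProfile_bound hn
  refine ⟨(Fintype.card (MIdx n) : ℝ) ^ 2 * C, by positivity, fun t ht p hp => ?_⟩
  have hh := isProfile_solProfile hn
  have hc : (0 : ℝ) < 1 - 2 * -1 * t := by linarith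
  have hq := (hσ.isDiffeoOn_solDiffeo (n := n) t).2.1 hp
  have h1 := curvNormLE_scaledPullback hh.isRiemannianMetricOn (hσ.isDiffeoOn_solDiffeo t)
    isOpen_halfSpace hc hh.contDiffOn_christoffel hp hC0 fun u v w x =>
      (hh.abs_riemann_le hq u v w x).trans (mul_le_mul_of_nonneg_right (hC _ hq) (by positivity))
  have e : (Fintype.card (MIdx n) : ℝ) ^ 2 * C / (1 + 2 * t) =
      (Fintype.card (MIdx n) : ℝ) ^ 2 * (C / (1 - 2 * -1 * t)) := by
    rw [mul_div_assoc]
    ring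
  rw [e]
  exact h1

theorem isTypeIII_selfSimilarFlow {σ : ℝ → ℝ → ℝ} (hσ : IsFlowOfNeg (solProfile n) σ) :
    IsTypeIII (halfSpace n) (selfSimilarFlow (solMetric n) (-1) (solDiffeo n σ)) := by
  have hsub : Ici (0 : ℝ) ⊆ lifeSpan (-1) := fun t ht => by
    have : (0 : ℝ) ≤ t := ht
    change (0 : ℝ) < 1 - 2 * -1 * t
    linarith
  have hflow := isRicciFlowOn_selfSimilarFlow hn hσ
  obtain ⟨K, hK, h⟩ := exists_curvNormLE_selfSimilarFlow hn hσ
  refine ⟨⟨fun t ht => hflow.metric t (hsub ht), fun v w => (hflow.smooth v w).mono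
    (prod_mono hsub Subset.rfl), fun t ht p hp v w => (hflow.flow t (hsub ht) p hp v w).mono hsub⟩,
    fun t ht => ?_, fun t ht => ⟨_, h t ht⟩, K, fun t ht p hp e he => ?_⟩
  · exact (isCompleteOn_solMetric hn).scaledPullback isOpen_halfSpace
      (hσ.isDiffeoOn_solDiffeo t) (hsub ht)
  · refine (h t ht.le p hp e he).trans ?_
    -- The bound `K / (1 + 2t)` is at most `K / t`.
    exact div_le_div_of_nonneg_left hK ht (by linarith)

end Soliton

end

/-! ### The main theorem. -/

theorem theorem1 (n : ℕ) (hn : 1 ≤ n) :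
    -- the explicit metric is a complete expanding gradient Kähler-Ricci soliton
    (IsKahlerRicciSolitonOn (halfSpace n) (solMetric n) (solJ n) (solPotential n) (-1) ∧
      IsCompleteOn (halfSpace n) (solMetric n)) ∧
    -- Ricci curvature
    (∀ p ∈ halfSpace n, ∀ v, v ≠ 0 →
      -solMetric n p v v < ricci (solMetric n) p v v ∧ ricci (solMetric n) p v v < 0) ∧
    -- scalar curvature, with complex dimension `m = n + 1`
    (∀ p ∈ halfSpace n,
      -2 * ((n : ℝ) + 1) < scalarCurv (solMetric n) p ∧ scalarCurv (solMetric n) p < 0) ∧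
    -- sectional curvatures
    (∃ C : ℝ, ∀ p ∈ halfSpace n, ∀ v w, LinearIndependent ℝ ![v, w] →
      |secCurv (solMetric n) p v w| ≤ C) ∧
    -- the associated Ricci flow
    (∃ ψ : ℝ → (MIdx n → ℝ) → (MIdx n → ℝ),
      IsSolitonDiffeos (halfSpace n) (solMetric n) (solPotential n) (-1) ψ ∧
      IsRicciFlowOn (lifeSpan (-1)) (halfSpace n) (selfSimilarFlow (solMetric n) (-1) ψ) ∧
      IsTypeIII (halfSpace n) (selfSimilarFlow (solMetric n) (-1) ψ)) ∧
    -- left translations are holomorphic isometries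
    (∀ a : Heis n, IsIsometricTransl a (solMetric n) ∧ IsHolomorphicTransl a (solJ n)) ∧
    -- the model at the end `φ → 0`
    (IsKahlerOn (halfSpace n) (cuspMetric n) (cuspJ n) ∧
      (∀ a : Heis n, IsIsometricTransl a (cuspMetric n) ∧ IsHolomorphicTransl a (cuspJ n)) ∧
      HasConstantHolSecCurvOn (halfSpace n) (cuspMetric n) (cuspJ n) (-2 / ((n : ℝ) + 2))) ∧
    -- asymptotics on the quotients by lattices
    Heis.IsLattice (Heis.integerLattice n) ∧
    (∀ Γ : Subgroup (Heis n), Heis.IsLattice Γ →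
      T2Space (Heis.Nil Γ) ∧
      IsQuotientCoveringMap (Quotient.mk (MulAction.orbitRel Γ (Heis n))) Γ ∧
      Heis.endZero Γ ≠ Heis.endInfty Γ ∧
      (∀ F : Filter (Heis.QuotSpace Γ), IsEnd F ↔ F = Heis.endZero Γ ∨ F = Heis.endInfty Γ) ∧
      Heis.IsAsymptoticallyConical Γ (Heis.endInfty Γ) (solMetric n) (linkMetric n) (toRadius n) ∧
      Heis.IsAsymptotic Γ (Heis.endZero Γ) (solMetric n) (cuspMetric n)) := by
  obtain ⟨σ, hσ⟩ := (isProfile_solProfile hn).exists_flow fun s hs => solProfile_lt hn hs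
  refine ⟨⟨isKahlerRicciSolitonOn_solMetric hn, isCompleteOn_solMetric hn⟩,
    fun p hp v hv => ricci_solMetric_bounds hn hp hv,
    fun p hp => scalarCurv_solMetric_bounds hn hp, exists_abs_secCurv_solMetric_le hn,
    ⟨solDiffeo n σ, hσ.isSolitonDiffeos (isProfile_solProfile hn),
      isRicciFlowOn_selfSimilarFlow hn hσ, isTypeIII_selfSimilarFlow hn hσ⟩,
    fun a => ⟨isIsometricTransl_heisMetric a _, isHolomorphicTransl_heisJ a _⟩,
    ⟨(isProfile_cusp n).isKahlerOn,
      fun a => ⟨isIsometricTransl_heisMetric a _, isHolomorphicTransl_heisJ a _⟩,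
      hasConstantHolSecCurvOn_cuspMetric n⟩,
    Heis.isLattice_integerLattice n, fun Γ hΓ => ⟨hΓ.t2Space, hΓ.isQuotientCoveringMap,
      Heis.endZero_ne_endInfty Γ, hΓ.isEnd_iff, isAsymptoticallyConical_solMetric hn Γ,
      isAsymptotic_solMetric_cuspMetric hn Γ⟩⟩
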